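/- **Setting.** Let $N\ge 1$, $\eta,\xi_1,\dots,\xi_N,\zeta_\pm,\kappa_\pm,\tau_\pm\in\mathbb C$ with $\sinh\zeta_\pm\ne0$, $\kappa_\pm\neq 0$, and let $\alpha_\pm,\beta_\pm$ satisfy $\sinh\alpha_\pm\cosh\beta_\pm=\frac{\sinh\zeta_\pm}{2\kappa_\pm}$, $\cosh\alpha_\pm\sinh\beta_\pm=\frac{\cosh\zeta_\pm}{2\kappa_\pm}$. Let $R(\lambda)$ be the six-vertex $R$-matrix on $\mathbb C^2\otimes\mathbb C^2$ (diagonal entries $\sinh(\lambda+\eta),\sinh\lambda,\sinh\lambda,\sinh(\lambda+\eta)$, off-diagonal entries $\sinh\eta$ between the two middle basis vectors), $$K(\lambda;\zeta,\kappa,\tau)=\frac1{\sinh\zeta}\begin{pmatrix}\sinh(\lambda-\frac\eta2+\zeta)&\kappa e^{\tau}\sinh(2\lambda-\eta)\\ \kappa e^{-\tau}\sinh(2\lambda-\eta)&\sinh(\zeta-\lambda+\frac\eta2)\end{pmatrix},$$ $K_-(\lambda)=K(\lambda;\zeta_-,\kappa_-,\tau_-)$, $K_+(\lambda)=K(\lambda+\eta;\zeta_+,\kappa_+,\tau_+)$.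 On $\mathcal H=(\mathbb C^2)^{\otimes N}$ with auxiliary space $0$ put $M(\lambda)=R_{0N}(\lambda-\xi_N-\frac\eta2)\cdots R_{01}(\lambda-\xi_1-\frac\eta2)$, $\hat M(\lambda)=(-1)^N\sigma^y_0M^{t_0}(-\lambda)\sigma^y_0$, $\mathcal U_-(\lambda)=M(\lambda)K_-(\lambda)\hat M(\lambda)$ and $\mathcal T(\lambda)=\mathrm{tr}_0\{K_+(\lambda)\mathcal U_-(\lambda)\}$. **Gauge transformation.** For $\alpha,\beta\in\mathbb C$ let $X(\lambda|\beta)=\binom{e^{-[\lambda+(\alpha+\beta)\eta]}}{1}$, $Y(\lambda|\beta)=\binom{e^{-[\lambda+(\alpha-\beta)\eta]}}{1}$, and define rows by $\bar X(\lambda|\beta)=\frac{e^{\lambda+\alpha\eta}}{2\sinh\beta\eta}(1,-e^{-[\lambda+(\alpha+\beta)\eta]})$, $\bar Y(\lambda|\beta)=\frac{e^{\lambda+\alpha\eta}}{2\sinh\beta\eta}(-1,e^{-[\lambda+(\alpha-\beta)\eta]})$, $\tilde X(\lambda|\beta)=e^\eta\frac{\sinh\beta\eta}{\sinh(\beta-1)\eta}\bar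 X(\lambda|\beta)$, $\tilde Y(\lambda|\beta)=e^\eta\frac{\sinh\beta\eta}{\sinh(\beta+1)\eta}\bar Y(\lambda|\beta)$, and columns $\hat X(\lambda|\beta+2)=e^\eta\frac{\sinh(\beta-1)\eta}{\sinh\beta\eta}X(\lambda|\beta+2)$, $\hat Y(\lambda|\beta-2)=e^\eta\frac{\sinh(\beta+1)\eta}{\sinh\beta\eta}Y(\lambda|\beta-2)$. Let $\tilde G(\lambda|\beta)$ have columns $X(\lambda|\beta+1),Y(\lambda|\beta-1)$, and $$e^{-\lambda+\eta/2}\,\tilde G^{-1}(\lambda-\tfrac\eta2|\beta)\,\mathcal U_-(\lambda)\,\tilde G(\tfrac\eta2-\lambda|\beta)=\begin{pmatrix}\mathcal A_-(\lambda|\beta+2)&\mathcal B_-(\lambda|\beta)\\ \mathcal C_-(\lambda|\beta+2)&\mathcal D_-(\lambda|\beta)\end{pmatrix}.$$ With $u=\frac\eta2-\lambda$, $v=\lambda-\frac\eta2$, $K_+=K_+(\lambda)$, let $$K_+^{(L)}(\lambda|\beta)=\begin{pmatrix}\tilde Y(u|\beta-2)K_+\hat X(v|\beta+2)&\tilde Y(u|\beta)K_+\hat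 Y(v|\beta-2)\\ \tilde X(u|\beta)K_+\hat X(v|\beta+2)&\tilde X(u|\beta+2)K_+\hat Y(v|\beta-2)\end{pmatrix},$$ $$K_+^{(R)}(\lambda|\beta)=\begin{pmatrix}\bar Y(u|\beta)K_+X(v|\beta)&\bar Y(u|\beta)K_+Y(v|\beta-2)\\ \bar X(u|\beta)K_+X(v|\beta+2)&\bar X(u|\beta)K_+Y(v|\beta)\end{pmatrix}.$$ **Functions and states.** Let $a(\lambda)=\prod_n\sinh(\lambda-\xi_n+\frac\eta2)$, $d(\lambda)=a(\lambda-\eta)$, $\det_qM(\lambda)=a(\lambda+\frac\eta2)d(\lambda-\frac\eta2)$, $\mathsf A_-(\lambda)=\frac{\sinh(\lambda+\alpha_--\eta/2)\cosh(\lambda+\beta_--\eta/2)}{\sinh\alpha_-\cosh\beta_-}a(\lambda)d(-\lambda)$, $\zeta_n^{(h)}=\xi_n+(h-\frac12)\eta$ for $h\in\{0,1\}$, $a_{\mathbf h}(\lambda)=\prod_n\sinh(\lambda-\zeta_n^{(h_n)})$ and $f_n(\beta)=\frac{\sinh(2\xi_n+\eta)\sinh\beta\eta}{\sinh(2\xi_n-\eta)\sinh(2\xi_n+\beta\eta)}$.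 For $\mathbf h\in\{0,1\}^N$ let $$\langle\beta,\mathbf h|=\langle\beta|\prod_{n=1}^N\Big(\tfrac{\mathcal A_-(\eta/2-\xi_n|\beta+2)}{\mathsf A_-(\eta/2-\xi_n)}\Big)^{h_n},\qquad |\beta,\mathbf h\rangle=\prod_{n=1}^N\Big(\tfrac{\mathcal D_-(\xi_n+\eta/2|\beta)}{f_n(\beta)\mathsf A_-(\eta/2-\xi_n)}\Big)^{1-h_n}|2-\beta\rangle,$$ $$\langle\beta,\mathbf h|_{\mathcal C}=\langle2-\beta|\prod_{n=1}^N\Big(\tfrac{\mathcal D_-(\eta/2-\xi_n|\beta-2)}{\mathsf A_-(\eta/2-\xi_n)}\Big)^{h_n},\qquad |\beta,\mathbf h\rangle_{\mathcal C}=\prod_{n=1}^N\Big(\tfrac{\mathcal A_-(\xi_n+\eta/2|\beta)}{f_n(2-\beta)\mathsf A_-(\eta/2-\xi_n)}\Big)^{1-h_n}|\beta\rangle,$$ with reference states $\langle\beta|=\bigotimes_n(-1,e^{-\alpha\eta+(N-n+\beta)\eta-\xi_n})$, $|\beta\rangle=\bigotimes_n\binom{e^{-\alpha\eta-(N-n+\beta)\eta-\xi_n}}{1}$.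 Put $$\mathsf B_{\mathbf h}(\lambda|\beta)=(-1)^Ne^{(\beta+N)\eta}a_{\mathbf h}(\lambda)a_{\mathbf h}(-\lambda)\frac{\sinh(2\lambda-\eta)\big(2\kappa_-\sinh[(N+\beta-\alpha-1)\eta-\tau_-]-e^{\zeta_-}\big)}{2\sinh\zeta_-\sinh\beta\eta},$$ $$\bar{\mathsf B}_{\mathbf h}(\lambda|\beta)=(-1)^Ne^{(\beta-N)\eta}\prod_n\Big(\tfrac{f_n(\beta+2)}{f_n(\beta)}\Big)^{1-h_n}a_{\mathbf h}(\lambda)a_{\mathbf h}(-\lambda)\frac{\sinh(2\lambda-\eta)\big(2\kappa_-\sinh[(\beta-1-N-\alpha)\eta-\tau_-]-e^{\zeta_-}\big)}{2\sinh\zeta_-\sinh\beta\eta},$$ $$\mathsf a_+(\lambda|\beta)=\tfrac{\sinh(2\lambda+\eta)\left[\sinh\zeta_+\cosh(\lambda-\frac\eta2)\sinh(\lambda+\frac\eta2+\beta\eta)-\cosh\zeta_+\sinh(\lambda-\frac\eta2)\cosh(\lambda+\frac\eta2+\beta\eta)-\kappa_+\sinh(2\lambda-\eta)\sinh(\tau_++(\alpha+2)\eta)\right]}{\sinh2\lambda\,\sinh(\beta+1)\eta\,\sinh\zeta_+},$$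 $$\mathsf d_+(\lambda|\beta)=\tfrac{\sinh(2\lambda+\eta)\left[\sinh\zeta_+\cosh(\lambda-\frac\eta2)\sinh(-\lambda-\frac\eta2+\beta\eta)+\cosh\zeta_+\sinh(\lambda-\frac\eta2)\cosh(-\lambda-\frac\eta2+\beta\eta)+\kappa_+\sinh(2\lambda-\eta)\sinh(\tau_++\alpha\eta)\right]}{\sinh2\lambda\,\sinh(\beta-1)\eta\,\sinh\zeta_+}.$$ Let $\mathcal F$ be the set of functions $t:\mathbb C\to\mathbb C$ such that for all $\lambda$, with $c=\cosh2\lambda$, $c_b=\cosh2\zeta_b^{(0)}$, $$\begin{aligned}t(\lambda)=&\sum_{a=1}^N\frac{c^2-\cosh^2\eta}{c_a^2-\cosh^2\eta}\prod_{b\ne a}\frac{c-c_b}{c_a-c_b}\,t(\zeta_a^{(0)})+(-1)^N(c+\cosh\eta)\prod_b\frac{c-c_b}{\cosh\eta-c_b}\,\textstyle\det_qM(0)\\&+(-1)^N(c-\cosh\eta)\prod_b\frac{c-c_b}{\cosh\eta+c_b}\coth\zeta_-\coth\zeta_+\,\textstyle\det_qM(\tfrac{i\pi}2)+\frac{2^{1-N}\kappa_+\kappa_-\cosh(\tau_+-\tau_-)}{\sinh\zeta_+\sinh\zeta_-}(c^2-\cosh^2\eta)\prod_b(c-c_b).\end{aligned}$$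 **SOV representation.** Let $x_n,y_n\in\mathbb C$. For a function $\Psi$ on $\{0,1\}^N$ (scalar or vector valued) let $(S_n\Psi)(\mathbf h)=x_n\Psi(h_1,\dots,1,\dots,h_N)$ if $h_n=0$ and $(S_n\Psi)(\mathbf h)=y_n\Psi(h_1,\dots,0,\dots,h_N)$ if $h_n=1$ (the $n$-th entry is changed). A basis $(\langle E_{\mathbf h}|)_{\mathbf h}$ of covectors is a *left SOV representation for the spectral problem of $\mathcal T$ with coefficients $(x_n,y_n)$* if $\langle E_{\mathbf h}|\mathcal T(\pm\zeta_n^{(h_n)})=(S_n\langle E|)(\mathbf h)$ for all $n,\mathbf h$, and for every $t:\mathbb C\to\mathbb C$ and every $v\ne0$ in $\mathcal H$: $\mathcal T(\lambda)v=t(\lambda)v$ for all $\lambda$ if and only if $t\in\mathcal F$ and the wave function $\Psi(\mathbf h)=\langle E_{\mathbf h}|v\rangle$ satisfies the separate Baxter-like equations $t(\zeta_n^{(h_n)})\Psi(\mathbf h)=(S_n\Psi)(\mathbf h)$ for all $n,\mathbf h$. *Right SOV representations* are defined in the same way, with a basis of vectors $|E_{\mathbf h}\rangle$ and with left eigenvectors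 $w$ and $\Psi(\mathbf h)=\langle w|E_{\mathbf h}\rangle$. **Assumptions on gauge parameter and inhomogeneities.** (G0) $\sinh(\beta+m)\eta\ne0$ for all $m\in\mathbb Z$. (G1) $\sinh(\xi_a\pm\xi_b+r\eta)\ne0$ for $a\ne b$, $r\in\{-1,0,1\}$; $\sinh(2\xi_a+r\eta)\neq0$ for $r\in\{-2,\dots,2\}$; $\mathsf A_-(\frac\eta2\pm\xi_a)\ne0$. **Theorem.** Assume (G0). (b) If for some $k\in\mathbb Z$: $(\alpha-\beta+2)\eta=-\tau_++(-1)^k(\alpha_+-\beta_+)+i\pi k$, then $K_+^{(L)}(\lambda|\beta-1)_{12}=K_+^{(R)}(\lambda|\beta-1)_{12}=0$ for all $\lambda$. Suppose moreover (G1) and $(\alpha-\beta)\eta\ne(N-3-2j)\eta-\tau_--(-1)^k(\alpha_-+\beta_-)+i\pi k$ for all $0\le j\le N-1$, $k\in\mathbb Z$. Then: - (I$_b$) the covectors $\langle\beta-2,\mathbf h|$ are a basis, $\langle\beta-2,\mathbf h|\mathcal B_-(\lambda|\beta-2)=\mathsf B_{\mathbf h}(\lambda|\beta-2)\langle\beta-4,\mathbf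 h|$, the functions $\mathsf B_{\mathbf h}(\cdot|\beta-2)$ are nonzero and pairwise distinct, and this basis is a left SOV representation for the spectral problem of $\mathcal T$, with $x_n=\mathsf a_+(-\zeta_n^{(0)}|\beta-1)\mathsf A_-(-\zeta_n^{(0)})$ and $y_n=\mathsf a_+(\zeta_n^{(1)}|\beta-1)\mathsf A_-(\zeta_n^{(1)})$; - (II$_b$) if $\sinh(2\xi_n+\beta\eta)\ne0\neq\sinh(2\xi_n+(\beta+2)\eta)$ for all $n$, the vectors $|\beta,\mathbf h\rangle$ are a basis, $\mathcal B_-(\lambda|\beta)|\beta,\mathbf h\rangle=\bar{\mathsf B}_{\mathbf h}(\lambda|\beta)|\beta+2,\mathbf h\rangle$, the functions $\bar{\mathsf B}_{\mathbf h}(\cdot|\beta)$ are nonzero and pairwise distinct, and this basis is a right SOV representation for the spectral problem of $\mathcal T$, with $x_n=\mathsf d_+(-\zeta_n^{(0)}|\beta-1)\mathsf A_-(\zeta_n^{(1)})/f_n(\beta)$ and $y_n=\mathsf d_+(\zeta_n^{(1)}|\beta-1)f_n(\beta)\mathsf A_-(-\zeta_n^{(0)})$. (c) If for some $k\in\mathbb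 Z$: $(\alpha+\beta)\eta=-\tau_++(-1)^k(\alpha_+-\beta_+)+i\pi k$, then $K_+^{(L)}(\lambda|\beta-1)_{21}=K_+^{(R)}(\lambda|\beta-1)_{21}=0$ for all $\lambda$. Suppose moreover (G1) and $(\alpha+\beta)\eta\ne(N-1-2j)\eta-\tau_--(-1)^k(\alpha_-+\beta_-)+i\pi k$ for all $0\le j\le N-1$, $k\in\mathbb Z$. Then: - (I$_c$) the covectors $\langle\beta+2,\mathbf h|_{\mathcal C}$ are a basis, $\langle\beta+2,\mathbf h|_{\mathcal C}\,\mathcal C_-(\lambda|\beta+2)=\mathsf B_{\mathbf h}(\lambda|-\beta)\langle\beta+4,\mathbf h|_{\mathcal C}$, these pseudo-eigenvalues are nonzero and pairwise distinct, and this basis is a left SOV representation for the spectral problem of $\mathcal T$, with $x_n=\mathsf a_+(-\zeta_n^{(0)}|1-\beta)\mathsf A_-(-\zeta_n^{(0)})$ and $y_n=\mathsf a_+(\zeta_n^{(1)}|1-\beta)\mathsf A_-(\zeta_n^{(1)})$; - (II$_c$) if $\sinh(2\xi_n+(2-\beta)\eta)\ne0\ne\sinh(2\xi_n+(4-\beta)\eta)$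 for all $n$, the vectors $|\beta,\mathbf h\rangle_{\mathcal C}$ are a basis, $\mathcal C_-(\lambda|\beta)|\beta,\mathbf h\rangle_{\mathcal C}=\bar{\mathsf B}_{\mathbf h}(\lambda|2-\beta)|\beta-2,\mathbf h\rangle_{\mathcal C}$, these pseudo-eigenvalues are nonzero and pairwise distinct, and this basis is a right SOV representation for the spectral problem of $\mathcal T$, with $x_n=\mathsf d_+(-\zeta_n^{(0)}|1-\beta)\mathsf A_-(\zeta_n^{(1)})/f_n(2-\beta)$ and $y_n=\mathsf d_+(\zeta_n^{(1)}|1-\beta)f_n(2-\beta)\mathsf A_-(-\zeta_n^{(0)})$. -/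

import Mathlib

open Complex Matrix

noncomputable section

namespace OpenXXZ

/-- Spin configurations of a chain with `N` sites; the index `0` is the first vector of the
standard basis of `ℂ²`. They index the standard basis of `(ℂ²)^{⊗N}`. -/
abbrev Conf (N : ℕ) := Fin N → Fin 2

/-- Vectors (and covectors) of the quantum space, in coordinates. -/
abbrev Vect (N : ℕ) := Conf N → ℂ

/-- Operators on the quantum space. -/
abbrev Op (N : ℕ) := Matrix (Conf N) (Conf N) ℂ

/-- Operators on auxiliary space `ℂ²` tensor quantum space, as `2 × 2` matrices of operators. -/
abbrev AuxOp (N : ℕ) := Matrix (Fin 2) (Fin 2) (Op N)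

/-- Parameters of the inhomogeneous open spin-1/2 XXZ chain: crossing parameter `η`,
inhomogeneities `ξ`, and the parameters `ζ, κ, τ` of the boundary matrices `K₋`, `K₊`. -/
structure Chain (N : ℕ) where
  η : ℂ
  ξ : Fin N → ℂ
  ζm : ℂ
  κm : ℂ
  τm : ℂ
  ζp : ℂ
  κp : ℂ
  τp : ℂ

/-- The six-vertex trigonometric `R`-matrix on `ℂ² ⊗ ℂ²`. -/
def RMatrix (η l : ℂ) : Matrix (Fin 2 × Fin 2) (Fin 2 × Fin 2) ℂ :=
  Matrix.of fun p q =>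
    if p = q then (if p.1 = p.2 then sinh (l + η) else sinh l)
    else if p = q.swap then sinh η else 0

/-- The scalar solution `K(l; ζ, κ, τ)` of the reflection equation. -/
def KMatrix (η ζ κ τ l : ℂ) : Matrix (Fin 2) (Fin 2) ℂ :=
  (1 / sinh ζ) •
    !![sinh (l - η / 2 + ζ), κ * exp τ * sinh (2 * l - η);
       κ * exp (-τ) * sinh (2 * l - η), sinh (ζ - l + η / 2)]

/-- The operator acting as `m` on site `n` and as the identity on the other sites. -/
def siteOp {N : ℕ} (n : Fin N) (m : Matrix (Fin 2) (Fin 2) ℂ) : Op N :=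
  Matrix.of fun s t => if ∀ j, j ≠ n → s j = t j then m (s n) (t n) else 0

/-- A `2 × 2` scalar matrix acting on the auxiliary space. -/
def lift {N : ℕ} (A : Matrix (Fin 2) (Fin 2) ℂ) : AuxOp N :=
  A.map (algebraMap ℂ (Op N))

namespace Chain

variable {N : ℕ} (p : Chain N)

/-! ### Monodromy matrices and transfer matrix -/

/-- `R_{0n}(l)`: the `R`-matrix on auxiliary space times site `n`. -/
def R0 (n : Fin N) (l : ℂ) : AuxOp N :=
  Matrix.of fun i j => siteOp n (Matrix.of fun a b => RMatrix p.η l (i, a) (j, b))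

/-- `M(l) = R_{0N}(l - ξ_N - η/2) ⋯ R_{01}(l - ξ_1 - η/2)`. -/
def M (l : ℂ) : AuxOp N :=
  ((List.finRange N).reverse.map fun n => p.R0 n (l - p.ξ n - p.η / 2)).prod

/-- `M̂(l) = (-1)^N σ₀ʸ M^{t₀}(-l) σ₀ʸ`; the transposition is in the auxiliary space only. -/
def Mhat (l : ℂ) : AuxOp N :=
  (-1 : ℂ) ^ N • (lift !![0, -I; I, 0] * (p.M (-l))ᵀ * lift !![0, -I; I, 0])

def Kminus (l : ℂ) : Matrix (Fin 2) (Fin 2) ℂ := KMatrix p.η p.ζm p.κm p.τm l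

def Kplus (l : ℂ) : Matrix (Fin 2) (Fin 2) ℂ := KMatrix p.η p.ζp p.κp p.τp (l + p.η)

/-- The double-row monodromy matrix `𝒰₋(l) = M(l) K₋(l) M̂(l)`. -/
def Uminus (l : ℂ) : AuxOp N := p.M l * lift (p.Kminus l) * p.Mhat l

/-- The boundary transfer matrix `𝒯(l) = tr₀ {K₊(l) 𝒰₋(l)}`. -/
def transfer (l : ℂ) : Op N := (lift (p.Kplus l) * p.Uminus l).trace

/-! ### Gauge transformation, with gauge parameters `α` and `b` -/

/-- The column `X(l|b)`. -/
def X (α b l : ℂ) : Fin 2 → ℂ := ![exp (-(l + (α + b) * p.η)), 1]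

/-- The column `Y(l|b)`. -/
def Y (α b l : ℂ) : Fin 2 → ℂ := ![exp (-(l + (α - b) * p.η)), 1]

/-- The row `X̄(l|b)`. -/
def Xbar (α b l : ℂ) : Fin 2 → ℂ :=
  (exp (l + α * p.η) / (2 * sinh (b * p.η))) • ![1, -exp (-(l + (α + b) * p.η))]

/-- The row `Ȳ(l|b)`. -/
def Ybar (α b l : ℂ) : Fin 2 → ℂ :=
  (exp (l + α * p.η) / (2 * sinh (b * p.η))) • ![-1, exp (-(l + (α - b) * p.η))]

/-- The row `X̃(l|b)`. -/
def Xtil (α b l : ℂ) : Fin 2 → ℂ :=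
  (exp p.η * (sinh (b * p.η) / sinh ((b - 1) * p.η))) • p.Xbar α b l

/-- The row `Ỹ(l|b)`. -/
def Ytil (α b l : ℂ) : Fin 2 → ℂ :=
  (exp p.η * (sinh (b * p.η) / sinh ((b + 1) * p.η))) • p.Ybar α b l

/-- The column `X̂(l|b)`; thus `X̂(l|b+2) = e^η (sinh (b-1)η / sinh bη) X(l|b+2)`. -/
def Xhat (α b l : ℂ) : Fin 2 → ℂ :=
  (exp p.η * (sinh ((b - 3) * p.η) / sinh ((b - 2) * p.η))) • p.X α b l

/-- The column `Ŷ(l|b)`; thus `Ŷ(l|b-2) = e^η (sinh (b+1)η / sinh bη) Y(l|b-2)`. -/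
def Yhat (α b l : ℂ) : Fin 2 → ℂ :=
  (exp p.η * (sinh ((b + 3) * p.η) / sinh ((b + 2) * p.η))) • p.Y α b l

/-- The gauge matrix `G̃(l|b)` with columns `X(l|b+1)` and `Y(l|b-1)`. -/
def Gtil (α b l : ℂ) : Matrix (Fin 2) (Fin 2) ℂ :=
  Matrix.of fun i j => ![p.X α (b + 1) l i, p.Y α (b - 1) l i] j

/-- The gauge transformed double-row monodromy matrix
`𝒰₋(l|b) = e^{-l+η/2} G̃⁻¹(l-η/2|b) 𝒰₋(l) G̃(η/2-l|b)`. -/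
def Ugauge (α b l : ℂ) : AuxOp N :=
  exp (-l + p.η / 2) •
    (lift (p.Gtil α b (l - p.η / 2))⁻¹ * p.Uminus l * lift (p.Gtil α b (p.η / 2 - l)))

/-! The entries of `𝒰₋(l|b)` are `𝒜₋(l|b+2)`, `ℬ₋(l|b)`, `𝒞₋(l|b+2)`, `𝒟₋(l|b)`. -/

/-- `𝒜₋(l|b)` -/
def opA (α b l : ℂ) : Op N := p.Ugauge α (b - 2) l 0 0

/-- `ℬ₋(l|b)` -/
def opB (α b l : ℂ) : Op N := p.Ugauge α b l 0 1

/-- `𝒞₋(l|b)` -/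
def opC (α b l : ℂ) : Op N := p.Ugauge α (b - 2) l 1 0

/-- `𝒟₋(l|b)` -/
def opD (α b l : ℂ) : Op N := p.Ugauge α b l 1 1

/-- The left gauge transformed boundary matrix `K₊^{(L)}(l|b)`. -/
def KL (α b l : ℂ) : Matrix (Fin 2) (Fin 2) ℂ :=
  !![p.Ytil α (b - 2) (p.η / 2 - l) ⬝ᵥ (p.Kplus l *ᵥ p.Xhat α (b + 2) (l - p.η / 2)),
     p.Ytil α b (p.η / 2 - l) ⬝ᵥ (p.Kplus l *ᵥ p.Yhat α (b - 2) (l - p.η / 2));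
     p.Xtil α b (p.η / 2 - l) ⬝ᵥ (p.Kplus l *ᵥ p.Xhat α (b + 2) (l - p.η / 2)),
     p.Xtil α (b + 2) (p.η / 2 - l) ⬝ᵥ (p.Kplus l *ᵥ p.Yhat α (b - 2) (l - p.η / 2))]

/-- The right gauge transformed boundary matrix `K₊^{(R)}(l|b)`. -/
def KR (α b l : ℂ) : Matrix (Fin 2) (Fin 2) ℂ :=
  !![p.Ybar α b (p.η / 2 - l) ⬝ᵥ (p.Kplus l *ᵥ p.X α b (l - p.η / 2)),
     p.Ybar α b (p.η / 2 - l) ⬝ᵥ (p.Kplus l *ᵥ p.Y α (b - 2) (l - p.η / 2));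
     p.Xbar α b (p.η / 2 - l) ⬝ᵥ (p.Kplus l *ᵥ p.X α (b + 2) (l - p.η / 2)),
     p.Xbar α b (p.η / 2 - l) ⬝ᵥ (p.Kplus l *ᵥ p.Y α b (l - p.η / 2))]

/-! ### Scalar functions -/

def aFun (l : ℂ) : ℂ := ∏ n, sinh (l - p.ξ n + p.η / 2)

def dFun (l : ℂ) : ℂ := p.aFun (l - p.η)

/-- The bulk quantum determinant. -/
def detqM (l : ℂ) : ℂ := p.aFun (l + p.η / 2) * p.dFun (l - p.η / 2)

/-- `g₋(l)`, in terms of the parameters `α₋ = αm` and `β₋ = βm`. -/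
def gMinus (αm βm l : ℂ) : ℂ :=
  sinh (l + αm - p.η / 2) * cosh (l + βm - p.η / 2) / (sinh αm * cosh βm)

/-- `𝖠₋(l) = g₋(l) a(l) d(-l)`. -/
def AMinus (αm βm l : ℂ) : ℂ := p.gMinus αm βm l * p.aFun l * p.dFun (-l)

/-- `ζ_n^{(h)} = ξ_n + (h - 1/2) η`: the separate variables. -/
def sep (n : Fin N) (h : Fin 2) : ℂ := p.ξ n + (((h : ℕ) : ℂ) - 1 / 2) * p.η

/-- `a_h(l) = ∏ sinh (l - ξ_n - (h_n - 1/2) η)`. -/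
def aConf (h : Conf N) (l : ℂ) : ℂ := ∏ n, sinh (l - p.sep n (h n))

/-- The normalization `f_n(b)`. -/
def fNorm (b : ℂ) (n : Fin N) : ℂ :=
  sinh (2 * p.ξ n + p.η) * sinh (b * p.η) /
    (sinh (2 * p.ξ n - p.η) * sinh (2 * p.ξ n + b * p.η))

/-- The coefficient `𝖺₊(l|b)` of `𝒜₋(l|b+1)` in the transfer matrix. -/
def aPlus (α b l : ℂ) : ℂ :=
  sinh (2 * l + p.η) / (sinh (2 * l) * sinh ((b + 1) * p.η) * sinh p.ζp) *
    (sinh p.ζp * cosh (l - p.η / 2) * sinh (l + p.η / 2 + b * p.η)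
      - (cosh p.ζp * sinh (l - p.η / 2) * cosh (l + p.η / 2 + b * p.η)
        + p.κp * sinh (2 * l - p.η) * sinh (p.τp + (α + 2) * p.η)))

/-- The coefficient `𝖽₊(l|b)` of `𝒟₋(l|b+1)` in the transfer matrix. -/
def dPlus (α b l : ℂ) : ℂ :=
  sinh (2 * l + p.η) / (sinh (2 * l) * sinh ((b - 1) * p.η) * sinh p.ζp) *
    (sinh p.ζp * cosh (l - p.η / 2) * sinh (-l - p.η / 2 + b * p.η)
      + (cosh p.ζp * sinh (l - p.η / 2) * cosh (-l - p.η / 2 + b * p.η)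
        + p.κp * sinh (2 * l - p.η) * sinh (p.τp + α * p.η)))

/-! ### The left and right SOV states -/

/-- The left reference state `⟨b|`; the site `n` of `Fin N` is the site number `n + 1`. -/
def leftRef (α b : ℂ) : Vect N := fun s =>
  ∏ n : Fin N,
    (![-1, exp (-(α * p.η) + ((N : ℂ) - (((n : ℕ) : ℂ) + 1) + b) * p.η - p.ξ n)] :
      Fin 2 → ℂ) (s n)

/-- The right reference state `|b⟩`. -/
def rightRef (α b : ℂ) : Vect N := fun s =>
  ∏ n : Fin N,
    (![exp (-(α * p.η) - ((N : ℂ) - (((n : ℕ) : ℂ) + 1) + b) * p.η - p.ξ n), 1] :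
      Fin 2 → ℂ) (s n)

/-- `⟨b, h| = ⟨b| ∏ₙ (𝒜₋(η/2-ξ_n|b+2) / 𝖠₋(η/2-ξ_n))^{h_n}`. -/
def leftB (αm βm α b : ℂ) (h : Conf N) : Vect N :=
  p.leftRef α b ᵥ*
    ((List.finRange N).map fun n =>
      ((p.AMinus αm βm (p.η / 2 - p.ξ n))⁻¹ • p.opA α (b + 2) (p.η / 2 - p.ξ n))
        ^ (h n : ℕ)).prod

/-- `|b, h⟩ = ∏ₙ (𝒟₋(ξ_n+η/2|b) / (f_n(b) 𝖠₋(η/2-ξ_n)))^{1-h_n} |-b+2⟩`. -/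
def rightB (αm βm α b : ℂ) (h : Conf N) : Vect N :=
  ((List.finRange N).map fun n =>
      ((p.fNorm b n * p.AMinus αm βm (p.η / 2 - p.ξ n))⁻¹ • p.opD α b (p.ξ n + p.η / 2))
        ^ (1 - (h n : ℕ))).prod *ᵥ
    p.rightRef α (-b + 2)

/-- The left states for `𝒞₋(l|b)`, obtained from those of `ℬ₋` by the symmetry
`ℬ₋(l|b) = 𝒞₋(l|2-b)`, `𝒜₋(l|b) = 𝒟₋(l|2-b)`:
`⟨2-b| ∏ₙ (𝒟₋(η/2-ξ_n|b-2) / 𝖠₋(η/2-ξ_n))^{h_n}`. -/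
def leftC (αm βm α b : ℂ) (h : Conf N) : Vect N :=
  p.leftRef α (2 - b) ᵥ*
    ((List.finRange N).map fun n =>
      ((p.AMinus αm βm (p.η / 2 - p.ξ n))⁻¹ • p.opD α (b - 2) (p.η / 2 - p.ξ n))
        ^ (h n : ℕ)).prod

/-- The right states for `𝒞₋(l|b)`:
`∏ₙ (𝒜₋(ξ_n+η/2|b) / (f_n(2-b) 𝖠₋(η/2-ξ_n)))^{1-h_n} |b⟩`. -/
def rightC (αm βm α b : ℂ) (h : Conf N) : Vect N :=
  ((List.finRange N).map fun n =>
      ((p.fNorm (2 - b) n * p.AMinus αm βm (p.η / 2 - p.ξ n))⁻¹ • p.opA α b (p.ξ n + p.η / 2))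
        ^ (1 - (h n : ℕ))).prod *ᵥ
    p.rightRef α b

/-- The left pseudo-eigenvalue of `ℬ₋(l|b)` (and of `𝒞₋(l|2-b)`). -/
def leftVal (α b : ℂ) (h : Conf N) (l : ℂ) : ℂ :=
  (-1) ^ N * exp ((b + N) * p.η) * p.aConf h l * p.aConf h (-l) *
    (sinh (2 * l - p.η) * (2 * p.κm * sinh ((N + b - α - 1) * p.η - p.τm) - exp p.ζm) /
      (2 * sinh p.ζm * sinh (b * p.η)))

/-- The right pseudo-eigenvalue of `ℬ₋(l|b)` (and of `𝒞₋(l|2-b)`). -/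
def rightVal (α b : ℂ) (h : Conf N) (l : ℂ) : ℂ :=
  (-1) ^ N * exp ((b - N) * p.η) *
    (∏ n, (p.fNorm (b + 2) n / p.fNorm b n) ^ (1 - (h n : ℕ))) *
    p.aConf h l * p.aConf h (-l) *
    (sinh (2 * l - p.η) * (2 * p.κm * sinh ((b - (1 + N + α)) * p.η - p.τm) - exp p.ζm) /
      (2 * sinh p.ζm * sinh (b * p.η)))

/-- Genericity of the inhomogeneities: the `2N` numbers `cosh 2ζ_n^{(h)}` are distinct, different
from `± cosh η` and from `± 1`, all shifts by `η` occurring in the commutation relations are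
regular, and the quantum determinant of `𝒰₋` does not vanish at the `ξ_n`. -/
def Generic (αm βm : ℂ) : Prop :=
  (∀ a b : Fin N, a ≠ b → ∀ r : ℤ, |r| ≤ 1 →
    sinh (p.ξ a - p.ξ b + r * p.η) ≠ 0 ∧ sinh (p.ξ a + p.ξ b + r * p.η) ≠ 0) ∧
  (∀ a : Fin N, ∀ r : ℤ, |r| ≤ 2 → sinh (2 * p.ξ a + r * p.η) ≠ 0) ∧
  (∀ a : Fin N, p.AMinus αm βm (p.η / 2 - p.ξ a) ≠ 0 ∧ p.AMinus αm βm (p.η / 2 + p.ξ a) ≠ 0)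

/-- The class of functions to which all eigenvalues of the transfer matrix belong: polynomials of
degree at most `N + 2` in `cosh 2l` with the (central) leading coefficient and central values at
`l = η/2`, `l = η/2 + iπ/2` of the transfer matrix, written by interpolation at the `ζ_a^{(0)}`. -/
def spectralClass : Set (ℂ → ℂ) :=
  {t | ∀ l : ℂ, t l =
    (∑ a, (cosh (2 * l) ^ 2 - cosh p.η ^ 2) / (cosh (2 * p.sep a 0) ^ 2 - cosh p.η ^ 2) *
      (∏ b ∈ Finset.univ.erase a, (cosh (2 * l) - cosh (2 * p.sep b 0)) /
        (cosh (2 * p.sep a 0) - cosh (2 * p.sep b 0))) * t (p.sep a 0))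
    + (-1) ^ N * (cosh (2 * l) + cosh p.η) *
      (∏ b, (cosh (2 * l) - cosh (2 * p.sep b 0)) / (cosh p.η - cosh (2 * p.sep b 0))) *
      p.detqM 0
    + (-1) ^ N * (cosh (2 * l) - cosh p.η) *
      (∏ b, (cosh (2 * l) - cosh (2 * p.sep b 0)) / (cosh p.η + cosh (2 * p.sep b 0))) *
      (cosh p.ζm / sinh p.ζm) * (cosh p.ζp / sinh p.ζp) * p.detqM (I * Real.pi / 2)
    + 2 * p.κp * p.κm * cosh (p.τp - p.τm) / (2 ^ N * sinh p.ζp * sinh p.ζm) *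
      (cosh (2 * l) ^ 2 - cosh p.η ^ 2) * ∏ b, (cosh (2 * l) - cosh (2 * p.sep b 0))}

end Chain

/-! ### Pseudo-diagonalizability and separation of variables -/

section General

variable {N : ℕ}

/-- The family `E` of vectors, indexed by configurations, is a basis of the quantum space. -/
def IsStateBasis (E : Conf N → Vect N) : Prop :=
  LinearIndependent ℂ E ∧ Submodule.span ℂ (Set.range E) = ⊤

/-- The family of operators `O` is left pseudo-diagonal with simple pseudo-spectrum:
`⟨E_h| O(l) = v_h(l) ⟨E'_h|` with `E` a basis and the functions `v_h` nonzero and distinct. -/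
def IsLeftPseudoDiagonal (O : ℂ → Op N) (E E' : Conf N → Vect N) (v : Conf N → ℂ → ℂ) : Prop :=
  IsStateBasis E ∧ (∀ h l, E h ᵥ* O l = v h l • E' h) ∧ (∀ h, v h ≠ 0) ∧ Function.Injective v

/-- The family of operators `O` is right pseudo-diagonal with simple pseudo-spectrum:
`O(l) |E_h⟩ = v_h(l) |E'_h⟩` with `E` a basis and the functions `v_h` nonzero and distinct. -/
def IsRightPseudoDiagonal (O : ℂ → Op N) (E E' : Conf N → Vect N) (v : Conf N → ℂ → ℂ) : Prop :=
  IsStateBasis E ∧ (∀ h l, O l *ᵥ E h = v h l • E' h) ∧ (∀ h, v h ≠ 0) ∧ Function.Injective v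

/-- The separate shift operator in the `n`-th variable: it sends `Ψ` to the function with value
`up_n Ψ(h_1, …, 1, …, h_N)` if `h_n = 0` and `down_n Ψ(h_1, …, 0, …, h_N)` if `h_n = 1`. -/
def sepShift {V : Type} [SMul ℂ V] (up down : Fin N → ℂ) (n : Fin N) (Ψ : Conf N → V)
    (h : Conf N) : V :=
  if h n = 0 then up n • Ψ (Function.update h n 1) else down n • Ψ (Function.update h n 0)

/-- The basis of covectors `E` is a left SOV representation for the spectral problem of the family
`T`, with separate variables `z n h` and coefficients `up`, `down`, within the class `F`
of functions: `T(z_n)` acts by a shift in the `n`-th variable only, and the spectral problem for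
`T` is equivalent to the separate Baxter-like equations, one for each variable `n` and each `h`,
for the wave function `Ψ(h) = ⟨E_h|v⟩`. -/
def IsLeftSOV (T : ℂ → Op N) (F : Set (ℂ → ℂ)) (z : Fin N → Fin 2 → ℂ) (up down : Fin N → ℂ)
    (E : Conf N → Vect N) : Prop :=
  IsStateBasis E ∧
  (∀ n h, E h ᵥ* T (z n (h n)) = sepShift up down n E h ∧
    E h ᵥ* T (-z n (h n)) = sepShift up down n E h) ∧
  ∀ (t : ℂ → ℂ) (v : Vect N), v ≠ 0 →
    ((∀ l, T l *ᵥ v = t l • v) ↔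
      t ∈ F ∧ ∀ n h, t (z n (h n)) * (E h ⬝ᵥ v) = sepShift up down n (fun k => E k ⬝ᵥ v) h)

/-- The basis of vectors `E` is a right SOV representation for the spectral problem of `T`: the
same as `IsLeftSOV`, for the left eigenstates `w` and their wave functions `Ψ(h) = ⟨w|E_h⟩`. -/
def IsRightSOV (T : ℂ → Op N) (F : Set (ℂ → ℂ)) (z : Fin N → Fin 2 → ℂ) (up down : Fin N → ℂ)
    (E : Conf N → Vect N) : Prop :=
  IsStateBasis E ∧
  (∀ n h, T (z n (h n)) *ᵥ E h = sepShift up down n E h ∧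
    T (-z n (h n)) *ᵥ E h = sepShift up down n E h) ∧
  ∀ (t : ℂ → ℂ) (w : Vect N), w ≠ 0 →
    ((∀ l, w ᵥ* T l = t l • w) ↔
      t ∈ F ∧ ∀ n h, t (z n (h n)) * (w ⬝ᵥ E h) = sepShift up down n (fun k => w ⬝ᵥ E k) h)

end General

end OpenXXZ

end

namespace OpenXXZ

/-! ### Operators acting on one site -/

section SiteOperators

variable {N : ℕ}

/-! The gauge transformation enters through one number, z = `gaugeParam α b`. Up to a nonzero scalar
ℬ₋(l|b) is `Bz z l`, and 𝒜₋(l|b+2) is `Az z l` plus a multiple of `Bz z l` (`opB_eq`, `opA_eq`).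
Since 𝒞₋ and 𝒟₋ are ℬ₋ and 𝒜₋ at 2 - b, part (c) is part (b) at 2 - β. The algebra of `Az` and `Bz`
rests on four properties of 𝒰₋, each proved by adding sites one at a time around K₋: the reflection
equation (`Ulist_reflection`), the parity relation between 𝒰₋(-l) and 𝒰₋(l) (`Ulist_crossParity`),
the inversion relation (`Ulist_inversion`), and the vanishing of the product fused to auxiliary spin
one at η/2 - ξ_n (`auxSym_mul_Ulist`).

A product covector of local gauge vectors is mapped by `Bz z` to a multiple of the one with
parameter z e^{-2η} and is annihilated by `Az z (ξ_n - η/2)`. Applying `Az z (η/2 - ξ_n)` at chosen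
sites gives the separate covectors `sepCov`. On these, `Bz z` vanishes at the separate points, so
the exchange relations lose their unwanted terms: the raising operators commute, each moves a pair
of zeros of the pseudo-eigenvalue from ±ζ_n^{(0)} to ±ζ_n^{(1)}, inversion undoes the raising, and
fusion annihilates the remaining case. Successive `Bz`, evaluated at suitable zeros, isolate any
single covector in a linear relation, which proves the basis property (`isStateBasis_sepConf`). The
condition involving α₋ + β₋ says that the boundary factor of the pseudo-eigenvalue is nonzero at
each of the N gauge steps.

The condition involving α₊ - β₊ amounts to 2κ₊ sinh((α-β+2)η + τ₊) = -e^{-ζ₊}. Under it the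
off-diagonal entry of the gauged K₊ vanishes, and 𝒯(l) is a combination of `Az z l`, `Az z (-l)` and
`Bz z l` (`transfer_eq`). At a separate point the `Bz` term drops out and one `Az` term annihilates,
so 𝒯 acts as a shift in one variable (`sepConf_vecMul_transfer`).

For the equivalence with the Baxter equations, 𝒯 is even, iπ-periodic and a Laurent polynomial in
e^l, with scalar leading coefficient and scalar values at η/2 and η/2 + iπ/2; so it is interpolated
from the N points ζ_a^{(0)} (`transfer_interpolation`). For fixed h the pairing of the covector of h
with (𝒯(l) - t(l))v, with t in the class, has no scalar part left and is determined by its values at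
the N points ζ_n^{(h_n)}, where the Baxter equations make it zero (`isLeftSOV_of_action`,
`interpCoeff_eq_zero`).

Right states need no second construction. Transposition in all spaces gives the chain with ξ, τ₋, τ₊
negated (`dual`), replaces z by -1/z and reverses all spins; right states are multiples of separate
covectors of the dual chain (`rightB_eq_sepConf`). -/

theorem siteOp_mulVec (n : Fin N) (m : Matrix (Fin 2) (Fin 2) ℂ) (v : Vect N) (s : Conf N) :
    (siteOp n m *ᵥ v) s = ∑ a, m (s n) a * v (Function.update s n a) := by
  classical
  have hinj : Function.Injective fun a : Fin 2 => Function.update s n a :=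
    Function.update_injective s n
  simp only [mulVec, dotProduct, siteOp, of_apply, ite_mul, zero_mul]
  rw [← Finset.sum_filter]
  symm
  refine Finset.sum_bij (fun a _ => Function.update s n a) ?_ ?_ ?_ ?_
  · intro a _
    simp only [Finset.mem_filter, Finset.mem_univ, true_and]
    intro j hj
    simp [hj]
  · intro a _ b _ h
    exact hinj h
  · intro t ht
    simp only [Finset.mem_filter, Finset.mem_univ, true_and] at ht
    refine ⟨t n, Finset.mem_univ _, ?_⟩
    funext j
    by_cases hj : j = n
    · subst hj; simp
    · simp [hj, ht j hj]
  · intro a _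
    simp

theorem op_ext {A B : Op N} (h : ∀ v, A *ᵥ v = B *ᵥ v) : A = B :=
  Matrix.mulVec_injective (funext h)

theorem siteOp_mul (n : Fin N) (m m' : Matrix (Fin 2) (Fin 2) ℂ) :
    siteOp n (m * m') = siteOp n m * siteOp n m' := by
  refine op_ext fun v => funext fun s => ?_
  rw [← mulVec_mulVec, siteOp_mulVec, siteOp_mulVec]
  simp only [siteOp_mulVec, Function.update_self, Function.update_idem, Fin.sum_univ_two,
    Matrix.mul_apply]
  ring

theorem siteOp_commute {n k : Fin N} (h : n ≠ k) (m m' : Matrix (Fin 2) (Fin 2) ℂ) :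
    Commute (siteOp n m) (siteOp k m') := by
  refine op_ext fun v => funext fun s => ?_
  rw [← mulVec_mulVec, ← mulVec_mulVec, siteOp_mulVec, siteOp_mulVec]
  simp only [siteOp_mulVec, Function.update_of_ne h, Function.update_of_ne h.symm,
    Fin.sum_univ_two, Function.update_comm h]
  ring

/-- Operators on site `n`, as an algebra homomorphism. -/
noncomputable def siteHom (n : Fin N) : Matrix (Fin 2) (Fin 2) ℂ →ₐ[ℂ] Op N :=
  AlgHom.ofLinearMap
    { toFun := siteOp n
      map_add' := fun a b => by
        ext s t; simp only [siteOp, of_apply, Matrix.add_apply]; split_ifs <;> simp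
      map_smul' := fun c a => by
        ext s t; simp only [siteOp, of_apply, Matrix.smul_apply, RingHom.id_apply]
        split_ifs <;> simp }
    (by
      refine op_ext fun v => funext fun s => ?_
      change (siteOp n 1 *ᵥ v) s = _
      rw [siteOp_mulVec, one_mulVec]
      rw [Finset.sum_eq_single (s n)]
      · simp
      · intro b _ hb; simp [Matrix.one_apply_ne hb.symm]
      · simp)
    (siteOp_mul n)

theorem siteHom_apply (n : Fin N) (m : Matrix (Fin 2) (Fin 2) ℂ) : siteHom n m = siteOp n m := rfl

end SiteOperators

/-! ### Matrices on two auxiliary spaces and the six-vertex Yang–Baxter equation -/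

section TwoAuxiliarySpaces

variable {𝒜 : Type*} [Ring 𝒜]

/-- A `2 × 2` matrix acting on the first of two auxiliary spaces. -/
noncomputable def aux1 (X : Matrix (Fin 2) (Fin 2) 𝒜) : Matrix (Fin 2 × Fin 2) (Fin 2 × Fin 2) 𝒜 :=
  Matrix.of fun i j => if i.2 = j.2 then X i.1 j.1 else 0

/-- A `2 × 2` matrix acting on the second of two auxiliary spaces. -/
noncomputable def aux2 (X : Matrix (Fin 2) (Fin 2) 𝒜) : Matrix (Fin 2 × Fin 2) (Fin 2 × Fin 2) 𝒜 :=
  Matrix.of fun i j => if i.1 = j.1 then X i.2 j.2 else 0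

/-- The `R`-matrix on two auxiliary spaces. -/
noncomputable def auxR (𝒜 : Type*) [Ring 𝒜] [Algebra ℂ 𝒜] (η l : ℂ) :
    Matrix (Fin 2 × Fin 2) (Fin 2 × Fin 2) 𝒜 :=
  (RMatrix η l).map (algebraMap ℂ 𝒜)

theorem aux1_mul (X Y : Matrix (Fin 2) (Fin 2) 𝒜) : aux1 (X * Y) = aux1 X * aux1 Y := by
  ext ⟨i, j⟩ ⟨k, l⟩
  fin_cases j <;> fin_cases l <;>
    simp [aux1, Matrix.mul_apply, Fintype.sum_prod_type]

theorem aux2_mul (X Y : Matrix (Fin 2) (Fin 2) 𝒜) : aux2 (X * Y) = aux2 X * aux2 Y := by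
  ext ⟨i, j⟩ ⟨k, l⟩
  fin_cases i <;> fin_cases k <;>
    simp [aux2, Matrix.mul_apply, Fintype.sum_prod_type]

theorem aux1_mul_aux2_comm {X Y : Matrix (Fin 2) (Fin 2) 𝒜}
    (h : ∀ i j k l, Commute (X i j) (Y k l)) : aux1 X * aux2 Y = aux2 Y * aux1 X := by
  ext ⟨i, j⟩ ⟨k, l⟩
  simp only [aux1, aux2, Matrix.mul_apply, Fintype.sum_prod_type, of_apply, Fin.sum_univ_two]
  have := fun i j k l => (h i j k l).eq
  fin_cases i <;> fin_cases j <;> fin_cases k <;> fin_cases l <;> simp [this]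

/-- A six-vertex weight matrix. -/
def sixVertex (a b c : ℂ) : Matrix (Fin 2 × Fin 2) (Fin 2 × Fin 2) ℂ :=
  Matrix.of fun p q =>
    if p = q then (if p.1 = p.2 then a else b) else if p = q.swap then c else 0

/-- A six-vertex weight matrix as a `2 × 2` matrix of `2 × 2` matrices. -/
def sixVertexBlock (a b c : ℂ) : Matrix (Fin 2) (Fin 2) (Matrix (Fin 2) (Fin 2) ℂ) :=
  !![!![a, 0; 0, b], !![0, 0; c, 0]; !![0, c; 0, 0], !![b, 0; 0, a]]

-- For weights with a common c, three quadratic relations suffice, entry by entry. Keeping the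
-- weights abstract confines the addition formulas to three short identities.
set_option maxHeartbeats 1000000 in
theorem sixVertex_yangBaxter {a₁ b₁ a₂ b₂ a₃ b₃ c : ℂ} (h₁ : a₁ * b₂ = a₂ * b₁ + c * b₃)
    (h₂ : a₁ * a₃ = c * a₂ + b₁ * b₃) (h₃ : a₃ * b₂ = c * b₁ + a₂ * b₃) :
    (sixVertex a₁ b₁ c).map (algebraMap ℂ (Matrix (Fin 2) (Fin 2) ℂ)) *
        aux1 (sixVertexBlock a₂ b₂ c) * aux2 (sixVertexBlock a₃ b₃ c) =
      aux2 (sixVertexBlock a₃ b₃ c) * aux1 (sixVertexBlock a₂ b₂ c) *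
        (sixVertex a₁ b₁ c).map (algebraMap ℂ (Matrix (Fin 2) (Fin 2) ℂ)) := by
  ext ⟨i, j⟩ ⟨k, l⟩ s t
  fin_cases i <;> fin_cases j <;> fin_cases k <;> fin_cases l <;>
    simp [Matrix.mul_apply, Fintype.sum_prod_type, Fin.sum_univ_two, aux1, aux2, sixVertexBlock,
      sixVertex, Algebra.algebraMap_eq_smul_one, -mul_eq_mul_left_iff,
      -mul_eq_mul_right_iff] <;> fin_cases s <;> fin_cases t <;>
    simp [-mul_eq_mul_left_iff, -mul_eq_mul_right_iff] <;> grind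

-- The arrangement with the auxiliary matrix in the middle is the one needed to pass through the
-- inner R-matrix of the reflection equation.
set_option maxHeartbeats 1000000 in
theorem sixVertex_yangBaxter' {a₁ b₁ a₂ b₂ a₃ b₃ c : ℂ} (h₁ : b₁ * a₂ = a₁ * b₂ + c * b₃)
    (h₂ : b₁ * a₃ = a₁ * b₃ + c * b₂) (h₃ : a₂ * a₃ = a₁ * c + b₂ * b₃) :
    aux1 (sixVertexBlock a₂ b₂ c) *
        (sixVertex a₁ b₁ c).map (algebraMap ℂ (Matrix (Fin 2) (Fin 2) ℂ)) *
        aux2 (sixVertexBlock a₃ b₃ c) =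
      aux2 (sixVertexBlock a₃ b₃ c) *
        (sixVertex a₁ b₁ c).map (algebraMap ℂ (Matrix (Fin 2) (Fin 2) ℂ)) *
        aux1 (sixVertexBlock a₂ b₂ c) := by
  ext ⟨i, j⟩ ⟨k, l⟩ s t
  fin_cases i <;> fin_cases j <;> fin_cases k <;> fin_cases l <;>
    simp [Matrix.mul_apply, Fintype.sum_prod_type, Fin.sum_univ_two, aux1, aux2, sixVertexBlock,
      sixVertex, Algebra.algebraMap_eq_smul_one, -mul_eq_mul_left_iff,
      -mul_eq_mul_right_iff] <;> fin_cases s <;> fin_cases t <;>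
    simp [-mul_eq_mul_left_iff, -mul_eq_mul_right_iff] <;> grind

end TwoAuxiliarySpaces

end OpenXXZ

namespace OpenXXZ

/-! ### Exchange relations, crossing, and the double-row matrix site by site -/

section YangBaxter

variable {𝒜 : Type*} [Ring 𝒜]

theorem R0_eq_map {N : ℕ} (p : Chain N) (n : Fin N) (l : ℂ) :
    p.R0 n l = (sixVertexBlock (sinh (l + p.η)) (sinh l) (sinh p.η)).map (siteHom n) := by
  ext1 i j
  simp only [Chain.R0, of_apply, map_apply, siteHom_apply]
  congr 1
  ext a b
  fin_cases i <;> fin_cases j <;> fin_cases a <;> fin_cases b <;> simp [RMatrix, sixVertexBlock]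

theorem aux1_map {ℬ : Type*} [Ring ℬ] [Algebra ℂ 𝒜] [Algebra ℂ ℬ] (f : 𝒜 →ₐ[ℂ] ℬ)
    (X : Matrix (Fin 2) (Fin 2) 𝒜) : aux1 (X.map f) = (aux1 X).map f := by
  ext i j
  simp only [aux1, of_apply, map_apply]
  split_ifs <;> simp

theorem aux2_map {ℬ : Type*} [Ring ℬ] [Algebra ℂ 𝒜] [Algebra ℂ ℬ] (f : 𝒜 →ₐ[ℂ] ℬ)
    (X : Matrix (Fin 2) (Fin 2) 𝒜) : aux2 (X.map f) = (aux2 X).map f := by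
  ext i j
  simp only [aux2, of_apply, map_apply]
  split_ifs <;> simp

theorem auxR_map {ℬ : Type*} [Ring ℬ] [Algebra ℂ 𝒜] [Algebra ℂ ℬ] (f : 𝒜 →ₐ[ℂ] ℬ) (η l : ℂ) :
    auxR ℬ η l = (auxR 𝒜 η l).map f := by
  ext i j
  simp [auxR]

theorem R0_yangBaxter {N : ℕ} (p : Chain N) (n : Fin N) (x y : ℂ) :
    auxR _ p.η (x - y) * aux1 (p.R0 n x) * aux2 (p.R0 n y) =
      aux2 (p.R0 n y) * aux1 (p.R0 n x) * auxR _ p.η (x - y) := by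
  rw [R0_eq_map, R0_eq_map, aux1_map, aux2_map, auxR_map (siteHom n), ← Matrix.map_mul,
    ← Matrix.map_mul, ← Matrix.map_mul, ← Matrix.map_mul]
  congr 1
  have hx := cosh_sq x
  have hy := cosh_sq y
  have hη := cosh_sq p.η
  refine sixVertex_yangBaxter ?_ ?_ ?_ <;>
    simp only [sinh_add, cosh_add, sinh_sub, cosh_sub] <;> grind

theorem R0_yangBaxter' {N : ℕ} (p : Chain N) (n : Fin N) (x y : ℂ) :
    aux1 (p.R0 n x) * auxR _ p.η (x + y) * aux2 (p.R0 n y) =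
      aux2 (p.R0 n y) * auxR _ p.η (x + y) * aux1 (p.R0 n x) := by
  rw [R0_eq_map, R0_eq_map, aux1_map, aux2_map, auxR_map (siteHom n), ← Matrix.map_mul,
    ← Matrix.map_mul, ← Matrix.map_mul, ← Matrix.map_mul]
  congr 1
  have hx := cosh_sq x
  have hy := cosh_sq y
  have hη := cosh_sq p.η
  refine sixVertex_yangBaxter' ?_ ?_ ?_ <;>
    simp only [sinh_add, cosh_add, sinh_sub, cosh_sub] <;> grind

theorem lift_apply {N : ℕ} (A : Matrix (Fin 2) (Fin 2) ℂ) (i j : Fin 2) :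
    (lift A : AuxOp N) i j = A i j • (1 : Op N) := by
  simp [lift, Algebra.algebraMap_eq_smul_one]

theorem lift_mul {N : ℕ} (A B : Matrix (Fin 2) (Fin 2) ℂ) :
    (lift (A * B) : AuxOp N) = lift A * lift B := by
  simp [lift, Matrix.map_mul]

theorem lift_one {N : ℕ} : (lift 1 : AuxOp N) = 1 := by
  simp [lift]

theorem lift_smul {N : ℕ} (c : ℂ) (A : Matrix (Fin 2) (Fin 2) ℂ) :
    (lift (c • A) : AuxOp N) = c • lift A := by
  ext1 i j
  simp [lift_apply, smul_smul]

theorem R0_unitarity {N : ℕ} (p : Chain N) (n : Fin N) (x : ℂ) :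
    p.R0 n x * p.R0 n (-x) = (sinh (p.η + x) * sinh (p.η - x)) • 1 := by
  have key : sixVertexBlock (sinh (x + p.η)) (sinh x) (sinh p.η) *
      sixVertexBlock (sinh (-x + p.η)) (sinh (-x)) (sinh p.η) =
        (sinh (p.η + x) * sinh (p.η - x)) • 1 := by
    have h1 : sinh (-x + p.η) = sinh (p.η - x) := by ring_nf
    have h2 : sinh (x + p.η) = sinh (p.η + x) := by ring_nf
    have h3 : sinh (p.η + x) * sinh (p.η - x) = sinh p.η ^ 2 - sinh x ^ 2 := by
      have hx := cosh_sq x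
      have hη := cosh_sq p.η
      rw [sinh_add, sinh_sub]
      grind
    rw [h1, h2, sinh_neg]
    ext i j s t
    fin_cases i <;> fin_cases j <;> fin_cases s <;> fin_cases t <;>
      simp [sixVertexBlock, Matrix.mul_apply, Fin.sum_univ_two] <;> grind
  rw [R0_eq_map, R0_eq_map, ← Matrix.map_mul, key]
  ext1 i j
  by_cases h : i = j <;> simp [h, Matrix.one_apply, Matrix.smul_apply]

/-- The operators `A i j` commute with all operators on site `n`. -/
def CommSite {N : ℕ} (n : Fin N) (A : AuxOp N) : Prop :=
  ∀ i j m, Commute (A i j) (siteOp n m)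

theorem CommSite.mul {N : ℕ} {n : Fin N} {A B : AuxOp N} (hA : CommSite n A)
    (hB : CommSite n B) : CommSite n (A * B) := fun i j m => by
  rw [Matrix.mul_apply]
  exact Commute.sum_left _ _ _ fun k _ => (hA i k m).mul_left (hB k j m)

theorem commSite_lift {N : ℕ} (n : Fin N) (A : Matrix (Fin 2) (Fin 2) ℂ) :
    CommSite n (lift A) := fun i j m => by
  rw [lift_apply]
  exact (Commute.one_left _).smul_left _

theorem commSite_R0 {N : ℕ} (p : Chain N) {n k : Fin N} (h : n ≠ k) (x : ℂ) :
    CommSite n (p.R0 k x) := fun _ _ m => siteOp_commute h.symm _ m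

theorem CommSite.commute_R0 {N : ℕ} {n : Fin N} {A : AuxOp N} (hA : CommSite n A)
    (p : Chain N) (x : ℂ) (i j k l : Fin 2) : Commute (A i j) (p.R0 n x k l) :=
  hA i j _

theorem commSite_list_prod {N : ℕ} {n : Fin N} (p : Chain N) (f : Fin N → ℂ) :
    ∀ {ns : List (Fin N)}, n ∉ ns → CommSite n (ns.map fun k => p.R0 k (f k)).prod
  | [], _ => by simpa [lift_one] using commSite_lift (N := N) n 1
  | k :: ns, h => by
    simp only [List.mem_cons, not_or] at h
    simpa using (commSite_R0 p h.1 _).mul (commSite_list_prod p f h.2)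

/-- `σʸ Aᵗ σʸ`, the transposition acting in the auxiliary space only. -/
def crossAux {N : ℕ} (A : AuxOp N) : AuxOp N := !![A 1 1, -A 0 1; -A 1 0, A 0 0]

theorem lift_sigma_conj {N : ℕ} (A : AuxOp N) :
    lift !![0, -I; I, 0] * Aᵀ * lift !![0, -I; I, 0] = crossAux A := by
  ext1 i j
  fin_cases i <;> fin_cases j <;>
    simp [crossAux, Matrix.mul_apply, Fin.sum_univ_two, lift_apply, smul_smul]

/-- Transposing only the auxiliary space reverses a product because the entries of the factors
commute, as they do for factors on different sites. -/
theorem crossAux_mul {N : ℕ} {A B : AuxOp N} (h : ∀ i j k l, Commute (A i j) (B k l)) :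
    crossAux (A * B) = crossAux B * crossAux A := by
  have h' := fun i j k l => (h i j k l).eq
  ext1 i j
  fin_cases i <;> fin_cases j <;>
    simp [crossAux, Matrix.mul_apply, Fin.sum_univ_two, h'] <;> abel

/-- Crossing symmetry of the R-matrix; it turns M̂ into an ordinary product of R-matrices in the
opposite order. -/
theorem crossAux_R0 {N : ℕ} (p : Chain N) (n : Fin N) (x : ℂ) :
    crossAux (p.R0 n x) = (-1 : ℂ) • p.R0 n (-x - p.η) := by
  have h1 : sinh (-x - p.η) = -sinh (x + p.η) := by rw [← sinh_neg]; ring_nf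
  have key : ∀ i j, (!![sixVertexBlock (sinh (x + p.η)) (sinh x) (sinh p.η) 1 1,
      -sixVertexBlock (sinh (x + p.η)) (sinh x) (sinh p.η) 0 1;
      -sixVertexBlock (sinh (x + p.η)) (sinh x) (sinh p.η) 1 0,
      sixVertexBlock (sinh (x + p.η)) (sinh x) (sinh p.η) 0 0] :
        Matrix (Fin 2) (Fin 2) (Matrix (Fin 2) (Fin 2) ℂ)) i j =
      (-1 : ℂ) • sixVertexBlock (sinh (-x - p.η + p.η)) (sinh (-x - p.η)) (sinh p.η) i j := by
    intro i j
    ext s t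
    fin_cases i <;> fin_cases j <;> fin_cases s <;> fin_cases t <;>
      simp [sixVertexBlock, h1]
  rw [R0_eq_map, R0_eq_map]
  ext1 i j
  rw [Matrix.smul_apply, Matrix.map_apply, ← map_smul, ← key i j]
  fin_cases i <;> fin_cases j <;> simp [crossAux]

namespace Chain

variable {N : ℕ} (p : Chain N)

/-- The monodromy matrix of the sites in a list. -/
noncomputable def Mlist (ns : List (Fin N)) (l : ℂ) : AuxOp N :=
  (ns.map fun n => p.R0 n (l - p.ξ n - p.η / 2)).prod

/-- The reflected monodromy matrix of the sites in a list. -/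
noncomputable def Mhlist (ns : List (Fin N)) (l : ℂ) : AuxOp N :=
  (ns.reverse.map fun n => p.R0 n (l + p.ξ n - p.η / 2)).prod

/-- The double-row monodromy matrix of the sites in a list. -/
noncomputable def Ulist (ns : List (Fin N)) (l : ℂ) : AuxOp N :=
  p.Mlist ns l * lift (p.Kminus l) * p.Mhlist ns l

theorem Ulist_nil (l : ℂ) : p.Ulist [] l = lift (p.Kminus l) := by
  simp [Ulist, Mlist, Mhlist]

/-- The recursion behind the inductions on sites: a new site dresses the double-row matrix of the
others from both sides. -/
theorem Ulist_cons (n : Fin N) (ns : List (Fin N)) (l : ℂ) :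
    p.Ulist (n :: ns) l =
      p.R0 n (l - p.ξ n - p.η / 2) * p.Ulist ns l * p.R0 n (l + p.ξ n - p.η / 2) := by
  simp [Ulist, Mlist, Mhlist, mul_assoc]

theorem commSite_Ulist {n : Fin N} {ns : List (Fin N)} (h : n ∉ ns) (l : ℂ) :
    CommSite n (p.Ulist ns l) :=
  ((commSite_list_prod p _ h).mul (commSite_lift n _)).mul
    (commSite_list_prod p _ (by simpa using h))

theorem crossAux_Mlist (l : ℂ) : ∀ {ns : List (Fin N)}, ns.Nodup →
    crossAux (p.Mlist ns (-l)) = (-1 : ℂ) ^ ns.length • p.Mhlist ns l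
  | [], _ => by
    ext1 i j
    fin_cases i <;> fin_cases j <;> simp [Mlist, Mhlist, crossAux]
  | n :: ns, h => by
    rw [List.nodup_cons] at h
    have h1 : p.Mlist (n :: ns) (-l) = p.R0 n (-l - p.ξ n - p.η / 2) * p.Mlist ns (-l) := by
      simp [Mlist]
    have h2 : p.Mhlist (n :: ns) l = p.Mhlist ns l * p.R0 n (l + p.ξ n - p.η / 2) := by
      simp [Mhlist]
    rw [h1, crossAux_mul, crossAux_Mlist l h.2, crossAux_R0, h2]
    · rw [show -(-l - p.ξ n - p.η / 2) - p.η = l + p.ξ n - p.η / 2 by ring]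
      simp only [smul_mul_smul_comm, List.length_cons, pow_succ]
    · exact fun i j k l => ((commSite_list_prod p _ h.1).commute_R0 p _ k l i j).symm

theorem M_eq_Mlist (l : ℂ) : p.M l = p.Mlist (List.finRange N).reverse l := rfl

theorem Mhat_eq_Mhlist (l : ℂ) : p.Mhat l = p.Mhlist (List.finRange N).reverse l := by
  rw [Mhat, lift_sigma_conj, M_eq_Mlist,
    p.crossAux_Mlist l (List.nodup_reverse.2 (List.nodup_finRange N)), smul_smul]
  simp [← mul_pow]

theorem Uminus_eq_Ulist (l : ℂ) : p.Uminus l = p.Ulist (List.finRange N).reverse l := by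
  rw [Uminus, M_eq_Mlist, Mhat_eq_Mhlist, Ulist]

end Chain

end YangBaxter

end OpenXXZ

namespace OpenXXZ

/-! ### The reflection equation -/

section ReflectionEquation

theorem aux1_R0_aux2_comm {N : ℕ} {n : Fin N} {A : AuxOp N} (hA : CommSite n A) (p : Chain N)
    (x : ℂ) : aux1 (p.R0 n x) * aux2 A = aux2 A * aux1 (p.R0 n x) :=
  aux1_mul_aux2_comm fun i j k l => (hA.commute_R0 p x k l i j).symm

theorem aux1_aux2_R0_comm {N : ℕ} {n : Fin N} {A : AuxOp N} (hA : CommSite n A) (p : Chain N)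
    (x : ℂ) : aux1 A * aux2 (p.R0 n x) = aux2 (p.R0 n x) * aux1 A :=
  aux1_mul_aux2_comm fun i j k l => hA.commute_R0 p x i j k l

/-- Yang–Baxter carries the R-matrices of site n across the auxiliary one, and they commute with A
and B in the other auxiliary space. The inner triple is thereby isolated for the induction
hypothesis. -/
theorem reflection_cross {N : ℕ} {n : Fin N} (p : Chain N) {A B : AuxOp N} (hA : CommSite n A)
    (hB : CommSite n B) (x y x' y' s : ℂ) (hs : y' + y = s) :
    aux2 (p.R0 n x * A * p.R0 n y) * auxR _ p.η s * aux1 (p.R0 n y' * B * p.R0 n x') =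
      aux2 (p.R0 n x) * aux1 (p.R0 n y') * (aux2 A * auxR _ p.η s * aux1 B) *
        (aux2 (p.R0 n y) * aux1 (p.R0 n x')) := by
  have h1 := R0_yangBaxter' p n y' y
  rw [hs] at h1
  have h2 := aux1_R0_aux2_comm hA p y'
  have h3 := aux1_aux2_R0_comm hB p y
  simp only [aux1_mul, aux2_mul, mul_assoc] at h1 h2 h3 ⊢
  rw [← mul_assoc (auxR _ p.η s) (aux1 (p.R0 n y')), ← mul_assoc (aux2 (p.R0 n y)), ← h1]
  simp only [mul_assoc]
  rw [← mul_assoc (aux2 A) (aux1 (p.R0 n y')), ← h2, ← mul_assoc (aux2 (p.R0 n y)) (aux1 B), ← h3]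
  simp only [mul_assoc]

theorem reflection_cross' {N : ℕ} {n : Fin N} (p : Chain N) {A B : AuxOp N} (hA : CommSite n A)
    (hB : CommSite n B) (x y x' y' s : ℂ) (hs : y + y' = s) :
    aux1 (p.R0 n x * A * p.R0 n y) * auxR _ p.η s * aux2 (p.R0 n y' * B * p.R0 n x') =
      aux1 (p.R0 n x) * aux2 (p.R0 n y') * (aux1 A * auxR _ p.η s * aux2 B) *
        (aux1 (p.R0 n y) * aux2 (p.R0 n x')) := by
  have h1 := R0_yangBaxter' p n y y'
  rw [hs] at h1
  have h2 := aux1_aux2_R0_comm hA p y'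
  have h3 := aux1_R0_aux2_comm hB p y
  simp only [aux1_mul, aux2_mul, mul_assoc] at h1 h2 h3 ⊢
  rw [← mul_assoc (auxR _ p.η s) (aux2 (p.R0 n y')), ← mul_assoc (aux1 (p.R0 n y)), h1]
  simp only [mul_assoc]
  rw [← mul_assoc (aux1 A) (aux2 (p.R0 n y')), h2, ← mul_assoc (aux1 (p.R0 n y)) (aux2 B), h3]
  simp only [mul_assoc]

set_option maxHeartbeats 2000000 in
theorem Kminus_reflection {N : ℕ} (p : Chain N) (l m : ℂ) :
    auxR (Op N) p.η (l - m) * aux1 (lift (p.Kminus l)) * auxR _ p.η (l + m - p.η) *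
        aux2 (lift (p.Kminus m)) =
      aux2 (lift (p.Kminus m)) * auxR _ p.η (l + m - p.η) * aux1 (lift (p.Kminus l)) *
        auxR _ p.η (l - m) := by
  have key : auxR ℂ p.η (l - m) * aux1 (p.Kminus l) * auxR _ p.η (l + m - p.η) *
        aux2 (p.Kminus m) =
      aux2 (p.Kminus m) * auxR _ p.η (l + m - p.η) * aux1 (p.Kminus l) *
        auxR _ p.η (l - m) := by
    -- Centred at η/2, the boundary matrices depend on u and v, and the two auxiliary R-matrices on
    -- u - v and u + v.
    obtain ⟨u, hu⟩ : ∃ u, u = l - p.η / 2 := ⟨_, rfl⟩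
    obtain ⟨v, hv⟩ : ∃ v, v = m - p.η / 2 := ⟨_, rfl⟩
    have e1 : l - m = u - v := by rw [hu, hv]; ring
    have e2 : l + m - p.η = u + v := by rw [hu, hv]; ring
    have e3 : 2 * l - p.η = 2 * u := by rw [hu]; ring
    have e4 : 2 * m - p.η = 2 * v := by rw [hv]; ring
    have e5 : p.ζm - l + p.η / 2 = p.ζm - u := by rw [hu]; ring
    have e6 : p.ζm - m + p.η / 2 = p.ζm - v := by rw [hv]; ring
    simp only [Chain.Kminus, KMatrix, e1, e2, e3, e4, e5, e6, ← hu, ← hv]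
    generalize p.κm * exp p.τm = P
    generalize p.κm * exp (-p.τm) = Q
    generalize 1 / sinh p.ζm = c
    ext ⟨i, j⟩ ⟨k, l⟩
    fin_cases i <;> fin_cases j <;> fin_cases k <;> fin_cases l <;>
      simp [auxR, aux1, aux2, Matrix.mul_apply, Fintype.sum_prod_type, Fin.sum_univ_two, RMatrix,
        -mul_eq_mul_left_iff, -mul_eq_mul_right_iff]
    all_goals
      clear * -
      simp only [Complex.sinh, sub_eq_add_neg, neg_add, neg_neg, Complex.exp_add, two_mul,
        Complex.exp_neg]
      field_simp <;> ring
  have := congrArg (fun M => M.map (Algebra.ofId ℂ (Op N))) key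
  have hl : ∀ K, (lift K : AuxOp N) = K.map (Algebra.ofId ℂ (Op N)) := fun _ => rfl
  simpa only [hl, Matrix.map_mul, ← aux1_map, ← aux2_map, ← auxR_map] using this

/-- Dressing preserves the equation: Yang–Baxter reorders the R-matrices of the new site on the left
and on the right, and the induction hypothesis reorders what lies between. -/
theorem Chain.Ulist_reflection {N : ℕ} (p : Chain N) (l m : ℂ) :
    ∀ {ns : List (Fin N)}, ns.Nodup →
    auxR (Op N) p.η (l - m) * (aux1 (p.Ulist ns l) * auxR _ p.η (l + m - p.η) *
        aux2 (p.Ulist ns m)) =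
      aux2 (p.Ulist ns m) * auxR _ p.η (l + m - p.η) * aux1 (p.Ulist ns l) *
        auxR _ p.η (l - m)
  | [], _ => by simpa only [Ulist_nil, ← mul_assoc] using Kminus_reflection p l m
  | n :: ns, h => by
    rw [List.nodup_cons] at h
    have hl := p.commSite_Ulist h.1 l
    have hm := p.commSite_Ulist h.1 m
    have ih := Ulist_reflection p l m h.2
    have h1 := R0_yangBaxter p n (l - p.ξ n - p.η / 2) (m - p.ξ n - p.η / 2)
    have h2 := R0_yangBaxter p n (l + p.ξ n - p.η / 2) (m + p.ξ n - p.η / 2)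
    rw [show l - p.ξ n - p.η / 2 - (m - p.ξ n - p.η / 2) = l - m by ring] at h1
    rw [show l + p.ξ n - p.η / 2 - (m + p.ξ n - p.η / 2) = l - m by ring] at h2
    rw [Ulist_cons, Ulist_cons, reflection_cross' p hl hm _ _ _ _ _ (by ring),
      reflection_cross p hm hl _ _ _ _ _ (by ring)]
    simp only [← mul_assoc] at h1 ih ⊢
    rw [h1]
    simp only [mul_assoc] at h2 ih ⊢
    have ih' : ∀ Z, auxR (Op N) p.η (l - m) * (aux1 (p.Ulist ns l) * (auxR _ p.η (l + m - p.η) *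
        (aux2 (p.Ulist ns m) * Z))) =
      aux2 (p.Ulist ns m) * (auxR _ p.η (l + m - p.η) * (aux1 (p.Ulist ns l) *
        (auxR _ p.η (l - m) * Z))) := fun Z => by
      simpa only [mul_assoc] using congrArg (· * Z) ih
    rw [← h2, ih']

end ReflectionEquation

end OpenXXZ

namespace OpenXXZ

/-! ### Parity: 𝒰₋ at opposite arguments -/

section Parity

/-- The linear map relating a double-row monodromy matrix at opposite spectral parameters. -/
def parityMap {W : Type*} [AddCommGroup W] [Module ℂ W] (s c t : ℂ) (F : Fin 2 → Fin 2 → W) :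
    Matrix (Fin 2) (Fin 2) W :=
  !![s • F 1 1 - c • F 0 0, -(t • F 0 1); -(t • F 1 0), s • F 0 0 - c • F 1 1]

theorem dress_apply {N : ℕ} {n : Fin N} (p : Chain N) {V : AuxOp N} (hV : CommSite n V) (x y : ℂ)
    (i j : Fin 2) : (p.R0 n x * V * p.R0 n y) i j =
      ∑ k, ∑ l, siteHom n (sixVertexBlock (sinh (x + p.η)) (sinh x) (sinh p.η) i k *
        sixVertexBlock (sinh (y + p.η)) (sinh y) (sinh p.η) l j) * V k l := by
  simp only [Matrix.mul_apply, Finset.sum_mul]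
  rw [Finset.sum_comm]
  refine Finset.sum_congr rfl fun k _ => Finset.sum_congr rfl fun l _ => ?_
  rw [R0_eq_map, R0_eq_map, map_apply, map_apply, map_mul, mul_assoc, mul_assoc]
  congr 1
  exact hV k l _

-- This moves the parity map from the inner auxiliary indices to the outer ones, hence through a
-- dressing. At -l the weights of the two R-matrices are those at l, negated, with a and b exchanged
-- and the two factors exchanged.
set_option maxHeartbeats 1000000 in
theorem sixVertexBlock_parity {a b a' b' c s t : ℂ} (h₁ : s * c = a * a' - b * b')
   
    (h₂ : s * a = t * b + c * a') (h₃ : s * a' = t * b' + c * a) (i j k m : Fin 2) :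
    parityMap s c t (fun k m => sixVertexBlock (-b') (-a') c i k * sixVertexBlock (-b) (-a) c m j)
        k m =
      parityMap s c t (fun i j => sixVertexBlock a b c i k * sixVertexBlock a' b' c m j) i j := by
  ext u v
  fin_cases i <;> fin_cases j <;> fin_cases k <;> fin_cases m <;>
    simp [parityMap, sixVertexBlock] <;> fin_cases u <;> fin_cases v <;>
    simp [-mul_eq_mul_left_iff, -mul_eq_mul_right_iff] <;> grind

/-- The parity relation satisfied by the double-row monodromy matrices. -/
def CrossParity {N : ℕ} (η : ℂ) (U : ℂ → AuxOp N) : Prop :=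
  ∀ l i j, sinh (2 * l - η) • U (-l) i j =
    parityMap (sinh (2 * l)) (sinh η) (sinh (2 * l + η)) (U l) i j

theorem sum_parityMap {N : ℕ} {𝒜 : Type*} [Ring 𝒜] [Algebra ℂ 𝒜] (φ : 𝒜 →ₐ[ℂ] Op N) (s c t : ℂ)
    (F : Fin 2 → Fin 2 → 𝒜) (V : AuxOp N) :
    ∑ k, ∑ m, φ (F k m) * parityMap s c t V k m = ∑ k, ∑ m, φ (parityMap s c t F k m) * V k m := by
  simp only [Fin.sum_univ_two, parityMap, of_apply, cons_val_zero, cons_val_one, map_neg, map_sub,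
    map_smul, mul_sub, sub_mul, mul_neg, neg_mul, mul_smul_comm, smul_mul_assoc]
  abel

theorem parityMap_sum {N : ℕ} {𝒜 : Type*} [Ring 𝒜] [Algebra ℂ 𝒜] (φ : 𝒜 →ₐ[ℂ] Op N) (s c t : ℂ)
    (F : Fin 2 → Fin 2 → Fin 2 → Fin 2 → 𝒜) (V : AuxOp N) (i j : Fin 2) :
    parityMap s c t (fun i j => ∑ k, ∑ m, φ (F i j k m) * V k m) i j =
      ∑ k, ∑ m, φ (parityMap s c t (fun i j => F i j k m) i j) * V k m := by
  fin_cases i <;> fin_cases j <;>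
    simp [parityMap, Fin.sum_univ_two, sub_mul] <;> module

theorem crossParity_dress {N : ℕ} {n : Fin N} (p : Chain N) {V : ℂ → AuxOp N}
    (hV : ∀ l, CommSite n (V l)) (h : CrossParity p.η V) :
    CrossParity p.η fun l => p.R0 n (l - p.ξ n - p.η / 2) * V l *
      p.R0 n (l + p.ξ n - p.η / 2) := by
  intro l i j
  obtain ⟨x, hx⟩ : ∃ x, x = l - p.ξ n - p.η / 2 := ⟨_, rfl⟩
  obtain ⟨y, hy⟩ : ∃ y, y = l + p.ξ n - p.η / 2 := ⟨_, rfl⟩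
  have e1 : sinh (-l - p.ξ n - p.η / 2 + p.η) = -sinh y := by rw [← sinh_neg, hy]; ring_nf
  have e2 : sinh (-l - p.ξ n - p.η / 2) = -sinh (y + p.η) := by rw [← sinh_neg, hy]; ring_nf
  have e3 : sinh (-l + p.ξ n - p.η / 2 + p.η) = -sinh x := by rw [← sinh_neg, hx]; ring_nf
  have e4 : sinh (-l + p.ξ n - p.η / 2) = -sinh (x + p.η) := by rw [← sinh_neg, hx]; ring_nf
  have e5 : 2 * l = x + y + p.η := by rw [hx, hy]; ring
  have hcx := cosh_sq x
  have hcy := cosh_sq y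
  have hch := cosh_sq p.η
  beta_reduce
  rw [dress_apply p (hV _)]
  simp only [Finset.smul_sum, ← mul_smul_comm, h l]
  rw [e1, e2, e3, e4]
  rw [sum_parityMap, ← hx, ← hy]
  have hd : p.R0 n x * V l * p.R0 n y = fun i j => ∑ k, ∑ m,
      siteHom n (sixVertexBlock (sinh (x + p.η)) (sinh x) (sinh p.η) i k *
        sixVertexBlock (sinh (y + p.η)) (sinh y) (sinh p.η) m j) * V l k m :=
    funext fun i => funext fun j => dress_apply p (hV l) x y i j
  rw [hd]
  refine Eq.trans ?_ (parityMap_sum (siteHom n) _ _ _ (fun i j k m =>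
    sixVertexBlock (sinh (x + p.η)) (sinh x) (sinh p.η) i k *
        sixVertexBlock (sinh (y + p.η)) (sinh y) (sinh p.η) m j) (V l) i j).symm
  refine Finset.sum_congr rfl fun k _ => Finset.sum_congr rfl fun m _ => ?_
  rw [sixVertexBlock_parity (a := sinh (x + p.η)) (b := sinh x) (a' := sinh (y + p.η))
    (b' := sinh y)] <;> rw [e5] <;> simp only [sinh_add, cosh_add] <;> grind

theorem Chain.Ulist_crossParity {N : ℕ} (p : Chain N) :
    ∀ {ns : List (Fin N)}, ns.Nodup → CrossParity p.η (p.Ulist ns)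
  | [], _ => by
    intro l i j
    rw [Ulist_nil, Ulist_nil]
    simp only [lift_apply, Kminus, KMatrix, Matrix.smul_apply]
    generalize 1 / sinh p.ζm = c
    have exp_half : exp p.η = exp (p.η / 2) * exp (p.η / 2) := by rw [← Complex.exp_add, add_halves]
    have a1 : -l - p.η / 2 + p.ζm = p.ζm - l - p.η / 2 := by ring
    have a2 : p.ζm - -l + p.η / 2 = p.ζm + l + p.η / 2 := by ring
    have a3 : 2 * -l - p.η = -(2 * l + p.η) := by ring
    fin_cases i <;> fin_cases j <;>
      simp only [parityMap, lift_apply, smul_smul, Fin.zero_eta, Fin.mk_one, of_apply, cons_val_zero, cons_val_one, ← sub_smul,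
        ← neg_smul, smul_eq_mul, a1, a2, a3, Matrix.smul_apply] <;> congr 1
    · simp only [Complex.sinh, sub_eq_add_neg, neg_add, neg_neg, Complex.exp_add, two_mul,
        Complex.exp_neg, exp_half]
      field_simp; ring
    · rw [sinh_neg]; ring
    · rw [sinh_neg]; ring
    · simp only [Complex.sinh, sub_eq_add_neg, neg_add, neg_neg, Complex.exp_add, two_mul,
        Complex.exp_neg, exp_half]
      field_simp; ring
  | n :: ns, h => by
    rw [List.nodup_cons] at h
    have := crossParity_dress p (fun l => p.commSite_Ulist h.1 l) (Ulist_crossParity p h.2)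
    intro l i j
    rw [Ulist_cons, Ulist_cons]
    exact this l i j

end Parity

end OpenXXZ

namespace OpenXXZ

/-! ### The inversion relation -/

section Inversion

/-- With u = l - η/2, both scalars equal (sinh²ζ₋ - sinh²u - κ₋² sinh²2u) / sinh²ζ₋. For g₋ this is
cosh²ζ₋ - sinh²ζ₋ = 1 rewritten in terms of α₋ and β₋. -/
theorem Chain.Kminus_inversion {N : ℕ} (p : Chain N) {αm βm : ℂ} (hζ : sinh p.ζm ≠ 0)
    (hκ : p.κm ≠ 0) (h₁ : sinh αm * cosh βm = sinh p.ζm / (2 * p.κm))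
    (h₂ : cosh αm * sinh βm = cosh p.ζm / (2 * p.κm)) (l : ℂ) :
    p.Kminus l * p.Kminus (p.η - l) = (p.gMinus αm βm l * p.gMinus αm βm (p.η - l)) • 1 := by
  obtain ⟨u, hu⟩ : ∃ u, u = l - p.η / 2 := ⟨_, rfl⟩
  have e1 : p.η - l - p.η / 2 = -u := by rw [hu]; ring
  have e2 : 2 * l - p.η = 2 * u := by rw [hu]; ring
  have e3 : 2 * (p.η - l) - p.η = -(2 * u) := by rw [hu]; ring
  have e4 : p.ζm - l + p.η / 2 = p.ζm - u := by rw [hu]; ring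
  have e5 : p.ζm - (p.η - l) + p.η / 2 = p.ζm + u := by rw [hu]; ring
  have e6 : -u + p.ζm = p.ζm - u := by ring
  have e7 : u + p.ζm = p.ζm + u := by ring
  have e8 : l + αm - p.η / 2 = αm + u := by rw [hu]; ring
  have e9 : l + βm - p.η / 2 = βm + u := by rw [hu]; ring
  have e10 : p.η - l + αm - p.η / 2 = αm - u := by rw [hu]; ring
  have e11 : p.η - l + βm - p.η / 2 = βm - u := by rw [hu]; ring
  have hprod : ∀ a b : ℂ, sinh (a + b) * sinh (a - b) = sinh a ^ 2 - sinh b ^ 2 := fun a b => by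
    have ha := cosh_sq a
    have hb := cosh_sq b
    rw [sinh_add, sinh_sub]; grind
  have hprod' : ∀ a b : ℂ, cosh (a + b) * cosh (a - b) = cosh a ^ 2 + sinh b ^ 2 := fun a b => by
    have ha := cosh_sq a
    have hb := cosh_sq b
    rw [cosh_add, cosh_sub]; grind
  have hτ : exp p.τm * exp (-p.τm) = 1 := by rw [← Complex.exp_add]; simp
  have hab : sinh αm * cosh βm ≠ 0 := by
    rw [h₁]; exact div_ne_zero hζ (mul_ne_zero two_ne_zero hκ)
  have hs : sinh p.ζm = 2 * p.κm * (sinh αm * cosh βm) := by rw [h₁]; field_simp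
  have hc : cosh p.ζm = 2 * p.κm * (cosh αm * sinh βm) := by rw [h₂]; field_simp
  have hg : p.gMinus αm βm l * p.gMinus αm βm (p.η - l) =
      (sinh p.ζm ^ 2 - sinh u ^ 2 - p.κm ^ 2 * sinh (2 * u) ^ 2) / sinh p.ζm ^ 2 := by
    have hz := cosh_sq p.ζm
    have ha := cosh_sq αm
    have hb := cosh_sq βm
    have hcu := cosh_sq u
    simp only [gMinus, e8, e9, e10, e11]
    rw [div_mul_div_comm, div_eq_div_iff (mul_ne_zero hab hab) (pow_ne_zero _ hζ),
      show sinh (αm + u) * cosh (βm + u) * (sinh (αm - u) * cosh (βm - u)) =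
        (sinh (αm + u) * sinh (αm - u)) * (cosh (βm + u) * cosh (βm - u)) by ring, hprod, hprod',
      sinh_two_mul]
    rw [hs, hc] at hz
    rw [hs]
    have hz' : 4 * p.κm ^ 2 * (cosh βm ^ 2 - 1 - sinh αm ^ 2) = 1 := by
      have hsb : sinh βm ^ 2 = cosh βm ^ 2 - 1 := by rw [hb]; ring
      calc _ = (2 * p.κm * (cosh αm * sinh βm)) ^ 2 - (2 * p.κm * (sinh αm * cosh βm)) ^ 2 := by
            rw [mul_pow, mul_pow, mul_pow, mul_pow, mul_pow, ha, hsb]; ring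
        _ = 1 := by rw [hz]; ring
    generalize sinh αm = a at *
    generalize cosh βm = b at *
    linear_combination (-(a * b) ^ 2 * sinh u ^ 2) * hz' +
      (a * b) ^ 2 * 4 * p.κm ^ 2 * sinh u ^ 2 * hcu
  rw [hg]
  simp only [Kminus, KMatrix, e1, e2, e3, e4, e5, e6, ← hu, sinh_neg]
  rw [show u + p.ζm = p.ζm + u by ring]
  have hz2 := hprod p.ζm u
  generalize sinh (2 * u) = w at *
  ext i j
  fin_cases i <;> fin_cases j <;>
    simp [Matrix.mul_apply, Fin.sum_univ_two] <;> field_simp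
  · linear_combination hz2 - p.κm ^ 2 * w ^ 2 * hτ
  · ring
  · ring
  · linear_combination hz2 - p.κm ^ 2 * w ^ 2 * hτ

/-- The adjacent R-matrices of the outermost site have opposite arguments at l and η - l. Unitarity
removes them, the induction hypothesis collapses the middle, and the outer pair is then removed
likewise. -/
theorem Chain.Ulist_inversion {N : ℕ} (p : Chain N) {δ : ℂ} {l : ℂ}
    (hK : p.Kminus l * p.Kminus (p.η - l) = δ • 1) : ∀ ns : List (Fin N),
    p.Ulist ns l * p.Ulist ns (p.η - l) =
      (δ * (ns.map fun n => sinh (l + p.ξ n + p.η / 2) * sinh (3 * p.η / 2 - l - p.ξ n) *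
        (sinh (l - p.ξ n + p.η / 2) * sinh (3 * p.η / 2 - l + p.ξ n))).prod) • 1
  | [] => by
    rw [Ulist_nil, Ulist_nil, ← lift_mul, hK, lift_smul, lift_one]; simp
  | n :: ns => by
    have h1 := R0_unitarity p n (l + p.ξ n - p.η / 2)
    have h2 := R0_unitarity p n (l - p.ξ n - p.η / 2)
    rw [show -(l + p.ξ n - p.η / 2) = p.η - l - p.ξ n - p.η / 2 by ring,
      show p.η + (l + p.ξ n - p.η / 2) = l + p.ξ n + p.η / 2 by ring,
      show p.η - (l + p.ξ n - p.η / 2) = 3 * p.η / 2 - l - p.ξ n by ring] at h1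
    rw [show -(l - p.ξ n - p.η / 2) = p.η - l + p.ξ n - p.η / 2 by ring,
      show p.η + (l - p.ξ n - p.η / 2) = l - p.ξ n + p.η / 2 by ring,
      show p.η - (l - p.ξ n - p.η / 2) = 3 * p.η / 2 - l + p.ξ n by ring] at h2
    rw [Ulist_cons, Ulist_cons]
    calc _ = p.R0 n (l - p.ξ n - p.η / 2) * (p.Ulist ns l *
          (p.R0 n (l + p.ξ n - p.η / 2) * p.R0 n (p.η - l - p.ξ n - p.η / 2)) *
          p.Ulist ns (p.η - l)) * p.R0 n (p.η - l + p.ξ n - p.η / 2) := by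
          simp only [mul_assoc]
      _ = _ := by
          rw [h1, mul_smul_comm, mul_one, smul_mul_assoc, Ulist_inversion p hK ns]
          simp only [mul_smul_comm, smul_mul_assoc, mul_one, h2, smul_smul, List.map_cons,
            List.prod_cons]
          congr 1; ring

/-- The inversion relation of the double-row monodromy matrix. -/
theorem Chain.Uminus_inversion {N : ℕ} (p : Chain N) {αm βm : ℂ} (hζ : sinh p.ζm ≠ 0)
    (hκ : p.κm ≠ 0) (h₁ : sinh αm * cosh βm = sinh p.ζm / (2 * p.κm))
    (h₂ : cosh αm * sinh βm = cosh p.ζm / (2 * p.κm)) (l : ℂ) :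
    p.Uminus l * p.Uminus (p.η - l) = (p.AMinus αm βm l * p.AMinus αm βm (p.η - l)) • 1 := by
  rw [Uminus_eq_Ulist, Uminus_eq_Ulist, p.Ulist_inversion (p.Kminus_inversion hζ hκ h₁ h₂ l)]
  congr 1
  rw [List.map_reverse, List.prod_reverse, ← List.ofFn_eq_map, List.prod_ofFn]
  simp only [AMinus, aFun, dFun]
  rw [show ∀ a b c d e f : ℂ, a * b * c * (d * e * f) = a * d * (b * c * e * f) by intros; ring]
  simp only [← Finset.prod_mul_distrib]
  congr 1
  refine Finset.prod_congr rfl fun n _ => ?_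
  have e1 : -l - p.η - p.ξ n + p.η / 2 = -(l + p.ξ n + p.η / 2) := by ring
  have e2 : p.η - l - p.ξ n + p.η / 2 = 3 * p.η / 2 - l - p.ξ n := by ring
  have e3 : -(p.η - l) - p.η - p.ξ n + p.η / 2 = -(3 * p.η / 2 - l + p.ξ n) := by ring
  rw [e1, e2, e3, sinh_neg, sinh_neg]
  ring

end Inversion

/-! ### Fusion to auxiliary spin one -/

section SymmetricVanishing

/-- The symmetrizer of two auxiliary spaces. -/
noncomputable def auxSym (N : ℕ) : Matrix (Fin 2 × Fin 2) (Fin 2 × Fin 2) (Op N) :=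
  (sixVertex 2 1 1).map (algebraMap ℂ (Op N))

theorem auxR_neg_eta {N : ℕ} (η : ℂ) :
    auxR (Op N) η (-η) = sinh η • (auxSym N - (2 : ℂ) • 1) := by
  ext1 ⟨i, j⟩ ⟨k, l⟩
  fin_cases i <;> fin_cases j <;> fin_cases k <;> fin_cases l <;>
    simp [auxR, auxSym, RMatrix, sixVertex, Algebra.algebraMap_eq_smul_one, two_smul]

theorem auxSym_mul_auxR {N : ℕ} (η : ℂ) : auxSym N * auxR (Op N) η (-η) = 0 := by
  have key : sixVertex 2 1 1 * RMatrix η (-η) = 0 := by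
    ext ⟨i, j⟩ ⟨k, l⟩
    fin_cases i <;> fin_cases j <;> fin_cases k <;> fin_cases l <;>
      simp [Matrix.mul_apply, Fintype.sum_prod_type, Fin.sum_univ_two, RMatrix, sixVertex]
  rw [auxSym, auxR, ← Matrix.map_mul, key]
  simp

/-- If `Z P⁻ = P⁻ W` with `P⁻` the antisymmetrizer then `Z` preserves symmetric rows. -/
theorem auxSym_mul_eq {N : ℕ} {η : ℂ} (hη : sinh η ≠ 0)
    {Z W : Matrix (Fin 2 × Fin 2) (Fin 2 × Fin 2) (Op N)}
    (h : auxR (Op N) η (-η) * W = Z * auxR (Op N) η (-η)) :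
    auxSym N * Z = (2⁻¹ : ℂ) • (auxSym N * Z * auxSym N) := by
  have h1 : auxSym N * Z * auxR (Op N) η (-η) = 0 := by
    rw [mul_assoc, ← h, ← mul_assoc, auxSym_mul_auxR, zero_mul]
  rw [auxR_neg_eta, mul_smul_comm, smul_eq_zero, mul_sub, sub_eq_zero] at h1
  rw [h1.resolve_left hη, mul_smul_comm, mul_one, smul_smul]
  simp

/-- R(0) is sinh η times the permutation of site n with the second auxiliary space. Moving it to the
right turns R(-η) on site n into R(-η) on the two auxiliary spaces, which the symmetrizer
annihilates. -/
theorem auxSym_mul_R0 {N : ℕ} (p : Chain N) (n : Fin N) :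
    auxSym N * (aux2 (p.R0 n 0) * aux1 (p.R0 n (-p.η))) = 0 := by
  have key : (sixVertex 2 1 1).map (algebraMap ℂ (Matrix (Fin 2) (Fin 2) ℂ)) *
      (aux2 (sixVertexBlock (sinh (0 + p.η)) (sinh 0) (sinh p.η)) *
        aux1 (sixVertexBlock (sinh (-p.η + p.η)) (sinh (-p.η)) (sinh p.η))) = 0 := by
    ext ⟨i, j⟩ ⟨k, l⟩ s t
    fin_cases i <;> fin_cases j <;> fin_cases k <;> fin_cases l <;>
      simp [Matrix.mul_apply, Fintype.sum_prod_type, Fin.sum_univ_two, aux1, aux2, sixVertexBlock,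
        sixVertex, Algebra.algebraMap_eq_smul_one] <;> fin_cases s <;> fin_cases t <;> simp
  have h1 : auxSym N = ((sixVertex 2 1 1).map
      (algebraMap ℂ (Matrix (Fin 2) (Fin 2) ℂ))).map (siteHom n) := by
    ext i j; simp [auxSym]
  rw [R0_eq_map, R0_eq_map, aux1_map, aux2_map, h1, ← Matrix.map_mul, ← Matrix.map_mul, key]
  ext i j; simp

/-- At `m = η/2 - ξ_n` the double-row monodromy matrices fused with auxiliary spin one vanish. -/
theorem Chain.auxSym_mul_Ulist {N : ℕ} (p : Chain N) (hη : sinh p.η ≠ 0) (n : Fin N) {m : ℂ}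
    (hm : m = p.η / 2 - p.ξ n) : ∀ {ns : List (Fin N)}, ns.Nodup → n ∈ ns →
    auxSym N * (aux2 (p.Ulist ns m) * auxR _ p.η (m - p.η + m - p.η) *
      aux1 (p.Ulist ns (m - p.η))) = 0
  | k :: ns, h, hn => by
    rw [List.nodup_cons] at h
    have hYB := R0_yangBaxter p k (m - p.η - p.ξ k - p.η / 2) (m - p.ξ k - p.η / 2)
    rw [show m - p.η - p.ξ k - p.η / 2 - (m - p.ξ k - p.η / 2) = -p.η by ring, mul_assoc] at hYB
    have hRE := p.Ulist_reflection (m - p.η) m h.2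
    rw [show m - p.η - m = -p.η by ring] at hRE
    -- A left factor that preserves symmetric rows can be stripped off.
    have hfactor : ∀ X W Y : Matrix (Fin 2 × Fin 2) (Fin 2 × Fin 2) (Op N),
        auxSym N * X = (2⁻¹ : ℂ) • (auxSym N * X * auxSym N) → auxSym N * W * Y = 0 →
        auxSym N * (X * W * Y) = 0 := fun X W Y hX hW => by
      calc auxSym N * (X * W * Y) = auxSym N * X * (W * Y) := by simp only [mul_assoc]
        _ = (2⁻¹ : ℂ) • (auxSym N * X * (auxSym N * W * Y)) := by
          conv_lhs => rw [hX]
          simp only [smul_mul_assoc, mul_assoc]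
        _ = 0 := by rw [hW, mul_zero, smul_zero]
    rw [Ulist_cons, Ulist_cons, reflection_cross p (p.commSite_Ulist h.1 _)
      (p.commSite_Ulist h.1 _) _ _ _ _ _ (by ring)]
    refine hfactor _ _ _ (auxSym_mul_eq hη hYB) ?_
    -- At the site n itself the right-hand R-matrices have arguments 0 and -η; for another outer
    -- site the inner matrix already vanishes.
    rcases List.mem_cons.1 hn with rfl | hn
    · rw [auxSym_mul_eq hη hRE, smul_mul_assoc, mul_assoc _ (auxSym N),
        show m + p.ξ n - p.η / 2 = 0 by rw [hm]; ring,
        show m - p.η + p.ξ n - p.η / 2 = -p.η by rw [hm]; ring, auxSym_mul_R0]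
      simp
    · rw [auxSym_mul_Ulist p hη n hm h.2 hn]
      simp

end SymmetricVanishing

end OpenXXZ

namespace OpenXXZ

namespace Chain

/-! ### The operators `Az` and `Bz` of the triangular gauge -/

section GaugedOperators

variable {N : ℕ} (p : Chain N)

/-- The diagonal entry of the double-row monodromy matrix in the triangular gauge `z`. -/
noncomputable def Az (z l : ℂ) : Op N := exp (l - p.η / 2) • p.Uminus l 0 0 - z • p.Uminus l 1 0

/-- The off-diagonal entry of the double-row monodromy matrix in the triangular gauge `z`. -/
noncomputable def Bz (z l : ℂ) : Op N :=
  (z * exp (l - p.η / 2)) • p.Uminus l 0 0 + p.Uminus l 0 1 - z ^ 2 • p.Uminus l 1 0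
    - (z * exp (-(l - p.η / 2))) • p.Uminus l 1 1

/-- The other diagonal entry of the double-row monodromy matrix in the triangular gauge `z`. -/
noncomputable def Dz (z l : ℂ) : Op N :=
  z • p.Uminus l 1 0 + exp (-(l - p.η / 2)) • p.Uminus l 1 1

theorem Uminus_reflection (l m : ℂ) :
    auxR (Op N) p.η (l - m) * (aux1 (p.Uminus l) * auxR _ p.η (l + m - p.η) *
        aux2 (p.Uminus m)) =
      aux2 (p.Uminus m) * auxR _ p.η (l + m - p.η) * aux1 (p.Uminus l) *
        auxR _ p.η (l - m) := by
  simp only [Uminus_eq_Ulist]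
  exact p.Ulist_reflection l m (List.nodup_reverse.2 (List.nodup_finRange N))

-- Passing `Az` through `Bz` multiplies its gauge parameter by e^{-2η}. On covectors annihilated by
-- `Bz z m` only the first product on the right survives.
set_option maxHeartbeats 4000000 in
theorem Az_mul_Bz (z l m : ℂ) :
    (sinh (l - m) * sinh (l + m)) • (p.Az z m * p.Bz z l) =
      (sinh (l - m + p.η) * sinh (l + m - p.η)) • (p.Bz z l * p.Az (z * exp (-(2 * p.η))) m)
      - p.Bz z m * ((exp (m - l) * sinh p.η * sinh (l + m - p.η)) •
          p.Az (z * exp (-(2 * p.η))) l +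
        (sinh (l - m) * exp (l + m - p.η) * sinh p.η) • p.Dz z l) := by
  have h := p.Uminus_reflection l m
  simp only [Az, Bz, Dz]
  generalize p.Uminus l = U at h ⊢
  generalize p.Uminus m = V at h ⊢
  have h1 := congrFun₂ h (0, 0) (0, 0)
  have h2 := congrFun₂ h (0, 1) (0, 0)
  have h3 := congrFun₂ h (1, 0) (0, 0)
  have h4 := congrFun₂ h (1, 1) (0, 0)
  have h5 := congrFun₂ h (0, 0) (1, 0)
  have h6 := congrFun₂ h (0, 1) (1, 0)
  have h7 := congrFun₂ h (1, 0) (1, 0)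
  have h8 := congrFun₂ h (1, 1) (1, 0)
  clear h
  simp [Matrix.mul_apply, Fintype.sum_prod_type, Fin.sum_univ_two, auxR, aux1, aux2, RMatrix,
    Algebra.algebraMap_eq_smul_one, mul_add, add_mul, smul_smul] at h1 h2 h3 h4 h5 h6 h7 h8
  generalize U 0 0 = u00 at *
  generalize U 0 1 = u01 at *
  generalize U 1 0 = u10 at *
  generalize U 1 1 = u11 at *
  generalize V 0 0 = v00 at *
  generalize V 0 1 = v01 at *
  generalize V 1 0 = v10 at *
  generalize V 1 1 = v11 at *
  simp only [mul_add, add_mul, mul_sub, sub_mul, smul_mul_assoc, mul_smul_comm, smul_add, smul_sub,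
    smul_smul]
  have e0 : p.η = p.η / 2 + p.η / 2 := (add_halves _).symm
  set y := exp (l - p.η / 2) with hy
  set w := exp (m - p.η / 2) with hw
  set r := exp (-p.η) with hr
  -- Up to an overall sign the coefficients are the row (1, -z e^{-η}/y) ⊗ (w, -z) and the column (z
  -- e^{-η} y, 1) ⊗ (1, 0), between which the reflection equation is contracted.
  linear_combination (norm := skip) (-w) • h5 + z • h6 + (z * r * w * exp (-(l - p.η / 2))) • h7
    - (z ^ 2 * r * exp (-(l - p.η / 2))) • h8 - (z * r * y * w) • h1 + (z ^ 2 * r * y) • h2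
    + (z ^ 2 * r ^ 2 * w) • h3 - (z ^ 3 * r ^ 2) • h4
  simp only [hy, hw, hr]
  clear * - e0
  generalize p.η / 2 = k at *
  rw [e0]
  match_scalars <;>
  · simp only [Complex.sinh, sub_eq_add_neg, neg_add, neg_neg, Complex.exp_add, two_mul,
        Complex.exp_neg]
    field_simp
    ring

-- The failure of `Az z l` and `Az z m` to commute is carried by products beginning with `Bz`, so
-- they commute on covectors killed by `Bz z l` and `Bz z m`, once the sinh prefactors can be
-- cancelled.
set_option maxHeartbeats 4000000 in
theorem Az_mul_Az (z l m : ℂ) :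
    sinh (l - m + p.η) • (sinh (l + m) • (p.Az z l * p.Az z m) +
        (exp (l + m - p.η) * sinh p.η) • (p.Bz z l * p.Uminus m 1 0)) =
      sinh (l - m + p.η) • (sinh (l + m) • (p.Az z m * p.Az z l) +
        (exp (l + m - p.η) * sinh p.η) • (p.Bz z m * p.Uminus l 1 0)) := by
  have h := p.Uminus_reflection l m
  simp only [Az, Bz]
  generalize p.Uminus l = U at h ⊢
  generalize p.Uminus m = V at h ⊢
  have h1 := congrFun₂ h (0, 0) (0, 0)
  have h2 := congrFun₂ h (0, 1) (0, 0)
  have h3 := congrFun₂ h (1, 0) (0, 0)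
  have h4 := congrFun₂ h (1, 1) (0, 0)
  clear h
  simp [Matrix.mul_apply, Fintype.sum_prod_type, Fin.sum_univ_two, auxR, aux1, aux2, RMatrix,
    Algebra.algebraMap_eq_smul_one, mul_add, add_mul, smul_smul] at h1 h2 h3 h4
  generalize U 0 0 = u00 at *
  generalize U 0 1 = u01 at *
  generalize U 1 0 = u10 at *
  generalize U 1 1 = u11 at *
  generalize V 0 0 = v00 at *
  generalize V 0 1 = v01 at *
  generalize V 1 0 = v10 at *
  generalize V 1 1 = v11 at *
  simp only [mul_add, add_mul, mul_sub, sub_mul, smul_mul_assoc, mul_smul_comm, smul_add, smul_sub,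
    smul_smul]
  have e0 : p.η = p.η / 2 + p.η / 2 := (add_halves _).symm
  set y := exp (l - p.η / 2) with hy
  set w := exp (m - p.η / 2) with hw
  set r := exp (-p.η) with hr
  -- The contracting row is (y, -z e^{-η}) ⊗ (w, -z), the column (1, 0) ⊗ (1, 0).
  linear_combination (norm := skip) (y * w) • h1 - (z * y) • h2 - (z * r * w) • h3
    + (z ^ 2 * r) • h4
  simp only [hy, hw, hr]
  clear * - e0
  generalize p.η / 2 = k at *
  rw [e0]
  match_scalars <;>
  · simp only [Complex.sinh, sub_eq_add_neg, neg_add, neg_neg, Complex.exp_add, two_mul,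
        Complex.exp_neg]
    field_simp
    ring

-- At l = m - η the row used in `Az_mul_Az` becomes a multiple of the symmetric row (w, -z) ⊗ (w,
-- -z), so the fused matrix can be contracted with it.
set_option maxHeartbeats 4000000 in
theorem Az_mul_Az_sub_eta (hη : sinh p.η ≠ 0) (n : Fin N) {m : ℂ} (hm : m = p.η / 2 - p.ξ n)
    (z : ℂ) : sinh (2 * m - p.η) • (p.Az z m * p.Az z (m - p.η)) +
      (exp (2 * m - 2 * p.η) * sinh p.η) • (p.Bz z m * p.Uminus (m - p.η) 1 0) = 0 := by
  have h := p.auxSym_mul_Ulist hη n hm (List.nodup_reverse.2 (List.nodup_finRange N))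
    (by simp)
  clear hm
  simp only [← Uminus_eq_Ulist] at h
  simp only [Az, Bz]
  generalize p.Uminus m = U at h ⊢
  generalize p.Uminus (m - p.η) = V at h ⊢
  have h1 := congrFun₂ h (0, 0) (0, 0)
  have h2 := congrFun₂ h (0, 1) (0, 0)
  have h4 := congrFun₂ h (1, 1) (0, 0)
  clear h
  simp [Matrix.mul_apply, Fintype.sum_prod_type, Fin.sum_univ_two, auxSym, auxR, aux1, aux2,
    RMatrix, sixVertex, Algebra.algebraMap_eq_smul_one, mul_add, add_mul, smul_smul,
    -smul_eq_zero] at h1 h2 h4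
  generalize U 0 0 = u00 at *
  generalize U 0 1 = u01 at *
  generalize U 1 0 = u10 at *
  generalize U 1 1 = u11 at *
  generalize V 0 0 = v00 at *
  generalize V 0 1 = v01 at *
  generalize V 1 0 = v10 at *
  generalize V 1 1 = v11 at *
  simp only [mul_add, add_mul, mul_sub, sub_mul, smul_mul_assoc, mul_smul_comm, smul_add, smul_sub,
    smul_smul]
  have e0 : p.η = p.η / 2 + p.η / 2 := (add_halves _).symm
  set w := exp (m - p.η / 2) with hw
  set r := exp (-p.η) with hr
  -- `auxSym` doubles the components (0,0) and (1,1) but only adds the two mixed ones; hence the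
  -- halves.
  linear_combination (norm := skip) (w ^ 2 * r / 2) • h1 - (z * r * w) • h2
    + (z ^ 2 * r / 2) • h4
  simp only [hw, hr]
  clear * - e0
  generalize p.η / 2 = k at *
  rw [e0]
  match_scalars <;>
  · simp only [Complex.sinh, sub_eq_add_neg, neg_add, neg_neg, Complex.exp_add, two_mul,
        Complex.exp_neg]
    field_simp
    ring

/-- This is the inversion relation between the row (1, -z e^{-(l-η/2)}) and the column (1, 0); the
correction again begins with `Bz`. -/
theorem Az_mul_Az_inversion {αm βm : ℂ} (hζ : sinh p.ζm ≠ 0)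
    (hκ : p.κm ≠ 0) (h₁ : sinh αm * cosh βm = sinh p.ζm / (2 * p.κm))
    (h₂ : cosh αm * sinh βm = cosh p.ζm / (2 * p.κm)) (z l : ℂ) :
    p.Az z l * p.Az z (p.η - l) + p.Bz z l * p.Uminus (p.η - l) 1 0 =
      (p.AMinus αm βm l * p.AMinus αm βm (p.η - l)) • 1 := by
  have h := p.Uminus_inversion hζ hκ h₁ h₂ l
  simp only [Az, Bz]
  generalize p.AMinus αm βm l * p.AMinus αm βm (p.η - l) = δ at *
  generalize p.Uminus l = U at h ⊢
  generalize p.Uminus (p.η - l) = V at h ⊢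
  have h1 := congrFun₂ h 0 0
  have h2 := congrFun₂ h 1 0
  clear h
  simp [Matrix.mul_apply, Fin.sum_univ_two] at h1 h2
  rw [show p.η - l - p.η / 2 = -(l - p.η / 2) by ring]
  generalize U 0 0 = u00 at *
  generalize U 0 1 = u01 at *
  generalize U 1 0 = u10 at *
  generalize U 1 1 = u11 at *
  generalize V 0 0 = v00 at *
  generalize V 0 1 = v01 at *
  generalize V 1 0 = v10 at *
  generalize V 1 1 = v11 at *
  simp only [mul_add, add_mul, mul_sub, sub_mul, smul_mul_assoc, mul_smul_comm, smul_add, smul_sub,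
    smul_smul]
  linear_combination (norm := skip) (1 : ℂ) • h1 - (z * exp (-(l - p.η / 2))) • h2
  clear * -
  match_scalars <;>
  · simp only [sub_eq_add_neg, neg_add, neg_neg, Complex.exp_add, Complex.exp_neg]
    field_simp
    ring

/-- The coefficient of `Az z l` in the transfer matrix. -/
noncomputable def transferCoeff (z l : ℂ) : ℂ :=
  exp p.η * sinh (2 * l + p.η) / (sinh (2 * l) * sinh p.ζp) *
    (exp (-l - p.η / 2) * sinh (p.ζp + l - p.η / 2)
      - z * (p.κp * exp (-p.τp)) * sinh (2 * l - p.η))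

theorem Uminus_crossParity : CrossParity p.η p.Uminus := by
  have := p.Ulist_crossParity (List.nodup_reverse.2 (List.nodup_finRange N))
  intro l i j
  simp only [Uminus_eq_Ulist]
  exact this l i j

-- Parity writes `Az z (-l)` through entries of 𝒰₋(l), so three coefficients must match four
-- entries. The gauge condition, used to eliminate κ₊ e^{τ₊}, supplies the missing equation in the
-- coefficient of `Uminus l 1 0`.
set_option maxHeartbeats 4000000 in
theorem transfer_eq {z l : ℂ} (hζ : sinh p.ζp ≠ 0) (hl : sinh (2 * l) ≠ 0)
    (hz : p.κp * ((exp p.η * z) ^ 2 * exp (-p.τp) - exp p.τp) = exp p.η * z * exp (-p.ζp)) :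
    p.transfer l = p.transferCoeff z l • p.Az z l + p.transferCoeff z (-l) • p.Az z (-l) +
      (p.κp * exp (-p.τp) * sinh (2 * l + p.η) / sinh p.ζp) • p.Bz z l := by
  have h1 := p.Uminus_crossParity l 0 0
  have h2 := p.Uminus_crossParity l 1 0
  have ht : p.transfer l = p.Kplus l 0 0 • p.Uminus l 0 0 + p.Kplus l 0 1 • p.Uminus l 1 0 +
      (p.Kplus l 1 0 • p.Uminus l 0 1 + p.Kplus l 1 1 • p.Uminus l 1 1) := by
    simp [transfer, Matrix.trace, Fin.sum_univ_two, Matrix.mul_apply, lift_apply]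
  -- The coefficient at -l contains sinh(2l - η), exactly the factor with which the parity relation
  -- is stated.
  have hc : p.transferCoeff z (-l) • p.Az z (-l) =
      (exp p.η / (sinh (2 * l) * sinh p.ζp) *
        (exp (l - p.η / 2) * sinh (p.ζp - l - p.η / 2)
          + z * (p.κp * exp (-p.τp)) * sinh (2 * l + p.η))) • (sinh (2 * l - p.η) • p.Az z (-l)) := by
    rw [smul_smul]
    congr 1
    simp only [transferCoeff]
    rw [show 2 * -l + p.η = -(2 * l - p.η) by ring, show 2 * -l - p.η = -(2 * l + p.η) by ring,
      show 2 * -l = -(2 * l) by ring, show -(-l) - p.η / 2 = l - p.η / 2 by ring,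
      show p.ζp + -l - p.η / 2 = p.ζp - l - p.η / 2 by ring, sinh_neg, sinh_neg, sinh_neg]
    field_simp
    ring
  have hA : sinh (2 * l - p.η) • p.Az z (-l) =
      exp (-l - p.η / 2) • (sinh (2 * l) • p.Uminus l 1 1 - sinh p.η • p.Uminus l 0 0)
        + (z * sinh (2 * l + p.η)) • p.Uminus l 1 0 := by
    simp only [parityMap, of_apply, cons_val_zero, cons_val_one] at h1 h2
    rw [Az, smul_sub, smul_comm, h1, smul_comm, h2]
    module
  rw [hc, hA, ht]
  simp only [Az, Bz, transferCoeff, Kplus, KMatrix]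
  generalize p.Uminus l 0 0 = u00 at *
  generalize p.Uminus l 0 1 = u01 at *
  generalize p.Uminus l 1 0 = u10 at *
  generalize p.Uminus l 1 1 = u11 at *
  have e0 : p.η = p.η / 2 + p.η / 2 := (add_halves _).symm
  simp
  clear h1 h2 ht hc hA
  have ha : p.κp * exp p.τp =
      (exp p.η * z) ^ 2 * (p.κp * exp (-p.τp)) - exp p.η * z * exp (-p.ζp) := by
    linear_combination -hz
  clear hz
  generalize p.κp * exp p.τp = a at *
  subst ha
  generalize p.κp * exp (-p.τp) = b at *
  generalize p.η / 2 = k at *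
  rw [e0]
  clear * - hζ hl
  generalize p.ζp = c at *
  obtain ⟨S, hS⟩ : ∃ S, S = sinh (2 * l) := ⟨_, rfl⟩
  rw [← hS] at hl ⊢
  generalize sinh c = C at *
  have hk : exp (k * (1 + 1)) = exp k ^ 2 := by rw [← Complex.exp_nat_mul]; congr 1; push_cast; ring
  match_scalars <;>
  · field_simp
    try rw [hS]
    simp only [Complex.sinh, sub_eq_add_neg, neg_add, neg_neg, Complex.exp_add, two_mul,
        Complex.exp_neg, mul_two]
    field_simp
    try simp only [hk]
    try ring

end GaugedOperators

end Chain

end OpenXXZ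

namespace OpenXXZ

/-! ### Reference covectors -/

section ReferenceCovectors

variable {N : ℕ}

theorem siteOp_transpose (n : Fin N) (m : Matrix (Fin 2) (Fin 2) ℂ) :
    (siteOp n m)ᵀ = siteOp n mᵀ := by
  ext s t
  simp only [siteOp, transpose_apply, of_apply, eq_comm]

theorem vecMul_siteOp (n : Fin N) (m : Matrix (Fin 2) (Fin 2) ℂ) (v : Vect N) (s : Conf N) :
    (v ᵥ* siteOp n m) s = ∑ a, v (Function.update s n a) * m a (s n) := by
  rw [← mulVec_transpose, siteOp_transpose, siteOp_mulVec]
  simp [mul_comm]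

/-- The product covector with component `(-1, B n)` at the site `n`. -/
noncomputable def siteCov (B : Fin N → ℂ) : Vect N := fun s => ∏ n, (![-1, B n] : Fin 2 → ℂ) (s n)

theorem siteCov_vecMul (B : Fin N → ℂ) (n : Fin N) (m : Matrix (Fin 2) (Fin 2) ℂ) {c b : ℂ}
    (h0 : -m 0 0 + B n * m 1 0 = -c) (h1 : -m 0 1 + B n * m 1 1 = c * b) :
    siteCov B ᵥ* siteOp n m = c • siteCov (Function.update B n b) := by
  funext s
  rw [vecMul_siteOp]
  have key : ∀ a, siteCov B (Function.update s n a) =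
      (![-1, B n] : Fin 2 → ℂ) a * ∏ k ∈ Finset.univ.erase n, (![-1, B k] : Fin 2 → ℂ) (s k) := by
    intro a
    rw [siteCov, ← Finset.mul_prod_erase _ _ (Finset.mem_univ n)]
    congr 1
    · simp
    · exact Finset.prod_congr rfl fun k hk => by
        rw [Function.update_of_ne (Finset.ne_of_mem_erase hk)]
  have key2 : siteCov (Function.update B n b) s =
      (![-1, b] : Fin 2 → ℂ) (s n) *
        ∏ k ∈ Finset.univ.erase n, (![-1, B k] : Fin 2 → ℂ) (s k) := by
    rw [siteCov, ← Finset.mul_prod_erase _ _ (Finset.mem_univ n)]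
    congr 1
    · simp
    · exact Finset.prod_congr rfl fun k hk => by
        rw [Function.update_of_ne (Finset.ne_of_mem_erase hk)]
  rw [Pi.smul_apply, smul_eq_mul, key2]
  simp only [key, Fin.sum_univ_two]
  generalize ∏ k ∈ Finset.univ.erase n, (![-1, B k] : Fin 2 → ℂ) (s k) = P
  have : s n = 0 ∨ s n = 1 := by omega
  rcases this with hs | hs <;> rw [hs] <;> simp
  · linear_combination P * h0
  · linear_combination P * h1

namespace Chain

variable (p : Chain N)

/-- Vertex–face intertwining: for a matched local covector the auxiliary row (1, -A) factors out as
(1, -e^η A), and the component at site n loses a factor e^η. -/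
theorem siteCov_vecMul_row {B : Fin N → ℂ} {n : Fin N} {A x : ℂ}
    (h : B n = A * exp p.η * exp x) (k : Fin 2) :
    siteCov B ᵥ* (p.R0 n x 0 k - A • p.R0 n x 1 k) =
      (sinh (x + p.η) * (![1, -(exp p.η * A)] : Fin 2 → ℂ) k) •
        siteCov (Function.update B n (B n * exp (-p.η))) := by
  rw [R0_eq_map, map_apply, map_apply, ← map_smul, ← map_sub, siteHom_apply]
  apply siteCov_vecMul <;> rw [h] <;> clear h <;> fin_cases k <;>
  · simp [sixVertexBlock]
    try simp only [Complex.sinh, neg_add, Complex.exp_add, Complex.exp_neg]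
    try field_simp
    try ring

theorem siteCov_vecMul_col {B : Fin N → ℂ} {n : Fin N} {C x : ℂ}
    (h : C = B n * exp x) (k : Fin 2) :
    siteCov B ᵥ* (C • p.R0 n x k 0 + p.R0 n x k 1) =
      (sinh x * (![exp p.η * C, 1] : Fin 2 → ℂ) k) •
        siteCov (Function.update B n (B n * exp (-p.η))) := by
  rw [R0_eq_map, map_apply, map_apply, ← map_smul, ← map_add, siteHom_apply]
  apply siteCov_vecMul <;> rw [h] <;> clear h <;> fin_cases k <;>
  · simp [sixVertexBlock]
    try simp only [Complex.sinh, neg_add, Complex.exp_add, Complex.exp_neg]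
    try field_simp
    try ring

/-- The covector `siteCov B` is compatible with the gauge parameter `z` on the listed sites. -/
def Matched (B : Fin N → ℂ) : ℂ → List (Fin N) → Prop
  | _, [] => True
  | z, n :: ns => B n = z * exp p.η * exp (-p.ξ n) ∧ Matched B (z * exp p.η) ns

theorem Matched.congr {B B' : Fin N → ℂ} : ∀ {z : ℂ} {ns : List (Fin N)},
    p.Matched B z ns → (∀ n ∈ ns, B' n = B n) → p.Matched B' z ns
  | _, [], _, _ => trivial
  | _, n :: ns, h, h' =>
    ⟨(h' n (by simp)).trans h.1, Matched.congr h.2 fun k hk => h' k (by simp [hk])⟩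

theorem matched_of_getElem {B : Fin N → ℂ} : ∀ {z : ℂ} {ns : List (Fin N)},
    (∀ i (hi : i < ns.length), B ns[i] = z * exp p.η ^ (i + 1) * exp (-p.ξ ns[i])) →
    p.Matched B z ns
  | _, [], _ => trivial
  | z, n :: ns, h => by
    have h0 : B n = _ := h 0 (by simp)
    refine ⟨by simpa only [List.getElem_cons_zero, zero_add, pow_one] using h0, matched_of_getElem fun i hi => ?_⟩
    have := h (i + 1) (by simpa using hi)
    simp only [List.getElem_cons_succ] at this
    rw [this, pow_succ' _ (i + 1)]
    ring

/-- The contraction of an operator on the auxiliary space with the row `(1, -A)` and the column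
`(C, 1)`. -/
noncomputable def contract (A C : ℂ) (U : AuxOp N) : Op N :=
  C • U 0 0 + U 0 1 - (A * C) • U 1 0 - A • U 1 1

theorem contract_dress {n : Fin N} {U : AuxOp N} (hU : CommSite n U) (A C x y : ℂ) :
    contract A C (p.R0 n x * U * p.R0 n y) =
      ∑ k, ∑ j, (p.R0 n x 0 k - A • p.R0 n x 1 k) * (C • p.R0 n y j 0 + p.R0 n y j 1) * U k j := by
  have h := fun i j k l => (hU.commute_R0 p y i j k l).eq
  simp only [contract, Matrix.mul_apply, Fin.sum_univ_two, sub_mul, add_mul, mul_add, mul_assoc,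
    h, smul_add, smul_mul_assoc, mul_smul_comm]
  module

/-- Removing the outermost site yields two sinh factors, divides its component by e^{2η} and
replaces z by z e^η, leaving the same problem for the inner sites. The recursion ends with K₋
contracted at z e^η to the number of sites. -/
theorem siteCov_vecMul_contract (l : ℂ) : ∀ (ns : List (Fin N)) (B : Fin N → ℂ) (z : ℂ),
    ns.Nodup → p.Matched B z ns →
    siteCov B ᵥ* contract (z * exp (-(l - p.η / 2))) (z * exp (l - p.η / 2)) (p.Ulist ns l) =
      ((ns.map fun n => sinh (l - p.ξ n + p.η / 2) * sinh (l + p.ξ n - p.η / 2)).prod *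
        (sinh (2 * l - p.η) / sinh p.ζm * (z * exp p.η ^ ns.length * exp p.ζm +
          p.κm * (exp p.τm - (z * exp p.η ^ ns.length) ^ 2 * exp (-p.τm))))) •
        siteCov fun n => if n ∈ ns then B n * exp (-(2 * p.η)) else B n
  | [], B, z, _, _ => by
    have : contract (z * exp (-(l - p.η / 2))) (z * exp (l - p.η / 2)) (p.Ulist [] l) =
        (sinh (2 * l - p.η) / sinh p.ζm * (z * exp p.ζm +
          p.κm * (exp p.τm - z ^ 2 * exp (-p.τm)))) • (1 : Op N) := by
      simp only [Ulist_nil, contract, lift_apply, Kminus, KMatrix]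
      simp
      generalize sinh p.ζm = S
      obtain ⟨u, hu⟩ : ∃ u, u = l - p.η / 2 := ⟨_, rfl⟩
      rw [show p.ζm - l + p.η / 2 = p.ζm - u by rw [hu]; ring,
        show 2 * l - p.η = u + u by rw [hu]; ring, show p.η / 2 - l = - u by rw [hu]; ring, ← hu]
      clear hu
      match_scalars
      by_cases hS : S = 0
      · simp [hS]
      simp only [Complex.sinh, sub_eq_add_neg, neg_add, neg_neg, Complex.exp_add, Complex.exp_neg]
      field_simp
      ring
    rw [this]
    simp [vecMul_smul]
  | n :: ns, B, z, hnd, hB => by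
    rw [List.nodup_cons] at hnd
    set B' := Function.update B n (B n * exp (-p.η)) with hB'
    set B'' := Function.update B' n (B' n * exp (-p.η)) with hB''
    have hm : p.Matched B'' (z * exp p.η) ns := hB.2.congr p fun k hk => by
      have : k ≠ n := fun h => hnd.1 (h ▸ hk)
      simp [hB'', hB', this]
    have ih := siteCov_vecMul_contract l ns B'' (z * exp p.η) hnd.2 hm
    have e1 : B n = z * exp (-(l - p.η / 2)) * exp p.η * exp (l - p.ξ n - p.η / 2) := by
      rw [hB.1]
      simp only [sub_eq_add_neg, neg_add, neg_neg, Complex.exp_add, Complex.exp_neg]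
      field_simp
    have e2 : z * exp (l - p.η / 2) = B' n * exp (l + p.ξ n - p.η / 2) := by
      rw [hB', Function.update_self, hB.1]
      simp only [sub_eq_add_neg, neg_add, neg_neg, Complex.exp_add, Complex.exp_neg]
      field_simp
    rw [Ulist_cons, contract_dress p (p.commSite_Ulist hnd.1 l)]
    have e3 : ∀ k j, siteCov B ᵥ* ((p.R0 n (l - p.ξ n - p.η / 2) 0 k - (z * exp (-(l - p.η / 2))) •
        p.R0 n (l - p.ξ n - p.η / 2) 1 k) * ((z * exp (l - p.η / 2)) •
        p.R0 n (l + p.ξ n - p.η / 2) j 0 + p.R0 n (l + p.ξ n - p.η / 2) j 1) * p.Ulist ns l k j) =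
        (sinh (l - p.ξ n + p.η / 2) * sinh (l + p.ξ n - p.η / 2)) • ((
          (![1, -(exp p.η * (z * exp (-(l - p.η / 2))))] : Fin 2 → ℂ) k *
          (![exp p.η * (z * exp (l - p.η / 2)), 1] : Fin 2 → ℂ) j) •
            (siteCov B'' ᵥ* p.Ulist ns l k j)) := by
      intro k j
      rw [← vecMul_vecMul, ← vecMul_vecMul, p.siteCov_vecMul_row e1, smul_vecMul,
        p.siteCov_vecMul_col e2, smul_vecMul, smul_vecMul, smul_smul, smul_smul,
        show l - p.ξ n - p.η / 2 + p.η = l - p.ξ n + p.η / 2 by ring]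
      congr 1
      ring
    have e4 : siteCov B ᵥ* (∑ k, ∑ j, (p.R0 n (l - p.ξ n - p.η / 2) 0 k -
        (z * exp (-(l - p.η / 2))) •
        p.R0 n (l - p.ξ n - p.η / 2) 1 k) * ((z * exp (l - p.η / 2)) •
        p.R0 n (l + p.ξ n - p.η / 2) j 0 + p.R0 n (l + p.ξ n - p.η / 2) j 1) * p.Ulist ns l k j) =
        (sinh (l - p.ξ n + p.η / 2) * sinh (l + p.ξ n - p.η / 2)) • (siteCov B'' ᵥ*
          contract (z * exp p.η * exp (-(l - p.η / 2))) (z * exp p.η * exp (l - p.η / 2))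
            (p.Ulist ns l)) := by
      simp only [Fin.sum_univ_two, vecMul_add, e3]
      simp only [contract, vecMul_add, vecMul_sub, vecMul_smul]
      simp
      module
    rw [e4, ih, smul_smul]
    congr 1
    · simp only [List.map_cons, List.prod_cons, List.length_cons, pow_succ']
      ring
    · congr 1
      funext k
      by_cases hk : k = n
      · subst hk
        simp only [hnd.1, if_false, List.mem_cons, true_or, if_true, hB'', hB',
          Function.update_self, mul_assoc, ← Complex.exp_add]
        congr 2
        ring
      · simp [hk, hB'', hB']

/-- The row contraction alone produces sinh(l - ξ_n + η/2) at each site, and this is zero at site m.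
The column is never used, so both columns are annihilated. -/
theorem siteCov_vecMul_row_Ulist {m : Fin N} {l : ℂ} (hl : l = p.ξ m - p.η / 2) :
    ∀ (ns : List (Fin N)) (B : Fin N → ℂ) (z : ℂ), ns.Nodup → m ∈ ns → p.Matched B z ns →
    ∀ j, siteCov B ᵥ*
      (p.Ulist ns l 0 j - (z * exp (-(l - p.η / 2))) • p.Ulist ns l 1 j) = 0
  | n :: ns, B, z, hnd, hm, hB => fun j => by
    rw [List.nodup_cons] at hnd
    set B' := Function.update B n (B n * exp (-p.η)) with hB'
    have hm' : p.Matched B' (z * exp p.η) ns := hB.2.congr p fun k hk => by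
      have : k ≠ n := fun h => hnd.1 (h ▸ hk)
      simp [hB', this]
    have e1 : B n = z * exp (-(l - p.η / 2)) * exp p.η * exp (l - p.ξ n - p.η / 2) := by
      rw [hB.1]
      simp only [sub_eq_add_neg, neg_add, neg_neg, Complex.exp_add, Complex.exp_neg]
      field_simp
    have e2 : p.Ulist (n :: ns) l 0 j - (z * exp (-(l - p.η / 2))) • p.Ulist (n :: ns) l 1 j =
        ∑ k, ∑ i, (p.R0 n (l - p.ξ n - p.η / 2) 0 k - (z * exp (-(l - p.η / 2))) •
          p.R0 n (l - p.ξ n - p.η / 2) 1 k) * (p.Ulist ns l k i *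
            p.R0 n (l + p.ξ n - p.η / 2) i j) := by
      rw [Ulist_cons]
      simp only [Matrix.mul_apply, Fin.sum_univ_two, sub_mul, add_mul, mul_assoc, smul_add,
        smul_mul_assoc]
      module
    have e3 : siteCov B ᵥ* (p.Ulist (n :: ns) l 0 j -
        (z * exp (-(l - p.η / 2))) • p.Ulist (n :: ns) l 1 j) =
        sinh (l - p.ξ n + p.η / 2) • ∑ i, (siteCov B' ᵥ* (p.Ulist ns l 0 i -
          (z * exp p.η * exp (-(l - p.η / 2))) • p.Ulist ns l 1 i)) ᵥ*
            p.R0 n (l + p.ξ n - p.η / 2) i j := by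
      rw [e2]
      simp only [Fin.sum_univ_two, vecMul_add, ← vecMul_vecMul, p.siteCov_vecMul_row e1,
        smul_vecMul, vecMul_sub, vecMul_smul, sub_vecMul,
        show l - p.ξ n - p.η / 2 + p.η = l - p.ξ n + p.η / 2 by ring]
      simp
      module
    rw [e3]
    by_cases hmn : m = n
    · subst hmn
      rw [hl, show p.ξ m - p.η / 2 - p.ξ m + p.η / 2 = 0 by ring, sinh_zero, zero_smul]
    · have hmem : m ∈ ns := (List.mem_cons.1 hm).resolve_left hmn
      simp only [siteCov_vecMul_row_Ulist hl ns B' (z * exp p.η) hnd.2 hmem hm', zero_vecMul,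
        Finset.sum_const_zero, smul_zero]

/-- The reference covector of the triangular gauge `z`. -/
noncomputable def refCov (z : ℂ) : Vect N :=
  siteCov fun n : Fin N => z * exp p.η ^ (N - (n : ℕ)) * exp (-p.ξ n)

/-- The last site is outermost. In the reversed list site n stands at position N - 1 - n, so N - n
is its position plus one. -/
theorem matched_refCov (z : ℂ) :
    p.Matched (fun n : Fin N => z * exp p.η ^ (N - (n : ℕ)) * exp (-p.ξ n)) z
      (List.finRange N).reverse := by
  refine p.matched_of_getElem fun i hi => ?_
  have hi' : i < N := by simpa using hi
  simp only [List.getElem_reverse, List.getElem_finRange, List.length_finRange, Fin.val_cast]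
  congr 3
  omega

/-- The boundary factor of the reference eigenvalue. -/
noncomputable def refFactor (z : ℂ) : ℂ :=
  (z * exp p.η ^ N * exp p.ζm +
    p.κm * (exp p.τm - (z * exp p.η ^ N) ^ 2 * exp (-p.τm))) / sinh p.ζm

theorem Bz_eq_contract (z l : ℂ) : p.Bz z l =
    contract (z * exp (-(l - p.η / 2))) (z * exp (l - p.η / 2)) (p.Uminus l) := by
  rw [Bz, contract, show z * exp (-(l - p.η / 2)) * (z * exp (l - p.η / 2)) = z ^ 2 by
    rw [Complex.exp_neg]; field_simp]

theorem refCov_vecMul_Bz (z l : ℂ) :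
    p.refCov z ᵥ* p.Bz z l =
      ((∏ n, sinh (l - p.ξ n + p.η / 2) * sinh (l + p.ξ n - p.η / 2)) *
        (sinh (2 * l - p.η) * p.refFactor z)) • p.refCov (z * exp (-(2 * p.η))) := by
  have h := p.siteCov_vecMul_contract l (List.finRange N).reverse _ z
    (List.nodup_reverse.2 (List.nodup_finRange N)) (p.matched_refCov z)
  rw [Bz_eq_contract, Uminus_eq_Ulist, refCov, h]
  congr 1
  · rw [List.map_reverse, List.prod_reverse, ← List.ofFn_eq_map, List.prod_ofFn, refFactor]
    rw [List.length_reverse, List.length_finRange, div_mul_eq_mul_div, mul_div_assoc]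
  · rw [refCov]
    congr 1
    funext n
    simp
    ring

theorem refCov_vecMul_Az (z : ℂ) (n : Fin N) : p.refCov z ᵥ* p.Az z (p.ξ n - p.η / 2) = 0 := by
  have h := p.siteCov_vecMul_row_Ulist rfl (List.finRange N).reverse _ z
    (List.nodup_reverse.2 (List.nodup_finRange N)) (m := n) (by simp) (p.matched_refCov z) 0
  have e : p.Az z (p.ξ n - p.η / 2) = exp (p.ξ n - p.η / 2 - p.η / 2) •
      (p.Uminus (p.ξ n - p.η / 2) 0 0 - (z * exp (-(p.ξ n - p.η / 2 - p.η / 2))) •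
        p.Uminus (p.ξ n - p.η / 2) 1 0) := by
    rw [Az, smul_sub, smul_smul, Complex.exp_neg]
    congr 2
    field_simp
  rw [e, Uminus_eq_Ulist, vecMul_smul, refCov, h, smul_zero]

end Chain

end ReferenceCovectors

end OpenXXZ

namespace OpenXXZ

/-! ### Continuity and the cancellation of factors with isolated zeros -/

section Density

open Filter Topology

/-- At a zero of sinh the cosh does not vanish, so the derivative is nonzero and the zero is
isolated. -/
theorem eventually_sinh_ne_zero {b : ℂ} (hb : b ≠ 0) (a l : ℂ) :
    ∀ᶠ x in 𝓝[≠] l, sinh (b * x + a) ≠ 0 := by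
  by_cases h : sinh (b * l + a) = 0
  · have hd : HasDerivAt (fun x => sinh (b * x + a)) (cosh (b * l + a) * b) l := by
      have h1 : HasDerivAt (fun x : ℂ => b * x + a) b l := by
        simpa using ((hasDerivAt_id l).const_mul b).add_const a
      exact h1.csinh
    refine hd.eventually_ne (mul_ne_zero (fun hc => ?_) hb)
    have := cosh_sq_sub_sinh_sq (b * l + a)
    simp [h, hc] at this
  · have hc : Continuous fun x => sinh (b * x + a) := by fun_prop
    exact (hc.continuousAt.eventually_ne h).filter_mono nhdsWithin_le_nhds

theorem eq_of_eventually_punctured {V : Type*} [TopologicalSpace V] [T2Space V] {f g : ℂ → V}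
    (hf : Continuous f) (hg : Continuous g) {l : ℂ} (h : ∀ᶠ x in 𝓝[≠] l, f x = g x) :
    f l = g l :=
  tendsto_nhds_unique_of_eventuallyEq ((hf.tendsto l).mono_left nhdsWithin_le_nhds)
    ((hg.tendsto l).mono_left nhdsWithin_le_nhds) h

end Density

section Continuity

variable {N : ℕ} {X : Type*} [TopologicalSpace X]

theorem continuous_siteOp (n : Fin N) {m : X → Matrix (Fin 2) (Fin 2) ℂ} (hm : Continuous m) :
    Continuous fun x => siteOp n (m x) := by
  refine continuous_matrix fun s t => ?_
  simp only [siteOp, of_apply]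
  split_ifs
  · exact hm.matrix_elem _ _
  · exact continuous_const

theorem continuous_RMatrix {η l : X → ℂ} (hη : Continuous η) (hl : Continuous l) :
    Continuous fun x => RMatrix (η x) (l x) := by
  refine continuous_matrix fun s t => ?_
  simp only [RMatrix, of_apply]
  split_ifs <;> fun_prop

/-- The chain with the crossing parameter replaced by `η`. -/
noncomputable def Chain.withEta (p : Chain N) (η : ℂ) : Chain N := { p with η := η }

variable (p : Chain N)

theorem Chain.continuous_R0 (n : Fin N) {η l : X → ℂ} (hη : Continuous η) (hl : Continuous l) :
    Continuous fun x => (p.withEta (η x)).R0 n (l x) := by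
  refine continuous_matrix fun i j => ?_
  simp only [Chain.R0, of_apply]
  refine continuous_siteOp n (continuous_matrix fun a b => ?_)
  exact (continuous_RMatrix hη hl).matrix_elem (i, a) (j, b)

theorem continuous_KMatrix (ζ κ τ : ℂ) {η l : X → ℂ} (hη : Continuous η) (hl : Continuous l) :
    Continuous fun x => KMatrix (η x) ζ κ τ (l x) := by
  refine continuous_matrix fun i j => ?_
  fin_cases i <;> fin_cases j <;> simp [KMatrix] <;> fun_prop

theorem continuous_lift {A : X → Matrix (Fin 2) (Fin 2) ℂ} (hA : Continuous A) :
    Continuous fun x => (lift (A x) : AuxOp N) := by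
  refine continuous_matrix fun i j => ?_
  simp only [lift_apply]
  exact (hA.matrix_elem i j).smul continuous_const

theorem Chain.continuous_Ulist {η l : X → ℂ} (hη : Continuous η) (hl : Continuous l) :
    ∀ ns : List (Fin N), Continuous fun x => (p.withEta (η x)).Ulist ns (l x)
  | [] => by
    simp only [Ulist_nil]
    exact continuous_lift (continuous_KMatrix _ _ _ hη hl)
  | n :: ns => by
    simp only [Ulist_cons]
    have h1 : Continuous fun x => l x - p.ξ n - η x / 2 := by fun_prop
    have h2 : Continuous fun x => l x + p.ξ n - η x / 2 := by fun_prop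
    exact ((p.continuous_R0 n hη h1).matrix_mul (Chain.continuous_Ulist hη hl ns)).matrix_mul
      (p.continuous_R0 n hη h2)

theorem Chain.continuous_Uminus {η l : X → ℂ} (hη : Continuous η) (hl : Continuous l) :
    Continuous fun x => (p.withEta (η x)).Uminus (l x) := by
  simp only [Uminus_eq_Ulist]
  exact p.continuous_Ulist hη hl _

theorem Chain.continuous_transfer {η l : X → ℂ} (hη : Continuous η) (hl : Continuous l) :
    Continuous fun x => (p.withEta (η x)).transfer (l x) := by
  have hK : Continuous fun x => (p.withEta (η x)).Kplus (l x) :=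
    continuous_KMatrix _ _ _ hη (hl.add hη)
  exact ((continuous_lift hK).matrix_mul (p.continuous_Uminus hη hl)).matrix_trace

theorem Chain.continuous_Bz (z : ℂ) : Continuous fun l => p.Bz z l := by
  have h : Continuous fun l => p.Uminus l := p.continuous_Uminus continuous_const continuous_id
  have h' := fun i j => h.matrix_elem i j
  simp only [Chain.Bz]
  have h1 : Continuous fun l : ℂ => z * exp (l - p.η / 2) := by fun_prop
  have h2 : Continuous fun l : ℂ => z * exp (-(l - p.η / 2)) := by fun_prop
  have h3 : Continuous fun _ : ℂ => z ^ 2 := continuous_const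
  exact (((h1.smul (h' 0 0)).add (h' 0 1)).sub (h3.smul (h' 1 0))).sub
    (h2.smul (h' 1 1))

end Continuity

namespace Chain

/-! ### Separate covectors -/

section SeparateStates

variable {N : ℕ} (p : Chain N) (αm βm : ℂ)

/-- The separate covectors of the triangular gauge `z`, for a list of excited sites. -/
noncomputable def sepCov (z : ℂ) : List (Fin N) → Vect N
  | [] => p.refCov z
  | n :: ns => (p.AMinus αm βm (p.η / 2 - p.ξ n))⁻¹ • (sepCov z ns ᵥ* p.Az z (p.η / 2 - p.ξ n))

/-- The configuration of a list of excited sites. -/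
noncomputable def confOf (ns : List (Fin N)) : Conf N := fun n => if n ∈ ns then 1 else 0

/-- The pseudo-eigenvalue of `Bz z`. -/
noncomputable def sepVal (z : ℂ) (h : Conf N) (l : ℂ) : ℂ :=
  (∏ n, sinh (l - p.sep n (h n)) * sinh (l + p.sep n (h n))) *
    (sinh (2 * l - p.η) * p.refFactor z)

theorem sep_zero (n : Fin N) : p.sep n 0 = p.ξ n - p.η / 2 := by
  simp [sep]; ring

theorem sep_one (n : Fin N) : p.sep n 1 = p.ξ n + p.η / 2 := by
  simp [sep]; ring

theorem continuous_sepVal (z : ℂ) (h : Conf N) : Continuous (p.sepVal z h) := by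
  unfold sepVal
  fun_prop

theorem sepVal_eq_zero (z : ℂ) {h : Conf N} {l : ℂ} (n : Fin N)
    (hl : l = p.sep n (h n) ∨ l = -p.sep n (h n)) : p.sepVal z h l = 0 := by
  rw [sepVal, Finset.prod_eq_zero (Finset.mem_univ n), zero_mul]
  rcases hl with hl | hl <;> simp [hl]

variable {p αm βm}

/-- The unwanted term of `Az_mul_Bz` begins with `Bz z m`, and m = -ζ_n^{(0)} is a zero for the
shorter covector. The remaining coefficient replaces the zeros ±ζ_n^{(0)} by ±ζ_n^{(1)}. The
prefactor sinh(x - m) sinh(x + m) is cancelled away from its zeros and then by continuity. -/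
theorem sepCov_vecMul_Bz (z : ℂ) : ∀ {ns : List (Fin N)}, ns.Nodup → ∀ l,
    p.sepCov αm βm z ns ᵥ* p.Bz z l =
      p.sepVal z (confOf ns) l • p.sepCov αm βm (z * exp (-(2 * p.η))) ns
  | [], _, l => by
    rw [sepCov, refCov_vecMul_Bz, sepCov, sepVal]
    congr 2
    refine Finset.prod_congr rfl fun n _ => ?_
    simp only [confOf, List.not_mem_nil, if_false, sep_zero]
    rw [show l - (p.ξ n - p.η / 2) = l - p.ξ n + p.η / 2 by ring,
      show l + (p.ξ n - p.η / 2) = l + p.ξ n - p.η / 2 by ring]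
  | n :: ns, hnd, l => by
    rw [List.nodup_cons] at hnd
    have ih := sepCov_vecMul_Bz z hnd.2
    obtain ⟨m, hm⟩ : ∃ m, m = p.η / 2 - p.ξ n := ⟨_, rfl⟩
    have hcn : confOf ns n = 0 := by simp [confOf, hnd.1]
    have h0 : p.sepCov αm βm z ns ᵥ* p.Bz z m = 0 := by
      rw [ih, p.sepVal_eq_zero z n, zero_smul]
      right; rw [hm, hcn, sep_zero]; ring
    have key : ∀ x, (sinh (x - m) * sinh (x + m)) •
        (p.sepCov αm βm z ns ᵥ* p.Az z m ᵥ* p.Bz z x) =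
        (sinh (x - m) * sinh (x + m)) • (p.sepVal z (confOf (n :: ns)) x •
          (p.sepCov αm βm (z * exp (-(2 * p.η))) ns ᵥ* p.Az (z * exp (-(2 * p.η))) m)) := by
      intro x
      have h1 := congrArg (fun O => p.sepCov αm βm z ns ᵥ* O) (p.Az_mul_Bz z x m)
      simp only [vecMul_smul, vecMul_sub, ← vecMul_vecMul, h0, zero_vecMul, sub_zero, ih,
        smul_vecMul] at h1
      rw [h1, smul_smul, smul_smul]
      congr 1
      rw [sepVal, sepVal, ← Finset.mul_prod_erase _ _ (Finset.mem_univ n),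
        ← Finset.mul_prod_erase _ _ (Finset.mem_univ n)]
      have h2 : ∏ k ∈ Finset.univ.erase n, sinh (x - p.sep k (confOf (n :: ns) k)) *
          sinh (x + p.sep k (confOf (n :: ns) k)) =
          ∏ k ∈ Finset.univ.erase n, sinh (x - p.sep k (confOf ns k)) *
            sinh (x + p.sep k (confOf ns k)) :=
        Finset.prod_congr rfl fun k hk => by
          simp [confOf, Finset.ne_of_mem_erase hk]
      rw [h2, hcn, show confOf (n :: ns) n = 1 by simp [confOf], sep_zero, sep_one, hm,
        show x - (p.ξ n - p.η / 2) = x + (p.η / 2 - p.ξ n) by ring,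
        show x + (p.ξ n - p.η / 2) = x - (p.η / 2 - p.ξ n) by ring,
        show x - (p.ξ n + p.η / 2) = x + (p.η / 2 - p.ξ n) - p.η by ring,
        show x + (p.ξ n + p.η / 2) = x - (p.η / 2 - p.ξ n) + p.η by ring]
      ring
    have key2 : p.sepCov αm βm z ns ᵥ* p.Az z m ᵥ* p.Bz z l = p.sepVal z (confOf (n :: ns)) l •
          (p.sepCov αm βm (z * exp (-(2 * p.η))) ns ᵥ* p.Az (z * exp (-(2 * p.η))) m) := by
      refine eq_of_eventually_punctured
        (f := fun l => p.sepCov αm βm z ns ᵥ* p.Az z m ᵥ* p.Bz z l)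
        (g := fun l => p.sepVal z (confOf (n :: ns)) l •
          (p.sepCov αm βm (z * exp (-(2 * p.η))) ns ᵥ* p.Az (z * exp (-(2 * p.η))) m))
        (continuous_const.matrix_vecMul (p.continuous_Bz z)) ?_ ?_
      · exact (p.continuous_sepVal z _).smul continuous_const
      · filter_upwards [eventually_sinh_ne_zero one_ne_zero (-m) l,
          eventually_sinh_ne_zero one_ne_zero m l] with x h1 h2
        rw [one_mul, ← sub_eq_add_neg] at h1
        rw [one_mul] at h2
        exact smul_right_injective _ (mul_ne_zero h1 h2) (key x)
    rw [sepCov, sepCov, smul_vecMul, ← hm, key2, smul_comm]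

theorem sepCov_vecMul_Bz_eq_zero (z : ℂ) {ns : List (Fin N)} (hns : ns.Nodup) {n : Fin N}
    (hn : n ∉ ns) {l : ℂ} (hl : l = p.ξ n - p.η / 2 ∨ l = p.η / 2 - p.ξ n) :
    p.sepCov αm βm z ns ᵥ* p.Bz z l = 0 := by
  rw [sepCov_vecMul_Bz z hns, p.sepVal_eq_zero z n, zero_smul]
  simp only [confOf, hn, if_false, sep_zero, neg_sub, hl]

variable (hG : p.Generic αm βm)
include hG

theorem Generic.shift {a b : Fin N} (h : a ≠ b) {x : ℂ} (r : ℤ) (hr : |r| ≤ 1)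
    (hx : x = p.ξ a - p.ξ b + r * p.η ∨ x = p.ξ a + p.ξ b + r * p.η) : sinh x ≠ 0 := by
  rcases hx with rfl | rfl
  · exact (hG.1 a b h r hr).1
  · exact (hG.1 a b h r hr).2

theorem Generic.double (a : Fin N) {x : ℂ} (r : ℤ) (hr : |r| ≤ 2)
    (hx : x = 2 * p.ξ a + r * p.η) : sinh x ≠ 0 :=
  hx ▸ hG.2.1 a r hr

/-- 𝖠₋(η/2 - ξ_n) is nonzero and has sinh(-η) as a factor, coming from d at site n. -/
theorem Generic.sinh_eta (n : Fin N) : sinh p.η ≠ 0 := by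
  intro h
  refine (hG.2.2 n).1 ?_
  rw [AMinus, dFun, aFun, aFun, Finset.prod_eq_zero (Finset.mem_univ n)
    (f := fun k => sinh (-(p.η / 2 - p.ξ n) - p.η - p.ξ k + p.η / 2)), mul_zero]
  rw [show -(p.η / 2 - p.ξ n) - p.η - p.ξ n + p.η / 2 = -p.η by ring, sinh_neg, h, neg_zero]

/-- On the inner covector both `Bz` terms of `Az_mul_Az` vanish, and genericity cancels the sinh
prefactors. -/
theorem sepCov_swap (z : ℂ) {ns : List (Fin N)} {n m : Fin N} (h : (n :: m :: ns).Nodup) :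
    p.sepCov αm βm z (n :: m :: ns) = p.sepCov αm βm z (m :: n :: ns) := by
  simp only [List.nodup_cons, List.mem_cons, not_or] at h
  obtain ⟨⟨hnm, hn⟩, hm, hns⟩ := h
  have hBn := sepCov_vecMul_Bz_eq_zero (p := p) (αm := αm) (βm := βm) z hns hn (Or.inr rfl)
  have hBm := sepCov_vecMul_Bz_eq_zero (p := p) (αm := αm) (βm := βm) z hns hm (Or.inr rfl)
  have h1 := congrArg (fun O => p.sepCov αm βm z ns ᵥ* O)
    (p.Az_mul_Az z (p.η / 2 - p.ξ n) (p.η / 2 - p.ξ m))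
  simp only [vecMul_smul, vecMul_add, ← vecMul_vecMul, hBn, hBm, zero_vecMul, smul_zero,
    add_zero] at h1
  have h2 : sinh (p.η / 2 - p.ξ n - (p.η / 2 - p.ξ m) + p.η) ≠ 0 :=
    hG.shift (Ne.symm hnm) 1 (by simp) (Or.inl (by push_cast; ring))
  have h3 : sinh (p.η / 2 - p.ξ n + (p.η / 2 - p.ξ m)) ≠ 0 := by
    rw [← neg_ne_zero, ← sinh_neg]
    exact hG.shift hnm (-1) (by simp) (Or.inr (by push_cast; ring))
  have h4 := smul_right_injective _ h3 (smul_right_injective _ h2 h1)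
  simp only [sepCov, smul_vecMul, h4]
  rw [smul_comm]

theorem sepCov_perm (z : ℂ) {ns ms : List (Fin N)} (h : ns.Perm ms) (hns : ns.Nodup) :
    p.sepCov αm βm z ns = p.sepCov αm βm z ms := by
  induction h with
  | nil => rfl
  | cons n _ ih => rw [sepCov, sepCov, ih (List.nodup_cons.1 hns).2]
  | swap n m _ => exact sepCov_swap hG z hns
  | trans h₁ _ ih₁ ih₂ => exact (ih₁ hns).trans (ih₂ (h₁.nodup_iff.1 hns))

theorem sepCov_vecMul_Az_raise (z : ℂ) (ns : List (Fin N)) (n : Fin N) :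
    p.sepCov αm βm z ns ᵥ* p.Az z (p.η / 2 - p.ξ n) =
      p.AMinus αm βm (p.η / 2 - p.ξ n) • p.sepCov αm βm z (n :: ns) := by
  rw [sepCov, smul_smul, mul_inv_cancel₀ (hG.2.2 n).1, one_smul]

/-- Commuting `Az z (ξ_n - η/2)` past the raising operators of the other sites brings it to the
reference covector, which it annihilates. -/
theorem sepCov_vecMul_Az_zero (z : ℂ) {n : Fin N} : ∀ {ns : List (Fin N)}, ns.Nodup → n ∉ ns →
    p.sepCov αm βm z ns ᵥ* p.Az z (p.ξ n - p.η / 2) = 0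
  | [], _, _ => p.refCov_vecMul_Az z n
  | m :: ns, hnd, hn => by
    simp only [List.nodup_cons, List.mem_cons, not_or] at hnd hn
    have ih := sepCov_vecMul_Az_zero z hnd.2 hn.2
    have hBn := sepCov_vecMul_Bz_eq_zero (p := p) (αm := αm) (βm := βm) z hnd.2 hn.2 (Or.inl rfl)
    have hBm := sepCov_vecMul_Bz_eq_zero (p := p) (αm := αm) (βm := βm) z hnd.2 hnd.1 (Or.inr rfl)
    have h1 := congrArg (fun O => p.sepCov αm βm z ns ᵥ* O)
      (p.Az_mul_Az z (p.ξ n - p.η / 2) (p.η / 2 - p.ξ m))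
    simp only [vecMul_smul, vecMul_add, ← vecMul_vecMul, hBn, hBm, zero_vecMul, smul_zero,
      add_zero, ih] at h1
    have h2 : sinh (p.ξ n - p.η / 2 - (p.η / 2 - p.ξ m) + p.η) ≠ 0 :=
      hG.shift hn.1 0 (by simp) (Or.inr (by push_cast; ring))
    have h3 : sinh (p.ξ n - p.η / 2 + (p.η / 2 - p.ξ m)) ≠ 0 :=
      hG.shift hn.1 0 (by simp) (Or.inl (by push_cast; ring))
    have h4 := (smul_eq_zero.1 ((smul_eq_zero.1 h1.symm).resolve_left h2)).resolve_left h3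
    rw [sepCov, smul_vecMul, h4, smul_zero]

/-- Here -ξ_n - η/2 = m - η with m = η/2 - ξ_n the raising point, so the fusion relation applies. -/
theorem sepCov_vecMul_Az_vanish (z : ℂ) {n : Fin N} {ns : List (Fin N)} (hnd : (n :: ns).Nodup) :
    p.sepCov αm βm z (n :: ns) ᵥ* p.Az z (-p.ξ n - p.η / 2) = 0 := by
  rw [List.nodup_cons] at hnd
  have hBn := sepCov_vecMul_Bz_eq_zero (p := p) (αm := αm) (βm := βm) z hnd.2 hnd.1 (Or.inr rfl)
  have h1 := congrArg (fun O => p.sepCov αm βm z ns ᵥ* O)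
    (p.Az_mul_Az_sub_eta (hG.sinh_eta n) n rfl z)
  simp only [vecMul_smul, vecMul_add, ← vecMul_vecMul, hBn, zero_vecMul, smul_zero,
    add_zero, vecMul_zero] at h1
  have h2 : sinh (2 * (p.η / 2 - p.ξ n) - p.η) ≠ 0 := by
    rw [← neg_ne_zero, ← sinh_neg]
    exact hG.double n 0 (by simp) (by push_cast; ring)
  have h3 := (smul_eq_zero.1 h1).resolve_left h2
  rw [sepCov, smul_vecMul, show -p.ξ n - p.η / 2 = p.η / 2 - p.ξ n - p.η by ring, h3, smul_zero]

variable (hζ : sinh p.ζm ≠ 0) (hκ : p.κm ≠ 0)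
  (h₁ : sinh αm * cosh βm = sinh p.ζm / (2 * p.κm))
  (h₂ : cosh αm * sinh βm = cosh p.ζm / (2 * p.κm))
include hζ hκ h₁ h₂

/-- Here ξ_n + η/2 = η - m with m the raising point, so the inversion relation cancels the
excitation. -/
theorem sepCov_vecMul_Az_lower (z : ℂ) {n : Fin N} {ns : List (Fin N)} (hnd : (n :: ns).Nodup) :
    p.sepCov αm βm z (n :: ns) ᵥ* p.Az z (p.ξ n + p.η / 2) =
      p.AMinus αm βm (p.ξ n + p.η / 2) • p.sepCov αm βm z ns := by
  rw [List.nodup_cons] at hnd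
  have hBn := sepCov_vecMul_Bz_eq_zero (p := p) (αm := αm) (βm := βm) z hnd.2 hnd.1 (Or.inr rfl)
  have h3 := congrArg (fun O => p.sepCov αm βm z ns ᵥ* O)
    (p.Az_mul_Az_inversion hζ hκ h₁ h₂ z (p.η / 2 - p.ξ n))
  simp only [vecMul_smul, vecMul_add, ← vecMul_vecMul, hBn, zero_vecMul, 
    add_zero, vecMul_one] at h3
  rw [sepCov, smul_vecMul, show p.ξ n + p.η / 2 = p.η - (p.η / 2 - p.ξ n) by ring, h3, smul_smul,
    inv_mul_cancel_left₀ (hG.2.2 n).1]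

/-- If an excited covector were zero, lowering would make the previous one zero, down to the
reference covector, whose component at the zero configuration is ±1. -/
theorem sepCov_ne_zero (z : ℂ) : ∀ {ns : List (Fin N)}, ns.Nodup → p.sepCov αm βm z ns ≠ 0
  | [], _ => fun h => by
    have := congrFun h fun _ => 0
    simp [sepCov, refCov, siteCov] at this
  | n :: ns, hnd => fun h => by
    have h3 := sepCov_vecMul_Az_lower hG hζ hκ h₁ h₂ z hnd
    rw [h, zero_vecMul] at h3
    have h4 := (smul_eq_zero.1 h3.symm).resolve_left (by rw [add_comm]; exact (hG.2.2 n).2)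
    exact sepCov_ne_zero z (List.nodup_cons.1 hnd).2 h4

end SeparateStates

end Chain

end OpenXXZ

namespace OpenXXZ

theorem isStateBasis_of_linearIndependent {N : ℕ} {E : Conf N → Vect N}
    (h : LinearIndependent ℂ E) : IsStateBasis E :=
  ⟨h, h.span_eq_top_of_card_eq_finrank' (by rw [Module.finrank_fintype_fun_eq_card])⟩

namespace Chain

/-! ### The separate covectors form a basis -/

section SeparateBasis

variable {N : ℕ} (p : Chain N) (αm βm : ℂ)

/-- The separate covectors of the triangular gauge `z`. -/
noncomputable def sepConf (z : ℂ) (h : Conf N) : Vect N :=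
  p.sepCov αm βm z ((List.finRange N).filter fun n => h n = 1)

theorem nodup_filter_finRange (h : Conf N) :
    ((List.finRange N).filter fun n => h n = 1).Nodup :=
  (List.nodup_finRange N).filter _

theorem mem_filter_finRange {h : Conf N} {n : Fin N} :
    n ∈ ((List.finRange N).filter fun n => h n = 1) ↔ h n = 1 := by simp

theorem fin_two_ne_one {a : Fin 2} : a ≠ 1 ↔ a = 0 := by omega

theorem confOf_filter (h : Conf N) :
    confOf ((List.finRange N).filter fun n => h n = 1) = h := by
  funext n
  simp only [confOf, mem_filter_finRange]
  split_ifs with hn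
  · exact hn.symm
  · exact (fin_two_ne_one.1 hn).symm

variable {p αm βm}

theorem sepConf_vecMul_Bz (z : ℂ) (h : Conf N) (l : ℂ) :
    p.sepConf αm βm z h ᵥ* p.Bz z l =
      p.sepVal z h l • p.sepConf αm βm (z * exp (-(2 * p.η))) h := by
  rw [sepConf, sepCov_vecMul_Bz z (nodup_filter_finRange h), confOf_filter, sepConf]

variable (hG : p.Generic αm βm)
include hG

theorem sepCov_eq_sepConf (z : ℂ) {ns : List (Fin N)} (hns : ns.Nodup) {h : Conf N}
    (hh : ∀ n, n ∈ ns ↔ h n = 1) : p.sepCov αm βm z ns = p.sepConf αm βm z h :=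
  sepCov_perm hG z ((List.perm_ext_iff_of_nodup hns (nodup_filter_finRange h)).2 fun n => by
    rw [hh, mem_filter_finRange]) hns

theorem sepConf_vecMul_Az_raise (z : ℂ) {h : Conf N} {n : Fin N} (hn : h n = 0) :
    p.sepConf αm βm z h ᵥ* p.Az z (p.η / 2 - p.ξ n) =
      p.AMinus αm βm (p.η / 2 - p.ξ n) • p.sepConf αm βm z (Function.update h n 1) := by
  rw [sepConf, sepCov_vecMul_Az_raise hG, sepCov_eq_sepConf hG z]
  · rw [List.nodup_cons, mem_filter_finRange]
    exact ⟨by simp [hn], nodup_filter_finRange h⟩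
  · intro k
    rw [List.mem_cons, mem_filter_finRange]
    by_cases hk : k = n
    · simp [hk]
    · simp [hk]

theorem sepConf_vecMul_Az_zero (z : ℂ) {h : Conf N} {n : Fin N} (hn : h n = 0) :
    p.sepConf αm βm z h ᵥ* p.Az z (p.ξ n - p.η / 2) = 0 :=
  sepCov_vecMul_Az_zero hG z (nodup_filter_finRange h) (by rw [mem_filter_finRange]; simp [hn])

theorem exists_sepCov_cons (z : ℂ) {h : Conf N} {n : Fin N} (hn : h n = 1) :
    ∃ ns : List (Fin N), (n :: ns).Nodup ∧ p.sepConf αm βm z h = p.sepCov αm βm z (n :: ns) ∧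
      p.sepCov αm βm z ns = p.sepConf αm βm z (Function.update h n 0) := by
  have hnd : (n :: (List.finRange N).filter fun k => Function.update h n 0 k = 1).Nodup := by
    rw [List.nodup_cons, mem_filter_finRange]
    exact ⟨by simp, nodup_filter_finRange _⟩
  refine ⟨_, hnd, (sepCov_eq_sepConf hG z hnd fun k => ?_).symm, rfl⟩
  rw [List.mem_cons, mem_filter_finRange]
  by_cases hk : k = n
  · simp [hk, hn]
  · simp [hk]

theorem sepConf_vecMul_Az_vanish (z : ℂ) {h : Conf N} {n : Fin N} (hn : h n = 1) :
    p.sepConf αm βm z h ᵥ* p.Az z (-p.ξ n - p.η / 2) = 0 := by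
  obtain ⟨ns, hnd, h1, -⟩ := exists_sepCov_cons hG z hn
  rw [h1, sepCov_vecMul_Az_vanish hG z hnd]

theorem sinh_sep_sub_ne_zero {n m : Fin N} (hnm : n ≠ m) (a b : Fin 2) :
    sinh (p.sep n a - p.sep m b) ≠ 0 := by
  fin_cases a <;> fin_cases b
  · exact hG.shift hnm 0 (by simp) (Or.inl (by simp [sep]))
  · exact hG.shift hnm (-1) (by simp) (Or.inl (by simp [sep]; ring))
  · exact hG.shift hnm 1 (by simp) (Or.inl (by simp [sep]; ring))
  · exact hG.shift hnm 0 (by simp) (Or.inl (by simp [sep]))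

theorem sinh_sep_add_ne_zero {n m : Fin N} (hnm : n ≠ m) (a b : Fin 2) :
    sinh (p.sep n a + p.sep m b) ≠ 0 := by
  fin_cases a <;> fin_cases b
  · exact hG.shift hnm (-1) (by simp) (Or.inr (by simp [sep]; ring))
  · exact hG.shift hnm 0 (by simp) (Or.inr (by simp [sep]; ring))
  · exact hG.shift hnm 0 (by simp) (Or.inr (by simp [sep]; ring))
  · exact hG.shift hnm 1 (by simp) (Or.inr (by simp [sep]; ring))

theorem sepVal_ne_zero {z : ℂ} (hz : p.refFactor z ≠ 0) (h : Conf N) (n : Fin N) {a : Fin 2}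
    (ha : h n ≠ a) : p.sepVal z h (p.sep n a) ≠ 0 := by
  refine mul_ne_zero (Finset.prod_ne_zero_iff.2 fun m _ => ?_) (mul_ne_zero ?_ hz)
  · by_cases hm : n = m
    · subst hm
      have h01 : (h n = 0 ∧ a = 1) ∨ (h n = 1 ∧ a = 0) := by omega
      rcases h01 with ⟨h0, h1⟩ | ⟨h0, h1⟩ <;> rw [h0, h1, sep_zero, sep_one]
      · refine mul_ne_zero ?_ (hG.double n 0 (by simp) (by simp; ring))
        rw [show p.ξ n + p.η / 2 - (p.ξ n - p.η / 2) = p.η by ring]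
        exact hG.sinh_eta n
      · refine mul_ne_zero ?_ (hG.double n 0 (by simp) (by simp; ring))
        rw [show p.ξ n - p.η / 2 - (p.ξ n + p.η / 2) = -p.η by ring, sinh_neg]
        exact neg_ne_zero.2 (hG.sinh_eta n)
    · exact mul_ne_zero (sinh_sep_sub_ne_zero hG hm _ _) (sinh_sep_add_ne_zero hG hm _ _)
  · fin_cases a
    · exact hG.double n (-2) (by simp) (by simp [sep]; ring)
    · exact hG.double n 0 (by simp) (by simp [sep]; ring)

theorem sepVal_separates {z : ℂ} (hz : p.refFactor z ≠ 0) {h k : Conf N} (hk : h ≠ k) :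
    ∃ l, p.sepVal z h l = 0 ∧ p.sepVal z k l ≠ 0 := by
  obtain ⟨n, hn⟩ := Function.ne_iff.1 hk
  exact ⟨p.sep n (h n), p.sepVal_eq_zero z n (Or.inl rfl), sepVal_ne_zero hG hz k n hn.symm⟩

variable (hζ : sinh p.ζm ≠ 0) (hκ : p.κm ≠ 0)
  (h₁ : sinh αm * cosh βm = sinh p.ζm / (2 * p.κm))
  (h₂ : cosh αm * sinh βm = cosh p.ζm / (2 * p.κm))
include hζ hκ h₁ h₂

theorem sepConf_vecMul_Az_lower (z : ℂ) {h : Conf N} {n : Fin N} (hn : h n = 1) :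
    p.sepConf αm βm z h ᵥ* p.Az z (p.ξ n + p.η / 2) =
      p.AMinus αm βm (p.ξ n + p.η / 2) • p.sepConf αm βm z (Function.update h n 0) := by
  obtain ⟨ns, hnd, h3, h4⟩ := exists_sepCov_cons hG z hn
  rw [h3, sepCov_vecMul_Az_lower hG hζ hκ h₁ h₂ z hnd, h4]

theorem sepConf_ne_zero (z : ℂ) (h : Conf N) : p.sepConf αm βm z h ≠ 0 :=
  sepCov_ne_zero hG hζ hκ h₁ h₂ z (nodup_filter_finRange h)

/-- N successive `Bz`, each multiplying the gauge parameter by e^{-2η}, are applied to a linear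
relation. Their arguments are chosen so that only the term of k remains. -/
theorem isStateBasis_sepConf {z : ℂ} (hz : ∀ j < N, p.refFactor (z * exp (-(2 * p.η)) ^ j) ≠ 0) :
    IsStateBasis (p.sepConf αm βm z) := by
  refine isStateBasis_of_linearIndependent (Fintype.linearIndependent_iff.2 fun c hc k => ?_)
  -- Adding 1 in `Fin 2` flips the spin: step j annihilates each h with h_j ≠ k_j and not k. The
  -- value 0 for j ≥ N is never reached.
  set l : ℕ → ℂ := fun j => if hj : j < N then p.sep ⟨j, hj⟩ (k ⟨j, hj⟩ + 1) else 0 with hl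
  have key : ∀ m, ∑ h, (c h * ∏ j ∈ Finset.range m,
      p.sepVal (z * exp (-(2 * p.η)) ^ j) h (l j)) •
        p.sepConf αm βm (z * exp (-(2 * p.η)) ^ m) h = 0 := by
    intro m
    induction m with
    | zero => simpa using hc
    | succ m ih =>
      have h3 := congrArg (fun v => v ᵥ* p.Bz (z * exp (-(2 * p.η)) ^ m) (l m)) ih
      simp only [zero_vecMul, sum_vecMul, smul_vecMul, sepConf_vecMul_Bz, smul_smul] at h3
      rw [← h3]
      refine Finset.sum_congr rfl fun h _ => ?_
      rw [Finset.prod_range_succ, pow_succ, mul_assoc, mul_assoc]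
  have h3 := key N
  rw [Finset.sum_eq_single k] at h3
  · have h4 := (smul_eq_zero.1 h3).resolve_right (sepConf_ne_zero hG hζ hκ h₁ h₂ _ k)
    refine (mul_eq_zero.1 h4).resolve_right (Finset.prod_ne_zero_iff.2 fun j hj => ?_)
    have hj' := Finset.mem_range.1 hj
    simp only [hl, hj', dif_pos]
    exact sepVal_ne_zero hG (hz j hj') k _ (by omega)
  · intro h _ hk
    obtain ⟨n, hn⟩ := Function.ne_iff.1 hk
    rw [Finset.prod_eq_zero (Finset.mem_range.2 n.2), mul_zero, zero_smul]
    refine p.sepVal_eq_zero _ n (Or.inl ?_)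
    simp only [hl, n.2, dif_pos, Fin.eta]
    congr 1
    omega
  · simp

end SeparateBasis

end Chain

end OpenXXZ

namespace OpenXXZ

/-! ### Laurent polynomials in the exponential -/

section LaurentPolynomials

open Polynomial

/-- `f` is a Laurent polynomial in `exp l` with exponents between `-d` and `d`, and `c` is its
coefficient at `exp l ^ d`. -/
def IsExpLaurent (d : ℕ) (f : ℂ → ℂ) (c : ℂ) : Prop :=
  ∃ P : ℂ[X], P.natDegree ≤ 2 * d ∧ P.coeff (2 * d) = c ∧ ∀ l, f l * exp l ^ d = P.eval (exp l)

namespace IsExpLaurent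

variable {d e : ℕ} {f g : ℂ → ℂ} {a b c : ℂ}

theorem const (c : ℂ) : IsExpLaurent 0 (fun _ => c) c :=
  ⟨C c, by simp, by simp, by simp⟩

theorem mul (hf : IsExpLaurent d f a) (hg : IsExpLaurent e g b) :
    IsExpLaurent (d + e) (fun l => f l * g l) (a * b) := by
  obtain ⟨P, hP, rfl, hP'⟩ := hf
  obtain ⟨Q, hQ, rfl, hQ'⟩ := hg
  refine ⟨P * Q, natDegree_mul_le.trans (by omega), ?_, fun l => ?_⟩
  · rw [mul_add, coeff_mul_add_eq_of_natDegree_le hP hQ]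
  · rw [eval_mul, ← hP', ← hQ', pow_add]
    ring

theorem add (hf : IsExpLaurent d f a) (hg : IsExpLaurent d g b) :
    IsExpLaurent d (fun l => f l + g l) (a + b) := by
  obtain ⟨P, hP, rfl, hP'⟩ := hf
  obtain ⟨Q, hQ, rfl, hQ'⟩ := hg
  exact ⟨P + Q, (natDegree_add_le _ _).trans (max_le hP hQ), by simp,
    fun l => by rw [eval_add, ← hP', ← hQ', add_mul]⟩

theorem const_mul (k : ℂ) (hf : IsExpLaurent d f a) :
    IsExpLaurent d (fun l => k * f l) (k * a) := by
  simpa using (const k).mul hf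

theorem mul_const (k : ℂ) (hf : IsExpLaurent d f a) :
    IsExpLaurent d (fun l => f l * k) (a * k) := by
  simpa using hf.mul (const k)

theorem sub (hf : IsExpLaurent d f a) (hg : IsExpLaurent d g b) :
    IsExpLaurent d (fun l => f l - g l) (a - b) := by
  simpa [sub_eq_add_neg] using hf.add (hg.const_mul (-1))

theorem sum {ι : Type*} (s : Finset ι) {f : ι → ℂ → ℂ} {a : ι → ℂ}
    (h : ∀ i ∈ s, IsExpLaurent d (f i) (a i)) :
    IsExpLaurent d (fun l => ∑ i ∈ s, f i l) (∑ i ∈ s, a i) := by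
  classical
  induction s using Finset.induction_on with
  | empty => exact ⟨0, by simp, by simp, by simp⟩
  | insert i s hi ih =>
    simp only [Finset.sum_insert hi]
    exact (h i (by simp)).add (ih fun j hj => h j (by simp [hj]))

theorem prod {ι : Type*} (s : Finset ι) {f : ι → ℂ → ℂ} {a : ι → ℂ}
    (h : ∀ i ∈ s, IsExpLaurent d (f i) (a i)) :
    IsExpLaurent (d * s.card) (fun l => ∏ i ∈ s, f i l) (∏ i ∈ s, a i) := by
  classical
  induction s using Finset.induction_on with
  | empty => simpa using const 1
  | insert i s hi ih =>
    simp only [Finset.prod_insert hi, Finset.card_insert_of_notMem hi, mul_add, mul_one]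
    rw [add_comm]
    exact (h i (by simp)).mul (ih fun j hj => h j (by simp [hj]))

theorem of_lt (hf : IsExpLaurent d f a) (h : d < e) : IsExpLaurent e f 0 := by
  obtain ⟨P, hP, -, hP'⟩ := hf
  refine ⟨P * X ^ (e - d), ?_, ?_, fun l => ?_⟩
  · exact natDegree_mul_le.trans (by rw [natDegree_X_pow]; omega)
  · refine coeff_eq_zero_of_natDegree_lt (natDegree_mul_le.trans_lt ?_)
    rw [natDegree_X_pow]; omega
  · rw [eval_mul, ← hP', eval_pow, eval_X, mul_assoc, ← pow_add]
    congr 2; omega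

theorem congr (hf : IsExpLaurent d f a) (h : ∀ l, g l = f l) (hab : a = b) :
    IsExpLaurent d g b := by
  rw [funext h, ← hab]
  exact hf

theorem sinh_add (b : ℂ) : IsExpLaurent 1 (fun l => sinh (l + b)) (exp b / 2) := by
  refine ⟨C (exp b / 2) * X ^ 2 + C (-(exp (-b) / 2)), ?_, ?_, fun l => ?_⟩
  · compute_degree
  · simp [coeff_X_pow]
  · simp only [Complex.sinh, neg_add, Complex.exp_add, Complex.exp_neg, eval_add, eval_mul, eval_C,
      eval_pow, eval_X]
    field_simp
    ring

theorem sinh_two_mul_add (b : ℂ) : IsExpLaurent 2 (fun l => sinh (2 * l + b)) (exp b / 2) := by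
  refine ⟨C (exp b / 2) * X ^ 4 + C (-(exp (-b) / 2)), ?_, ?_, fun l => ?_⟩
  · compute_degree
  · simp [coeff_X_pow]
  · simp only [Complex.sinh, neg_add, two_mul, Complex.exp_add, Complex.exp_neg, eval_add, eval_mul,
      eval_C, eval_pow, eval_X]
    field_simp
    ring

theorem cosh_two_mul : IsExpLaurent 2 (fun l => cosh (2 * l)) (1 / 2) := by
  refine ⟨C (1 / 2) * X ^ 4 + C (1 / 2), ?_, ?_, fun l => ?_⟩
  · compute_degree
  · simp [coeff_X_pow]
  · simp only [Complex.cosh, neg_add, two_mul, Complex.exp_add, Complex.exp_neg, eval_add, eval_mul,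
      eval_C, eval_pow, eval_X]
    field_simp

/-- An even Laurent polynomial in `exp l`, invariant under `l ↦ l + iπ`, without leading
coefficient vanishes if it has sufficiently many zeros. -/
theorem eq_zero {ι : Type*} [Fintype ι] [DecidableEq ι] (hf : IsExpLaurent (2 * Fintype.card ι) f 0)
    (hcard : 0 < Fintype.card ι)
    (heven : ∀ l, f (-l) = f l) (hper : ∀ l, f (l + Real.pi * I) = f l) {z : ι → ℂ}
    (hz : ∀ i, f (z i) = 0) (h1 : ∀ i j, i ≠ j → sinh (z i - z j) ≠ 0 ∧ sinh (z i + z j) ≠ 0)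
    (h2 : ∀ i, sinh (2 * z i) ≠ 0) (l : ℂ) : f l = 0 := by
  obtain ⟨P, hP, hc, hP'⟩ := hf
  have hdeg : P.natDegree < 2 * (2 * Fintype.card ι) := by
    rcases hP.lt_or_eq with h | h
    · exact h
    · rw [← h, coeff_natDegree, leadingCoeff_eq_zero] at hc
      rw [hc, natDegree_zero]; omega
  -- Each z i gives four zeros, ±z i and ±z i + iπ, with distinct exponentials: 4 times the
  -- cardinality of ι, which exceeds the degree.
  set w : ι × Bool × Bool → ℂ := fun x =>
    (if x.2.1 then z x.1 else -z x.1) + (if x.2.2 then Real.pi * I else 0) with hw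
  have hfw : ∀ x, f (w x) = 0 := by
    rintro ⟨i, a, b⟩
    cases a <;> cases b <;> simp [hw, heven, hper, hz]
  have hexp : ∀ x y : ℂ, exp x = exp y → sinh (x - y) = 0 := by
    intro x y h
    rw [Complex.sinh, Complex.exp_neg, Complex.exp_sub, h, div_self (Complex.exp_ne_zero _)]
    simp
  have hpi : ∀ x : ℂ, sinh (x + Real.pi * I) = -sinh x := fun x => by
    rw [Complex.sinh_add, Complex.cosh_mul_I, Complex.sinh_mul_I]; simp
  have hpi' : ∀ x : ℂ, sinh (x - Real.pi * I) = -sinh x := fun x => by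
    rw [Complex.sinh_sub, Complex.cosh_mul_I, Complex.sinh_mul_I]; simp
  have hinj : Function.Injective fun x => exp (w x) := by
    rintro ⟨i, a, b⟩ ⟨j, a', b'⟩ h
    have h3 : sinh ((if a then z i else -z i) - (if a' then z j else -z j)) = 0 := by
      have h4 := hexp _ _ h
      simp only [hw] at h4
      cases b <;> cases b' <;> simp at h4 ⊢
      · exact h4
      · rwa [sub_add_eq_sub_sub, hpi', neg_eq_zero] at h4
      · rwa [add_sub_right_comm, hpi, neg_eq_zero] at h4
      · exact h4
    obtain rfl : i = j := by
      by_contra hij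
      have h5 := h1 i j hij
      cases a <;> cases a' <;> simp at h3
      · apply h5.1
        rw [← neg_eq_zero, ← Complex.sinh_neg, ← h3]; congr 1; ring
      · apply h5.2
        rw [← neg_eq_zero, ← Complex.sinh_neg, ← h3]; congr 1; ring
      · exact h5.2 h3
      · exact h5.1 h3
    obtain rfl : a = a' := by
      have h5 := h2 i
      cases a <;> cases a' <;> simp at h3 ⊢
      · apply h5
        rw [← neg_eq_zero, ← Complex.sinh_neg, ← h3]; congr 1; ring
      · apply h5
        rw [← h3]; congr 1; ring
    obtain rfl : b = b' := by
      simp only [hw, Complex.exp_add, mul_right_inj' (Complex.exp_ne_zero _)] at h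
      cases b <;> cases b' <;> simp at h ⊢
      all_goals
        exact absurd h (by norm_num)
    rfl
  have hP0 : P = 0 := by
    refine Polynomial.eq_zero_of_natDegree_lt_card_of_eval_eq_zero P hinj (fun x => ?_) ?_
    · rw [← hP', hfw, zero_mul]
    · simp only [Fintype.card_prod, Fintype.card_bool]; omega
  have := hP' l
  rw [hP0, eval_zero] at this
  exact (mul_eq_zero.1 this).resolve_right (pow_ne_zero _ (Complex.exp_ne_zero _))

end IsExpLaurent

end LaurentPolynomials

/-! ### Analytic properties and central values of the transfer matrix -/

section TransferMatrix

variable {N : ℕ}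

/-- Entrywise version of `IsExpLaurent`. -/
def IsAuxExpLaurent (d : ℕ) (F : ℂ → AuxOp N) (C : AuxOp N) : Prop :=
  ∀ i j s t, IsExpLaurent d (fun l => F l i j s t) (C i j s t)

theorem IsAuxExpLaurent.mul {d e : ℕ} {F G : ℂ → AuxOp N} {A B : AuxOp N}
    (hF : IsAuxExpLaurent d F A) (hG : IsAuxExpLaurent e G B) :
    IsAuxExpLaurent (d + e) (fun l => F l * G l) (A * B) := by
  intro i j s t
  have : ∀ F G : AuxOp N, (F * G) i j s t = ∑ k, ∑ u, F i k s u * G k j u t := by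
    intro F G
    rw [Matrix.mul_apply, Matrix.sum_apply]
    simp only [Matrix.mul_apply]
  simp only [this]
  exact .sum _ fun k _ => .sum _ fun u _ => (hF i k s u).mul (hG k j u t)

theorem isAuxExpLaurent_lift {d : ℕ} {A : ℂ → Matrix (Fin 2) (Fin 2) ℂ}
    {C : Matrix (Fin 2) (Fin 2) ℂ} (h : ∀ i j, IsExpLaurent d (fun l => A l i j) (C i j)) :
    IsAuxExpLaurent d (fun l => (lift (A l) : AuxOp N)) (lift C) := by
  intro i j s t
  simp only [lift_apply, Matrix.smul_apply, smul_eq_mul]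
  exact (h i j).mul_const _

/-- The diagonal entries contain only sinh of l plus a constant, so they do not contribute to the
coefficient of e^{2l}. -/
theorem isExpLaurent_KMatrix (η ζ κ τ c : ℂ) (i j : Fin 2) :
    IsExpLaurent 2 (fun l => KMatrix η ζ κ τ (l + c) i j)
      (((κ * exp (2 * c - η) / (2 * sinh ζ)) • !![0, exp τ; exp (-τ), 0] :
        Matrix (Fin 2) (Fin 2) ℂ) i j) := by
  fin_cases i <;> fin_cases j
  · refine (((IsExpLaurent.sinh_add (c - η / 2 + ζ)).const_mul (1 / sinh ζ)).of_lt
      (by norm_num)).congr (fun l => ?_) (by simp)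
    simp [KMatrix]; ring_nf; simp
  · refine ((IsExpLaurent.sinh_two_mul_add (2 * c - η)).const_mul
      (1 / sinh ζ * (κ * exp τ))).congr (fun l => ?_) (by simp; ring)
    simp [KMatrix]; ring_nf
  · refine ((IsExpLaurent.sinh_two_mul_add (2 * c - η)).const_mul
      (1 / sinh ζ * (κ * exp (-τ)))).congr (fun l => ?_) (by simp; ring)
    simp [KMatrix]; ring_nf
  · refine (((IsExpLaurent.sinh_add (c - η / 2 - ζ)).const_mul (-(1 / sinh ζ))).of_lt
      (by norm_num)).congr (fun l => ?_) (by simp)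
    simp only [KMatrix]
    rw [show l + (c - η / 2 - ζ) = -(ζ - (l + c) + η / 2) by ring, Complex.sinh_neg]
    simp

namespace Chain

variable (p : Chain N)

theorem isAuxExpLaurent_R0 (n : Fin N) (b : ℂ) :
    IsAuxExpLaurent 1 (fun l => p.R0 n (l + b))
      ((exp b / 2) • !![siteOp n !![exp p.η, 0; 0, 1], 0; 0, siteOp n !![1, 0; 0, exp p.η]]) := by
  have h0 : ∀ c, IsExpLaurent 1 (fun _ => c) 0 := fun c => (IsExpLaurent.const c).of_lt one_pos
  have h1 := IsExpLaurent.sinh_add b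
  have h2 : IsExpLaurent 1 (fun l => sinh (l + b + p.η)) (exp b / 2 * exp p.η) :=
    (IsExpLaurent.sinh_add (b + p.η)).congr (fun l => by rw [add_assoc])
      (by rw [Complex.exp_add]; ring)
  intro i j s t
  simp only [R0_eq_map, map_apply, siteHom_apply, siteOp, of_apply]
  by_cases hst : ∀ k, k ≠ n → s k = t k
  · simp only [if_pos hst]
    have hs : s n = 0 ∨ s n = 1 := by omega
    have ht : t n = 0 ∨ t n = 1 := by omega
    fin_cases i <;> fin_cases j <;> rcases hs with hs | hs <;> rcases ht with ht | ht <;>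
      simp [sixVertexBlock, hs, ht, if_pos hst] <;>
      first | exact h1 | exact h2 | exact h0 _
  · simp only [if_neg hst]
    fin_cases i <;> fin_cases j <;> simp [if_neg hst] <;> exact h0 _

/-- At leading order an R-matrix is auxiliary-diagonal, with site matrices diag(e^η, 1) and diag(1,
e^η). An off-diagonal K pairs one with the other, and their product is the scalar e^η; hence the
leading coefficient is central. -/
theorem leading_dress (n : Fin N) {a b c : ℂ} {K : Matrix (Fin 2) (Fin 2) ℂ} (h0 : K 0 0 = 0)
    (h1 : K 1 1 = 0) :
    (a • !![siteOp n !![exp p.η, 0; 0, 1], 0; 0, siteOp n !![1, 0; 0, exp p.η]]) *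
      (c • lift K) * (b • !![siteOp n !![exp p.η, 0; 0, 1], 0; 0, siteOp n !![1, 0; 0, exp p.η]]) =
      (a * b * exp p.η) • c • (lift K : AuxOp N) := by
  have d1 : (!![exp p.η, 0; 0, 1] : Matrix (Fin 2) (Fin 2) ℂ) * !![1, 0; 0, exp p.η] =
      exp p.η • 1 := by
    ext a b; fin_cases a <;> fin_cases b <;> simp
  have d2 : (!![1, 0; 0, exp p.η] : Matrix (Fin 2) (Fin 2) ℂ) * !![exp p.η, 0; 0, 1] =
      exp p.η • 1 := by
    ext a b; fin_cases a <;> fin_cases b <;> simp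
  have sm : ∀ c : ℂ, siteOp n (c • (1 : Matrix (Fin 2) (Fin 2) ℂ)) = c • (1 : Op N) := by
    intro c
    rw [← siteHom_apply, map_smul, map_one]
  have f1 : siteOp n !![exp p.η, 0; 0, 1] * siteOp n !![1, 0; 0, exp p.η] =
      exp p.η • (1 : Op N) := by rw [← siteOp_mul, d1, sm]
  have f2 : siteOp n !![1, 0; 0, exp p.η] * siteOp n !![exp p.η, 0; 0, 1] =
      exp p.η • (1 : Op N) := by rw [← siteOp_mul, d2, sm]
  simp only [smul_mul_assoc, mul_smul_comm, smul_smul]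
  have key : !![siteOp n !![exp p.η, 0; 0, 1], 0; 0, siteOp n !![1, 0; 0, exp p.η]] * lift K *
      !![siteOp n !![exp p.η, 0; 0, 1], 0; 0, siteOp n !![1, 0; 0, exp p.η]] =
      exp p.η • (lift K : AuxOp N) := by
    ext1 i j
    rw [Matrix.smul_apply, lift_apply]
    fin_cases i <;> fin_cases j <;>
      simp [Matrix.mul_apply, Matrix.vecMul, dotProduct, Fin.sum_univ_two, lift_apply, f1, f2, h0,
        h1, smul_smul, mul_comm]
  rw [key, smul_smul]
  congr 1
  ring

theorem isAuxExpLaurent_Ulist : ∀ ns : List (Fin N),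
    IsAuxExpLaurent (2 + 2 * ns.length) (p.Ulist ns)
      (((1 / 4 : ℂ) ^ ns.length) • lift ((p.κm * exp (-p.η) / (2 * sinh p.ζm)) •
        !![0, exp p.τm; exp (-p.τm), 0]))
  | [] => by
    have h := isAuxExpLaurent_lift (N := N) fun i j =>
      isExpLaurent_KMatrix p.η p.ζm p.κm p.τm 0 i j
    have e : p.Ulist [] = fun l => lift (KMatrix p.η p.ζm p.κm p.τm (l + 0)) := by
      funext l
      rw [Ulist_nil, Kminus, add_zero]
    rw [e]
    simpa using h
  | n :: ns => by
    have h := ((p.isAuxExpLaurent_R0 n (-p.ξ n - p.η / 2)).mul (isAuxExpLaurent_Ulist ns)).mul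
      (p.isAuxExpLaurent_R0 n (p.ξ n - p.η / 2))
    have e : exp (-p.ξ n - p.η / 2) * exp (p.ξ n - p.η / 2) * exp p.η = 1 := by
      rw [← Complex.exp_add, ← Complex.exp_add, ← Complex.exp_zero]; congr 1; ring
    rw [p.leading_dress n (by simp) (by simp), smul_smul,
      show 1 + (2 + 2 * ns.length) + 1 = 2 + 2 * (n :: ns).length by rw [List.length_cons]; ring,
      show exp (-p.ξ n - p.η / 2) / 2 * (exp (p.ξ n - p.η / 2) / 2) * exp p.η *
        (1 / 4) ^ ns.length = (1 / 4) ^ (n :: ns).length by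
          rw [List.length_cons, pow_succ]
          linear_combination (1 / 4 : ℂ) ^ ns.length / 4 * e] at h
    have e2 : (fun l => p.R0 n (l + (-p.ξ n - p.η / 2)) * p.Ulist ns l *
        p.R0 n (l + (p.ξ n - p.η / 2))) = p.Ulist (n :: ns) := by
      funext l
      rw [Ulist_cons, show l + (-p.ξ n - p.η / 2) = l - p.ξ n - p.η / 2 by ring,
        show l + (p.ξ n - p.η / 2) = l + p.ξ n - p.η / 2 by ring]
    rwa [e2] at h

/-- The leading coefficient of the transfer matrix. -/
noncomputable def transferLead : ℂ :=
  2 * p.κp * p.κm * cosh (p.τp - p.τm) / (4 ^ (N + 1) * sinh p.ζp * sinh p.ζm)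

theorem isExpLaurent_transfer (s t : Conf N) :
    IsExpLaurent (2 * (N + 2)) (fun l => p.transfer l s t)
      (p.transferLead * (1 : Op N) s t) := by
  have h := (isAuxExpLaurent_lift (N := N) fun i j =>
    isExpLaurent_KMatrix p.η p.ζp p.κp p.τp p.η i j).mul
      (p.isAuxExpLaurent_Ulist (List.finRange N).reverse)
  rw [List.length_reverse, List.length_finRange,
    show 2 + (2 + 2 * N) = 2 * (N + 2) by ring, mul_smul_comm, ← lift_mul] at h
  have h' := (h 0 0 s t).add (h 1 1 s t)
  refine h'.congr (fun l => ?_) ?_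
  · rw [transfer, Uminus_eq_Ulist, Matrix.trace_fin_two, Matrix.add_apply, Kplus]
  · have e3 : cosh (p.τp - p.τm) =
        (exp p.τp * exp (-p.τm) + exp p.τm * exp (-p.τp)) / 2 := by
      rw [Complex.cosh, ← Complex.exp_add, ← Complex.exp_add]; ring_nf
    simp only [transferLead, e3, Matrix.smul_apply, lift_apply, smul_eq_mul, Matrix.mul_apply, Fin.sum_univ_two]
    clear h h'
    have e : exp (2 * p.η - p.η) * exp (-p.η) = 1 := by
      rw [← Complex.exp_add, ← Complex.exp_zero]; congr 1; ring
    generalize exp (2 * p.η - p.η) = x at e ⊢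
    generalize exp (-p.η) = y at e ⊢
    obtain rfl : y = x⁻¹ := (inv_eq_of_mul_eq_one_right e).symm
    have hx : x ≠ 0 := left_ne_zero_of_mul_eq_one e
    simp [Complex.exp_neg]
    field_simp
    ring

/-- The Pauli matrix `σᶻ` in the auxiliary space. -/
noncomputable def auxZ : AuxOp N := lift !![1, 0; 0, -1]

theorem auxZ_mul_auxZ : (auxZ : AuxOp N) * auxZ = 1 := by
  rw [auxZ, ← lift_mul, ← lift_one]
  congr 1
  ext i j; fin_cases i <;> fin_cases j <;> simp

/-- The shift by iπ negates the weights a and b but not c, and conjugation by σᶻ negates c only. -/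
theorem R0_add_pi (n : Fin N) (x : ℂ) :
    p.R0 n (x + Real.pi * I) = -(auxZ * p.R0 n x * auxZ) := by
  have h1 : ∀ y : ℂ, sinh (y + Real.pi * I) = -sinh y := fun y => by
    rw [Complex.sinh_add, Complex.cosh_mul_I, Complex.sinh_mul_I]; simp
  have h2 : sinh (x + Real.pi * I + p.η) = -sinh (x + p.η) := by rw [← h1]; ring_nf
  rw [R0_eq_map, R0_eq_map]
  ext1 i j
  rw [Matrix.map_apply, h1, h2]
  have key : ∀ i j, sixVertexBlock (-sinh (x + p.η)) (-sinh x) (sinh p.η) i j =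
      (if i = j then (-1 : ℂ) else 1) •
        sixVertexBlock (sinh (x + p.η)) (sinh x) (sinh p.η) i j := by
    intro i j
    ext s t
    fin_cases i <;> fin_cases j <;> fin_cases s <;> fin_cases t <;> simp [sixVertexBlock]
  rw [key, map_smul]
  fin_cases i <;> fin_cases j <;>
    simp [auxZ, Matrix.mul_apply (M := lift _ * _), Matrix.mul_apply (M := lift _),
      Fin.sum_univ_two, lift_apply]

theorem lift_KMatrix_add_pi (η ζ κ τ l : ℂ) :
    (lift (KMatrix η ζ κ τ (l + Real.pi * I)) : AuxOp N) =
      -(auxZ * lift (KMatrix η ζ κ τ l) * auxZ) := by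
  have h1 : ∀ y : ℂ, sinh (y + Real.pi * I) = -sinh y := fun y => by
    rw [Complex.sinh_add, Complex.cosh_mul_I, Complex.sinh_mul_I]; simp
  have h2 : ∀ y : ℂ, sinh (y - Real.pi * I) = -sinh y := fun y => by
    rw [Complex.sinh_sub, Complex.cosh_mul_I, Complex.sinh_mul_I]; simp
  have e1 : l + Real.pi * I - η / 2 + ζ = l - η / 2 + ζ + Real.pi * I := by ring
  have e2 : 2 * (l + Real.pi * I) - η = 2 * l - η + Real.pi * I + Real.pi * I := by ring
  have e3 : ζ - (l + Real.pi * I) + η / 2 = ζ - l + η / 2 - Real.pi * I := by ring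
  rw [auxZ, ← lift_mul, ← lift_mul, ← neg_one_smul ℂ, ← lift_smul]
  congr 1
  simp only [KMatrix, e1, e2, e3, h1, h2]
  ext i j; fin_cases i <;> fin_cases j <;> simp

theorem Ulist_add_pi (l : ℂ) : ∀ ns : List (Fin N),
    p.Ulist ns (l + Real.pi * I) = -(auxZ * p.Ulist ns l * auxZ)
  | [] => by rw [Ulist_nil, Ulist_nil, Kminus, Kminus, lift_KMatrix_add_pi]
  | n :: ns => by
    have hZ := fun A : AuxOp N => by
      have := congrArg (fun B => B * A) (auxZ_mul_auxZ (N := N))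
      simpa only [mul_assoc, one_mul] using this
    rw [Ulist_cons, Ulist_cons, Ulist_add_pi l ns,
      show l + Real.pi * I - p.ξ n - p.η / 2 = l - p.ξ n - p.η / 2 + Real.pi * I by ring,
      show l + Real.pi * I + p.ξ n - p.η / 2 = l + p.ξ n - p.η / 2 + Real.pi * I by ring,
      R0_add_pi, R0_add_pi]
    simp only [neg_mul, mul_neg, mul_assoc, hZ, neg_neg]

theorem transfer_add_pi (l : ℂ) : p.transfer (l + Real.pi * I) = p.transfer l := by
  rw [transfer, transfer, Uminus_eq_Ulist, Uminus_eq_Ulist, Ulist_add_pi, Kplus, Kplus,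
    show l + Real.pi * I + p.η = l + p.η + Real.pi * I by ring, lift_KMatrix_add_pi]
  have hZ := fun A : AuxOp N => by
    have := congrArg (fun B => B * A) (auxZ_mul_auxZ (N := N))
    simpa only [mul_assoc, one_mul] using this
  simp only [neg_mul, mul_neg, mul_assoc, hZ, neg_neg]
  generalize lift (KMatrix p.η p.ζp p.κp p.τp (l + p.η)) = A
  generalize p.Ulist (List.finRange N).reverse l = B
  simp [auxZ, Matrix.trace_fin_two, Matrix.mul_apply, Fin.sum_univ_two, lift_apply, mul_add]
  abel

theorem transfer_eq_sum (l : ℂ) : p.transfer l = p.Kplus l 0 0 • p.Uminus l 0 0 +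
    p.Kplus l 0 1 • p.Uminus l 1 0 +
      (p.Kplus l 1 0 • p.Uminus l 0 1 + p.Kplus l 1 1 • p.Uminus l 1 1) := by
  simp [transfer, Matrix.trace, Fin.sum_univ_two, Matrix.mul_apply, lift_apply]

/-- Parity of 𝒰₋ is compensated by the coefficients of K₊ after multiplication by sinh(2l - η),
which is cancelled by continuity. -/
theorem transfer_neg (l : ℂ) : p.transfer (-l) = p.transfer l := by
  have hc : Continuous p.transfer := p.continuous_transfer continuous_const continuous_id
  refine eq_of_eventually_punctured (f := fun l => p.transfer (-l)) (hc.comp continuous_neg) hc ?_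
  filter_upwards [eventually_sinh_ne_zero two_ne_zero (-p.η) l] with l hl
  rw [← sub_eq_add_neg] at hl
  refine smul_right_injective _ hl ?_
  have h00 := p.Uminus_crossParity l 0 0
  have h01 := p.Uminus_crossParity l 0 1
  have h10 := p.Uminus_crossParity l 1 0
  have h11 := p.Uminus_crossParity l 1 1
  simp only [parityMap, of_apply, cons_val_zero, cons_val_one, cons_val', cons_val_fin_one]
    at h00 h01 h10 h11
  simp only [transfer_eq_sum, smul_add]
  rw [smul_comm _ (p.Kplus (-l) 0 0), smul_comm _ (p.Kplus (-l) 0 1),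
    smul_comm _ (p.Kplus (-l) 1 0), smul_comm _ (p.Kplus (-l) 1 1), h00, h01, h10, h11]
  simp only [Kplus, KMatrix]
  clear h00 h01 h10 h11 hc hl
  generalize p.Uminus l 0 0 = u00
  generalize p.Uminus l 0 1 = u01
  generalize p.Uminus l 1 0 = u10
  generalize p.Uminus l 1 1 = u11
  have e0 : p.η = p.η / 2 + p.η / 2 := (add_halves _).symm
  generalize p.η / 2 = k at *
  rw [e0]
  simp
  generalize (sinh p.ζp)⁻¹ = S
  match_scalars <;>
  · simp only [Complex.sinh, sub_eq_add_neg, neg_add, neg_neg, Complex.exp_add, two_mul,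
      Complex.exp_neg, mul_neg]
    field_simp
    ring

/-- K₋(η/2) is the identity, so the two R-matrices of each site meet with opposite arguments and
unitarity gives a scalar. -/
theorem Ulist_half_eta : ∀ ns : List (Fin N), sinh p.ζm ≠ 0 →
    p.Ulist ns (p.η / 2) = (ns.map fun n => sinh (p.η + p.ξ n) * sinh (p.η - p.ξ n)).prod • 1
  | [], h => by
    have : p.Kminus (p.η / 2) = 1 := by
      rw [Kminus, KMatrix, show 2 * (p.η / 2) - p.η = 0 by ring]
      ext i j; fin_cases i <;> fin_cases j <;> simp [h]
    rw [Ulist_nil, this, lift_one]; simp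
  | n :: ns, h => by
    rw [Ulist_cons, Ulist_half_eta ns h, mul_smul_comm, mul_one, smul_mul_assoc,
      show p.η / 2 - p.ξ n - p.η / 2 = -p.ξ n by ring,
      show p.η / 2 + p.ξ n - p.η / 2 = -(-p.ξ n) by ring, R0_unitarity, smul_smul]
    simp only [List.map_cons, List.prod_cons]
    congr 1
    rw [show p.η + -p.ξ n = p.η - p.ξ n by ring, show p.η - -p.ξ n = p.η + p.ξ n by ring]
    ring

theorem transfer_half_eta (hm : sinh p.ζm ≠ 0) (hp : sinh p.ζp ≠ 0) :
    p.transfer (p.η / 2) =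
      ((-1) ^ N * (cosh p.η + cosh p.η) * p.detqM 0) • 1 := by
  rw [transfer_eq_sum, Uminus_eq_Ulist, Ulist_half_eta _ _ hm, List.map_reverse, List.prod_reverse,
    ← List.ofFn_eq_map, List.prod_ofFn, Finset.prod_mul_distrib]
  have e1 : p.detqM 0 = (∏ n, sinh (p.η - p.ξ n)) * ((-1) ^ N * ∏ n, sinh (p.η + p.ξ n)) := by
    rw [detqM, dFun, aFun, aFun]
    congr 1
    · exact Finset.prod_congr rfl fun n _ => by congr 1; ring
    · rw [show (-1 : ℂ) ^ N = ∏ _n : Fin N, (-1 : ℂ) by simp, ← Finset.prod_mul_distrib]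
      refine Finset.prod_congr rfl fun n _ => ?_
      rw [neg_one_mul, ← Complex.sinh_neg]; congr 1; ring
  have e2 : p.Kplus (p.η / 2) 0 0 + p.Kplus (p.η / 2) 1 1 = cosh p.η + cosh p.η := by
    simp only [Kplus, KMatrix]
    rw [show p.η / 2 + p.η - p.η / 2 + p.ζp = p.ζp + p.η by ring,
      show p.ζp - (p.η / 2 + p.η) + p.η / 2 = p.ζp - p.η by ring]
    simp [Complex.sinh_add, Complex.sinh_sub]
    field_simp
    ring
  have e3 : ((-1 : ℂ) ^ N) * (-1) ^ N = 1 := by rw [← mul_pow]; simp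
  rw [e1, ← e2]
  simp
  rw [← add_smul, ← mul_smul]
  congr 1
  linear_combination (-(∏ n, sinh (p.η + p.ξ n)) * (∏ n, sinh (p.η - p.ξ n)) *
    (p.Kplus (p.η / 2) 0 0 + p.Kplus (p.η / 2) 1 1)) * e3

theorem sinh_add_half_pi (x : ℂ) : sinh (x + I * Real.pi / 2) = I * cosh x := by
  rw [show I * (Real.pi : ℂ) / 2 = (Real.pi / 2 : ℝ) * I by push_cast; ring, Complex.sinh_add,
    Complex.cosh_mul_I, Complex.sinh_mul_I, ← Complex.ofReal_cos, ← Complex.ofReal_sin]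
  simp [mul_comm]

theorem cosh_add_half_pi (x : ℂ) : cosh (x + I * Real.pi / 2) = I * sinh x := by
  rw [show I * (Real.pi : ℂ) / 2 = (Real.pi / 2 : ℝ) * I by push_cast; ring, Complex.cosh_add,
    Complex.cosh_mul_I, Complex.sinh_mul_I, ← Complex.ofReal_cos, ← Complex.ofReal_sin]
  simp [mul_comm]

theorem sinh_sub_half_pi (x : ℂ) : sinh (x - I * Real.pi / 2) = -(I * cosh x) := by
  rw [← neg_sub, Complex.sinh_neg, show I * Real.pi / 2 - x = -x + I * Real.pi / 2 by ring,
    sinh_add_half_pi, Complex.cosh_neg]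

/-- Here K₋ is a multiple of σᶻ. The arguments of the two R-matrices are opposite up to iπ, and that
shift is a conjugation by σᶻ, which cancels against K₋. -/
theorem Ulist_half_eta_add : ∀ ns : List (Fin N),
    p.Ulist ns (p.η / 2 + I * Real.pi / 2) = (I * (cosh p.ζm / sinh p.ζm) *
      (ns.map fun n => -(cosh (p.η + p.ξ n) * cosh (p.η - p.ξ n))).prod) • auxZ
  | [] => by
    have : p.Kminus (p.η / 2 + I * Real.pi / 2) =
        (I * (cosh p.ζm / sinh p.ζm)) • !![1, 0; 0, -1] := by
      rw [Kminus, KMatrix,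
        show p.η / 2 + I * Real.pi / 2 - p.η / 2 + p.ζm = p.ζm + I * Real.pi / 2 by ring,
        show 2 * (p.η / 2 + I * Real.pi / 2) - p.η = (0 + Real.pi * I) by ring,
        show p.ζm - (p.η / 2 + I * Real.pi / 2) + p.η / 2 = p.ζm - I * Real.pi / 2 by ring,
        sinh_add_half_pi, sinh_sub_half_pi, Complex.sinh_add, Complex.sinh_mul_I]
      ext i j; fin_cases i <;> fin_cases j <;> simp <;> ring
    rw [Ulist_nil, this, lift_smul, auxZ]; simp
  | n :: ns => by
    obtain ⟨x, hx⟩ : ∃ x, x = p.ξ n + I * Real.pi / 2 := ⟨_, rfl⟩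
    have hZ := fun A : AuxOp N => by
      have := congrArg (fun B => B * A) (auxZ_mul_auxZ (N := N))
      simpa only [mul_assoc, one_mul] using this
    rw [Ulist_cons, Ulist_half_eta_add ns,
      show p.η / 2 + I * Real.pi / 2 - p.ξ n - p.η / 2 = -x + Real.pi * I by rw [hx]; ring,
      show p.η / 2 + I * Real.pi / 2 + p.ξ n - p.η / 2 = x by rw [hx]; ring, R0_add_pi,
      mul_smul_comm, smul_mul_assoc, neg_mul, neg_mul, mul_assoc, mul_assoc, mul_assoc, hZ]
    have h1 := R0_unitarity p n (-x)
    rw [neg_neg] at h1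
    rw [mul_assoc auxZ, h1, hx, show p.η + -(p.ξ n + I * Real.pi / 2) = p.η - p.ξ n - I * Real.pi / 2 by ring,
      show p.η - -(p.ξ n + I * Real.pi / 2) = p.η + p.ξ n + I * Real.pi / 2 by ring,
      sinh_add_half_pi, sinh_sub_half_pi, mul_smul_comm, mul_one, ← neg_smul, smul_smul]
    simp only [List.map_cons, List.prod_cons]
    congr 1
    linear_combination (I * (cosh p.ζm / sinh p.ζm) *
      (ns.map fun n => -(cosh (p.η + p.ξ n) * cosh (p.η - p.ξ n))).prod *
      cosh (p.η + p.ξ n) * cosh (p.η - p.ξ n)) * I_sq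

theorem transfer_half_eta_add :
    p.transfer (p.η / 2 + I * Real.pi / 2) =
      (-2 * cosh p.η * (cosh p.ζm / sinh p.ζm) * (cosh p.ζp / sinh p.ζp) *
        p.detqM (I * Real.pi / 2)) • 1 := by
  rw [transfer_eq_sum, Uminus_eq_Ulist, Ulist_half_eta_add, List.map_reverse, List.prod_reverse,
    ← List.ofFn_eq_map, List.prod_ofFn]
  have e1 : p.detqM (I * Real.pi / 2) = ∏ n, -(cosh (p.η + p.ξ n) * cosh (p.η - p.ξ n)) := by
    rw [detqM, dFun, aFun, aFun, ← Finset.prod_mul_distrib]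
    refine Finset.prod_congr rfl fun n _ => ?_
    rw [show I * Real.pi / 2 + p.η / 2 - p.ξ n + p.η / 2 = p.η - p.ξ n + I * Real.pi / 2 by ring,
      show I * Real.pi / 2 - p.η / 2 - p.η - p.ξ n + p.η / 2 =
        -(p.η + p.ξ n) + I * Real.pi / 2 by ring, sinh_add_half_pi, sinh_add_half_pi,
      Complex.cosh_neg]
    linear_combination cosh (p.η + p.ξ n) * cosh (p.η - p.ξ n) * I_sq
  have e2 : p.Kplus (p.η / 2 + I * Real.pi / 2) 0 0 - p.Kplus (p.η / 2 + I * Real.pi / 2) 1 1 =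
      2 * I * cosh p.η * (cosh p.ζp / sinh p.ζp) := by
    simp only [Kplus, KMatrix]
    rw [show p.η / 2 + I * Real.pi / 2 + p.η - p.η / 2 + p.ζp = p.ζp + p.η + I * Real.pi / 2
        by ring,
      show p.ζp - (p.η / 2 + I * Real.pi / 2 + p.η) + p.η / 2 = p.ζp - p.η - I * Real.pi / 2
        by ring, sinh_add_half_pi, sinh_sub_half_pi]
    simp [Complex.cosh_add, Complex.cosh_sub]
    ring
  rw [e1]
  generalize ∏ n, -(cosh (p.η + p.ξ n) * cosh (p.η - p.ξ n)) = Q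
  simp [auxZ, lift_apply]
  rw [← sub_eq_add_neg, ← sub_smul, e2, ← neg_smul, smul_smul]
  congr 1
  linear_combination (2 * cosh p.η * (cosh p.ζp / sinh p.ζp) * (cosh p.ζm / sinh p.ζm) * Q) * I_sq

end Chain

end TransferMatrix

end OpenXXZ

namespace OpenXXZ

theorem eq_of_eventually_punctured_at {V : Type*} [TopologicalSpace V] [T2Space V] {f g : ℂ → V}
    {l : ℂ} (hf : ContinuousAt f l) (hg : ContinuousAt g l)
    (h : ∀ᶠ x in nhdsWithin l {l}ᶜ, f x = g x) : f l = g l :=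
  tendsto_nhds_unique_of_eventuallyEq (hf.tendsto.mono_left nhdsWithin_le_nhds)
    (hg.tendsto.mono_left nhdsWithin_le_nhds) h

/-! ### Interpolation with prescribed leading coefficient -/

section Interpolation

theorem cosh_two_mul_sub_cosh_two_mul (x y : ℂ) :
    cosh (2 * x) - cosh (2 * y) = 2 * (sinh (x + y) * sinh (x - y)) := by
  have h1 := Complex.cosh_add (x + y) (x - y)
  have h2 := Complex.cosh_sub (x + y) (x - y)
  rw [show x + y + (x - y) = 2 * x by ring] at h1
  rw [show x + y - (x - y) = 2 * y by ring] at h2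
  rw [h1, h2]
  ring

theorem cosh_sq_sub_cosh_sq (x y : ℂ) :
    cosh x ^ 2 - cosh y ^ 2 = sinh (x + y) * sinh (x - y) := by
  rw [Complex.sinh_add, Complex.sinh_sub]
  have := Complex.cosh_sq x
  have := Complex.cosh_sq y
  grind

theorem sinh_mul_cosh_ne_zero {x : ℂ} (h : sinh (2 * x) ≠ 0) : sinh x ≠ 0 ∧ cosh x ≠ 0 := by
  rw [Complex.sinh_two_mul] at h
  exact ⟨right_ne_zero_of_mul (left_ne_zero_of_mul h), right_ne_zero_of_mul h⟩

variable {N : ℕ}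

/-- Interpolation of an even Laurent polynomial in `exp l`, invariant under `l ↦ l + iπ`, with
given leading coefficient. -/
theorem IsExpLaurent.interpolation {f : ℂ → ℂ} {κ η w₀ w₁ : ℂ} {x : Fin N → ℂ}
    (hf : IsExpLaurent (2 * (N + 2)) f κ) (heven : ∀ l, f (-l) = f l)
    (hper : ∀ l, f (l + Real.pi * I) = f l) (h0 : f (η / 2) = 2 * cosh η * w₀)
    (h1 : f (η / 2 + I * Real.pi / 2) = -2 * cosh η * (-1) ^ N * w₁)
    (hx : ∀ a b, a ≠ b → sinh (x a - x b) ≠ 0 ∧ sinh (x a + x b) ≠ 0)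
    (hx2 : ∀ a, sinh (2 * x a) ≠ 0)
    (hxη : ∀ a, sinh (2 * x a + η) ≠ 0 ∧ sinh (2 * x a - η) ≠ 0)
    (hη : sinh η ≠ 0) (hc : cosh η ≠ 0) (l : ℂ) :
    f l = (∑ a, (cosh (2 * l) ^ 2 - cosh η ^ 2) / (cosh (2 * x a) ^ 2 - cosh η ^ 2) *
      (∏ b ∈ Finset.univ.erase a, (cosh (2 * l) - cosh (2 * x b)) /
        (cosh (2 * x a) - cosh (2 * x b))) * f (x a))
      + (cosh (2 * l) + cosh η) * (∏ b, (cosh (2 * l) - cosh (2 * x b)) /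
        (cosh η - cosh (2 * x b))) * w₀
      + (cosh (2 * l) - cosh η) * (∏ b, (cosh (2 * l) - cosh (2 * x b)) /
        (cosh η + cosh (2 * x b))) * w₁
      + 2 ^ (N + 2) * κ * ((cosh (2 * l) ^ 2 - cosh η ^ 2) *
        ∏ b, (cosh (2 * l) - cosh (2 * x b))) := by
  set G : ℂ → ℂ := fun c => (∑ a, (c ^ 2 - cosh η ^ 2) / (cosh (2 * x a) ^ 2 - cosh η ^ 2) *
      (∏ b ∈ Finset.univ.erase a, (c - cosh (2 * x b)) /
        (cosh (2 * x a) - cosh (2 * x b))) * f (x a))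
      + (c + cosh η) * (∏ b, (c - cosh (2 * x b)) / (cosh η - cosh (2 * x b))) * w₀
      + (c - cosh η) * (∏ b, (c - cosh (2 * x b)) / (cosh η + cosh (2 * x b))) * w₁
      + 2 ^ (N + 2) * κ * ((c ^ 2 - cosh η ^ 2) * ∏ b, (c - cosh (2 * x b))) with hG
  change f l = G (cosh (2 * l))
  have hsinh : ∀ a, (sinh (x a + η / 2) ≠ 0 ∧ cosh (x a + η / 2) ≠ 0) ∧
      sinh (x a - η / 2) ≠ 0 ∧ cosh (x a - η / 2) ≠ 0 := fun a =>
    ⟨sinh_mul_cosh_ne_zero (by rw [mul_add, mul_div_cancel₀ _ two_ne_zero]; exact (hxη a).1),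
      sinh_mul_cosh_ne_zero (by rw [mul_sub, mul_div_cancel₀ _ two_ne_zero]; exact (hxη a).2)⟩
  have hcab : ∀ a b, a ≠ b → cosh (2 * x a) - cosh (2 * x b) ≠ 0 := fun a b hab => by
    rw [cosh_two_mul_sub_cosh_two_mul]
    exact mul_ne_zero two_ne_zero (mul_ne_zero (hx a b hab).2 (hx a b hab).1)
  have hcη : ∀ a, cosh (2 * x a) ^ 2 - cosh η ^ 2 ≠ 0 := fun a => by
    rw [cosh_sq_sub_cosh_sq]; exact mul_ne_zero (hxη a).1 (hxη a).2
  have hk1 : ∀ a, cosh η - cosh (2 * x a) ≠ 0 := fun a h => hcη a (by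
    linear_combination (-(cosh (2 * x a) + cosh η)) * h)
  have hk2 : ∀ a, cosh η + cosh (2 * x a) ≠ 0 := fun a h => hcη a (by
    linear_combination (cosh (2 * x a) - cosh η) * h)
  have hlin : ∀ y, IsExpLaurent 2 (fun l => cosh (2 * l) - y) (1 / 2) := fun y =>
    (IsExpLaurent.cosh_two_mul.sub ((IsExpLaurent.const y).of_lt two_pos)).congr
      (fun _ => rfl) (by simp)
  have hlin' : ∀ y, IsExpLaurent 2 (fun l => cosh (2 * l) + y) (1 / 2) := fun y =>
    (hlin (-y)).congr (fun _ => by ring) rfl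
  have hquad : IsExpLaurent 4 (fun l => cosh (2 * l) ^ 2 - cosh η ^ 2) (1 / 4) :=
    ((hlin (cosh η)).mul (hlin' (cosh η))).congr (fun _ => by ring) (by norm_num)
  have hprod : ∀ (s : Finset (Fin N)) (d : Fin N → ℂ), IsExpLaurent (2 * s.card)
      (fun l => ∏ b ∈ s, (cosh (2 * l) - cosh (2 * x b)) / d b) (∏ b ∈ s, 1 / 2 * (d b)⁻¹) :=
    fun s d => IsExpLaurent.prod s fun b _ => by
      simpa only [div_eq_mul_inv, one_mul] using (hlin (cosh (2 * x b))).mul_const (d b)⁻¹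
  have hGL : IsExpLaurent (2 * (N + 2)) (fun l => G (cosh (2 * l))) κ := by
    have t1 : IsExpLaurent (2 * (N + 2)) (fun l => ∑ a, (cosh (2 * l) ^ 2 - cosh η ^ 2) /
        (cosh (2 * x a) ^ 2 - cosh η ^ 2) * (∏ b ∈ Finset.univ.erase a,
          (cosh (2 * l) - cosh (2 * x b)) / (cosh (2 * x a) - cosh (2 * x b))) * f (x a))
        (∑ _a : Fin N, 0) := by
      refine IsExpLaurent.sum _ fun a _ => ?_
      have h := (((hquad.mul_const (cosh (2 * x a) ^ 2 - cosh η ^ 2)⁻¹).mul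
        (hprod (Finset.univ.erase a) fun b => cosh (2 * x a) - cosh (2 * x b))).mul_const (f (x a)))
      simp only [div_eq_mul_inv] at h ⊢
      refine h.of_lt ?_
      have := Fin.pos a
      rw [Finset.card_erase_of_mem (Finset.mem_univ a), Finset.card_univ, Fintype.card_fin]
      omega
    have t2 := (((hlin' (cosh η)).mul
      (hprod Finset.univ fun b => cosh η - cosh (2 * x b))).mul_const w₀).of_lt
        (e := 2 * (N + 2)) (by rw [Finset.card_univ, Fintype.card_fin]; omega)
    have t3 := (((hlin (cosh η)).mul
      (hprod Finset.univ fun b => cosh η + cosh (2 * x b))).mul_const w₁).of_lt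
        (e := 2 * (N + 2)) (by rw [Finset.card_univ, Fintype.card_fin]; omega)
    have t4 := (hquad.mul (IsExpLaurent.prod Finset.univ fun b _ =>
      hlin (cosh (2 * x b)))).const_mul (2 ^ (N + 2) * κ)
    rw [Finset.card_univ, Fintype.card_fin, show 4 + 2 * N = 2 * (N + 2) by ring] at t4
    refine (((t1.add t2).add t3).add t4).congr (fun _ => rfl) ?_
    have h2 : (2 : ℂ) ^ N * (1 / 2) ^ N = 1 := by rw [← mul_pow]; norm_num
    simp only [Finset.sum_const_zero, zero_add, Finset.prod_const, Finset.card_univ,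
      Fintype.card_fin]
    rw [pow_add]
    linear_combination κ * h2
  -- The N + 2 nodes: the x a, together with η/2 and η/2 + iπ/2.
  set z : Option (Option (Fin N)) → ℂ := fun i =>
    i.elim (η / 2 + I * Real.pi / 2) fun j => j.elim (η / 2) x with hz
  have hcard : Fintype.card (Option (Option (Fin N))) = N + 2 := by simp
  have hcosh : ∀ y : ℂ, cosh (2 * y + 2 * (I * Real.pi / 2)) = -cosh (2 * y) := fun y => by
    rw [show 2 * (I * Real.pi / 2) = Real.pi * I by ring, Complex.cosh_add, Complex.cosh_mul_I,
      Complex.sinh_mul_I]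
    simp
  have key := IsExpLaurent.eq_zero (ι := Option (Option (Fin N))) (f := fun l => f l - G (cosh (2 * l)))
    (z := z) (by rw [hcard, ← sub_self κ]; exact hf.sub hGL) (by simp)
    (fun l => by
      rw [heven, mul_neg, Complex.cosh_neg]) (fun l => by
      rw [hper, show 2 * (l + Real.pi * I) = 2 * l + 2 * (I * Real.pi / 2) +
        2 * (I * Real.pi / 2) by ring, ← mul_add, hcosh, mul_add, hcosh, neg_neg])
    ?_ ?_ ?_ l
  · exact sub_eq_zero.1 key
  · rintro (_ | _ | a)
    · change f (η / 2 + I * Real.pi / 2) - G (cosh (2 * (η / 2 + I * Real.pi / 2))) = 0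
      rw [mul_add, hcosh, h1, mul_div_cancel₀ _ two_ne_zero]
      simp only [hG]
      have : ∏ b, (-cosh η - cosh (2 * x b)) / (cosh η + cosh (2 * x b)) = (-1) ^ N := by
        rw [Finset.prod_congr rfl fun b _ => show (-cosh η - cosh (2 * x b)) /
          (cosh η + cosh (2 * x b)) = -1 by
            rw [div_eq_iff (hk2 b)]; ring]
        simp
      rw [this]
      simp
      ring
    · change f (η / 2) - G (cosh (2 * (η / 2))) = 0
      rw [h0, mul_div_cancel₀ _ two_ne_zero]
      simp only [hG]
      rw [Finset.prod_congr rfl fun b _ => div_self (hk1 b)]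
      simp
      ring
    · change f (x a) - G (cosh (2 * x a)) = 0
      have hzero : ∀ d : Fin N → ℂ,
          ∏ b, (cosh (2 * x a) - cosh (2 * x b)) / d b = 0 := fun d =>
        Finset.prod_eq_zero (Finset.mem_univ a) (by simp)
      have hzero' : ∏ b, (cosh (2 * x a) - cosh (2 * x b)) = 0 :=
        Finset.prod_eq_zero (Finset.mem_univ a) (by simp)
      simp only [hG, hzero, hzero', mul_zero, zero_mul, add_zero]
      rw [Finset.sum_eq_single a]
      · rw [div_self (hcη a), Finset.prod_congr rfl fun b hb =>
          div_self (hcab a b (Finset.ne_of_mem_erase hb).symm)]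
        simp
      · intro b _ hb
        rw [Finset.prod_eq_zero (Finset.mem_erase.2 ⟨hb.symm, Finset.mem_univ a⟩) (by simp)]
        ring
      · simp
  · have e1 : η / 2 - (η / 2 + I * Real.pi / 2) = 0 - I * Real.pi / 2 := by ring
    have e2 : η / 2 + (η / 2 + I * Real.pi / 2) = η + I * Real.pi / 2 := by ring
    have e3 : ∀ a, x a - (η / 2 + I * Real.pi / 2) = x a - η / 2 - I * Real.pi / 2 := by
      intro a; ring
    have e4 : ∀ a, x a + (η / 2 + I * Real.pi / 2) = x a + η / 2 + I * Real.pi / 2 := by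
      intro a; ring
    have hsymm : ∀ y y' : ℂ, sinh (y - y') ≠ 0 ∧ sinh (y + y') ≠ 0 →
        sinh (y' - y) ≠ 0 ∧ sinh (y' + y) ≠ 0 := by
      intro y y' h
      rw [← neg_sub, Complex.sinh_neg, add_comm]
      exact ⟨neg_ne_zero.2 h.1, h.2⟩
    -- At the two extra nodes cosh 2l equals cosh η and -cosh η, so they are distinct because cosh η
    -- ≠ 0.
    have hη0 : sinh (η / 2 - (η / 2 + I * Real.pi / 2)) ≠ 0 ∧
        sinh (η / 2 + (η / 2 + I * Real.pi / 2)) ≠ 0 := by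
      rw [e1, e2, Chain.sinh_add_half_pi, Chain.sinh_sub_half_pi]
      simp [hc]
    have ha0 : ∀ a, sinh (x a - (η / 2 + I * Real.pi / 2)) ≠ 0 ∧
        sinh (x a + (η / 2 + I * Real.pi / 2)) ≠ 0 := by
      intro a
      rw [e3, e4, Chain.sinh_add_half_pi, Chain.sinh_sub_half_pi]
      simp [(hsinh a).1.2, (hsinh a).2.2]
    rintro (_ | _ | a) (_ | _ | b) hab
    · exact absurd rfl hab
    · exact hsymm _ _ hη0
    · exact hsymm _ _ (ha0 b)
    · exact hη0
    · exact absurd rfl hab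
    · exact hsymm _ _ ⟨(hsinh b).2.1, (hsinh b).1.1⟩
    · exact ha0 a
    · exact ⟨(hsinh a).2.1, (hsinh a).1.1⟩
    · exact hx a b (by simpa using hab)
  · rintro (_ | _ | a)
    · change sinh (2 * (η / 2 + I * Real.pi / 2)) ≠ 0
      rw [show 2 * (η / 2 + I * Real.pi / 2) = η + I * Real.pi / 2 + I * Real.pi / 2 by ring,
        Chain.sinh_add_half_pi, Chain.cosh_add_half_pi]
      simp [hη]
    · change sinh (2 * (η / 2)) ≠ 0
      rwa [mul_div_cancel₀ _ two_ne_zero]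
    · exact hx2 a

end Interpolation

/-! ### Interpolation of the transfer matrix -/

section TransferInterpolation

namespace Chain

variable {N : ℕ} (p : Chain N)

/-- The coefficient of the value at `ζ_a^{(0)}` in the interpolation of the transfer matrix. -/
noncomputable def interpCoeff (a : Fin N) (l : ℂ) : ℂ :=
  (cosh (2 * l) ^ 2 - cosh p.η ^ 2) / (cosh (2 * p.sep a 0) ^ 2 - cosh p.η ^ 2) *
    ∏ b ∈ Finset.univ.erase a, (cosh (2 * l) - cosh (2 * p.sep b 0)) /
      (cosh (2 * p.sep a 0) - cosh (2 * p.sep b 0))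

/-- The central part of the interpolation of the transfer matrix. -/
noncomputable def interpConst (l : ℂ) : ℂ :=
  (-1) ^ N * (cosh (2 * l) + cosh p.η) *
      (∏ b, (cosh (2 * l) - cosh (2 * p.sep b 0)) / (cosh p.η - cosh (2 * p.sep b 0))) *
      p.detqM 0
    + (-1) ^ N * (cosh (2 * l) - cosh p.η) *
      (∏ b, (cosh (2 * l) - cosh (2 * p.sep b 0)) / (cosh p.η + cosh (2 * p.sep b 0))) *
      (cosh p.ζm / sinh p.ζm) * (cosh p.ζp / sinh p.ζp) * p.detqM (I * Real.pi / 2)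
    + 2 * p.κp * p.κm * cosh (p.τp - p.τm) / (2 ^ N * sinh p.ζp * sinh p.ζm) *
      (cosh (2 * l) ^ 2 - cosh p.η ^ 2) * ∏ b, (cosh (2 * l) - cosh (2 * p.sep b 0))

theorem mem_spectralClass {t : ℂ → ℂ} : t ∈ p.spectralClass ↔
    ∀ l, t l = ∑ a, p.interpCoeff a l * t (p.sep a 0) + p.interpConst l := by
  simp only [spectralClass, Set.mem_ofPred_eq, interpCoeff, interpConst, add_assoc]

/-- The inhomogeneities admit interpolation at the points `ζ_a^{(0)}`. -/
def InterpRegular : Prop :=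
  (∀ a b, a ≠ b → sinh (p.ξ a - p.ξ b) ≠ 0 ∧ sinh (p.ξ a + p.ξ b - p.η) ≠ 0) ∧
  (∀ a, sinh (2 * p.ξ a - p.η) ≠ 0 ∧ sinh (2 * p.ξ a) ≠ 0 ∧ sinh (2 * p.ξ a - 2 * p.η) ≠ 0) ∧
  sinh p.η ≠ 0

theorem transfer_interpolation_of_cosh_ne_zero (hp : p.InterpRegular) (hc : cosh p.η ≠ 0)
    (hζm : sinh p.ζm ≠ 0) (hζp : sinh p.ζp ≠ 0) (l : ℂ) :
    p.transfer l = ∑ a, p.interpCoeff a l • p.transfer (p.sep a 0) + p.interpConst l • 1 := by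
  ext s t
  have h := (p.isExpLaurent_transfer s t).interpolation (η := p.η)
    (x := fun a => p.sep a 0) (w₀ := (-1) ^ N * p.detqM 0 * (1 : Op N) s t)
    (w₁ := (-1) ^ N * ((cosh p.ζm / sinh p.ζm) * (cosh p.ζp / sinh p.ζp) *
      p.detqM (I * Real.pi / 2)) * (1 : Op N) s t)
    (fun l => by rw [p.transfer_neg]) (fun l => by rw [p.transfer_add_pi])
    (by rw [p.transfer_half_eta hζm hζp, Matrix.smul_apply, smul_eq_mul]; ring)
    (by
      have e3 : ((-1 : ℂ) ^ N) * (-1) ^ N = 1 := by rw [← mul_pow]; simp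
      rw [p.transfer_half_eta_add, Matrix.smul_apply, smul_eq_mul]
      linear_combination (2 * cosh p.η * (cosh p.ζm / sinh p.ζm) * (cosh p.ζp / sinh p.ζp) *
        p.detqM (I * Real.pi / 2) * (1 : Op N) s t) * e3)
    (fun a b hab => by
      simp only [sep_zero]
      rw [show p.ξ a - p.η / 2 - (p.ξ b - p.η / 2) = p.ξ a - p.ξ b by ring,
        show p.ξ a - p.η / 2 + (p.ξ b - p.η / 2) = p.ξ a + p.ξ b - p.η by ring]
      exact hp.1 a b hab)
    (fun a => by
      rw [sep_zero, show 2 * (p.ξ a - p.η / 2) = 2 * p.ξ a - p.η by ring]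
      exact (hp.2.1 a).1)
    (fun a => by
      rw [sep_zero, show 2 * (p.ξ a - p.η / 2) + p.η = 2 * p.ξ a by ring,
        show 2 * (p.ξ a - p.η / 2) - p.η = 2 * p.ξ a - 2 * p.η by ring]
      exact (hp.2.1 a).2)
    hp.2.2 hc l
  -- The leading coefficient in e^l becomes one in cosh 2l: each of the N + 2 factors cosh 2l
  -- contributes 1/2.
  have e : (2 : ℂ) ^ (N + 2) * p.transferLead =
      2 * p.κp * p.κm * cosh (p.τp - p.τm) / (2 ^ N * sinh p.ζp * sinh p.ζm) := by
    rw [transferLead, show (4 : ℂ) = 2 ^ 2 by norm_num, ← pow_mul,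
      show 2 * (N + 1) = N + 2 + N by ring, pow_add _ (N + 2) N]
    field_simp
  rw [h, Matrix.add_apply, Matrix.sum_apply, Matrix.smul_apply, interpConst, ← e]
  simp only [Matrix.smul_apply, smul_eq_mul, interpCoeff]
  ring

/-- To allow cosh η = 0, η itself is varied. Both sides are continuous at the given value since the
denominators do not vanish there, and in a punctured neighbourhood the inhomogeneities stay regular
and cosh η ≠ 0. -/
theorem transfer_interpolation (hp : p.InterpRegular) 
    (hζm : sinh p.ζm ≠ 0) (hζp : sinh p.ζp ≠ 0) (l : ℂ) :
    p.transfer l = ∑ a, p.interpCoeff a l • p.transfer (p.sep a 0) + p.interpConst l • 1 := by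
  have hcη : ∀ a, cosh (2 * p.sep a 0) ^ 2 - cosh p.η ^ 2 ≠ 0 := fun a => by
    rw [cosh_sq_sub_cosh_sq, sep_zero]
    refine mul_ne_zero ?_ ?_
    · rw [show 2 * (p.ξ a - p.η / 2) + p.η = 2 * p.ξ a by ring]
      exact (hp.2.1 a).2.1
    · rw [show 2 * (p.ξ a - p.η / 2) - p.η = 2 * p.ξ a - 2 * p.η by ring]
      exact (hp.2.1 a).2.2
  have hcab : ∀ a b, a ≠ b → cosh (2 * p.sep a 0) - cosh (2 * p.sep b 0) ≠ 0 := fun a b hab => by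
    rw [cosh_two_mul_sub_cosh_two_mul, sep_zero, sep_zero,
      show p.ξ a - p.η / 2 - (p.ξ b - p.η / 2) = p.ξ a - p.ξ b by ring,
      show p.ξ a - p.η / 2 + (p.ξ b - p.η / 2) = p.ξ a + p.ξ b - p.η by ring]
    exact mul_ne_zero two_ne_zero (mul_ne_zero (hp.1 a b hab).2 (hp.1 a b hab).1)
  have hk1 : ∀ a, cosh p.η - cosh (2 * p.sep a 0) ≠ 0 := fun a h => hcη a (by
    linear_combination (-(cosh (2 * p.sep a 0) + cosh p.η)) * h)
  have hk2 : ∀ a, cosh p.η + cosh (2 * p.sep a 0) ≠ 0 := fun a h => hcη a (by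
    linear_combination (cosh (2 * p.sep a 0) - cosh p.η) * h)
  have hsep : ∀ a, Continuous fun η => (p.withEta η).sep a 0 := fun a => by
    simp only [sep_zero, withEta]
    fun_prop
  have hch : ∀ a, Continuous fun η => cosh (2 * (p.withEta η).sep a 0) := fun a =>
    Complex.continuous_cosh.comp (continuous_const.mul (hsep a))
  have hdet : ∀ x, Continuous fun η => (p.withEta η).detqM x := fun x => by
    simp only [detqM, dFun, aFun, withEta]
    fun_prop
  have hcoeff : ∀ a, ContinuousAt (fun η => (p.withEta η).interpCoeff a l) p.η := fun a => by
    refine ContinuousAt.mul (ContinuousAt.div ?_ ?_ (hcη a))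
      (tendsto_finsetProd _ fun b hb => ContinuousAt.div ?_ ?_
        (hcab a b (Finset.ne_of_mem_erase hb).symm))
    · exact (continuous_const.sub (Complex.continuous_cosh.pow 2)).continuousAt
    · exact (((hch a).pow 2).sub (Complex.continuous_cosh.pow 2)).continuousAt
    · exact (continuous_const.sub (hch b)).continuousAt
    · exact ((hch a).sub (hch b)).continuousAt
  have hconst : ContinuousAt (fun η => (p.withEta η).interpConst l) p.η := by
    have hnum : ∀ b, ContinuousAt (fun η => cosh (2 * l) - cosh (2 * (p.withEta η).sep b 0)) p.η :=
      fun b => (continuous_const.sub (hch b)).continuousAt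
    have hη : ContinuousAt (fun η : ℂ => cosh (p.withEta η).η) p.η :=
      Complex.continuous_cosh.continuousAt
    have h1 : ContinuousAt (fun η => ∏ b, (cosh (2 * l) - cosh (2 * (p.withEta η).sep b 0)) /
        (cosh (p.withEta η).η - cosh (2 * (p.withEta η).sep b 0))) p.η :=
      tendsto_finsetProd _ fun b _ => (hnum b).div (hη.sub (hch b).continuousAt) (hk1 b)
    have h2 : ContinuousAt (fun η => ∏ b, (cosh (2 * l) - cosh (2 * (p.withEta η).sep b 0)) /
        (cosh (p.withEta η).η + cosh (2 * (p.withEta η).sep b 0))) p.η :=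
      tendsto_finsetProd _ fun b _ => (hnum b).div (hη.add (hch b).continuousAt) (hk2 b)
    have h3 : ContinuousAt (fun η => ∏ b, (cosh (2 * l) - cosh (2 * (p.withEta η).sep b 0))) p.η :=
      tendsto_finsetProd _ fun b _ => hnum b
    have hd0 := (hdet 0).continuousAt (x := p.η)
    have hd1 := (hdet (I * Real.pi / 2)).continuousAt (x := p.η)
    unfold interpConst
    refine ContinuousAt.add (ContinuousAt.add ?_ ?_) ?_
    · refine ContinuousAt.mul (ContinuousAt.mul (ContinuousAt.mul ?_ ?_) h1) hd0
      · exact continuousAt_const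
      · exact continuousAt_const.add hη
    · refine ContinuousAt.mul (ContinuousAt.mul (ContinuousAt.mul (ContinuousAt.mul
        (ContinuousAt.mul ?_ ?_) h2) ?_) ?_) hd1
      · exact continuousAt_const
      · exact continuousAt_const.sub hη
      · exact continuousAt_const
      · exact continuousAt_const
    · refine ContinuousAt.mul (ContinuousAt.mul ?_ ?_) h3
      · exact continuousAt_const
      · exact continuousAt_const.sub (hη.pow 2)
  have hT : ContinuousAt (fun η => (p.withEta η).transfer l) p.η :=
    (p.continuous_transfer continuous_id continuous_const).continuousAt
  have hTs : ∀ a, ContinuousAt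
      (fun η => (p.withEta η).transfer ((p.withEta η).sep a 0)) p.η := fun a =>
    (p.continuous_transfer continuous_id (hsep a)).continuousAt
  have hR : ContinuousAt (fun η => ∑ a, (p.withEta η).interpCoeff a l •
      (p.withEta η).transfer ((p.withEta η).sep a 0) + (p.withEta η).interpConst l • (1 : Op N))
      p.η :=
    (tendsto_finsetSum _ fun a _ => (hcoeff a).smul (hTs a)).add (hconst.smul continuousAt_const)
  refine eq_of_eventually_punctured_at (f := fun η => (p.withEta η).transfer l) hT hR ?_
  have hreg : ∀ᶠ η in nhdsWithin p.η {p.η}ᶜ, (p.withEta η).InterpRegular := by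
    have e1 : ∀ᶠ η in nhdsWithin p.η {p.η}ᶜ, ∀ a b : Fin N, sinh (p.ξ a + p.ξ b - η) ≠ 0 := by
      simp only [Filter.eventually_all]
      intro a b
      filter_upwards [eventually_sinh_ne_zero (neg_ne_zero.2 one_ne_zero) (p.ξ a + p.ξ b) p.η]
        with η h
      rwa [neg_one_mul, neg_add_eq_sub] at h
    have e2 : ∀ᶠ η in nhdsWithin p.η {p.η}ᶜ, ∀ a : Fin N, sinh (2 * p.ξ a - η) ≠ 0 := by
      simp only [Filter.eventually_all]
      intro a
      filter_upwards [eventually_sinh_ne_zero (neg_ne_zero.2 one_ne_zero) (2 * p.ξ a) p.η]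
        with η h
      rwa [neg_one_mul, neg_add_eq_sub] at h
    have e3 : ∀ᶠ η in nhdsWithin p.η {p.η}ᶜ, ∀ a : Fin N, sinh (2 * p.ξ a - 2 * η) ≠ 0 := by
      simp only [Filter.eventually_all]
      intro a
      filter_upwards [eventually_sinh_ne_zero (neg_ne_zero.2 two_ne_zero) (2 * p.ξ a) p.η]
        with η h
      rwa [neg_mul, neg_add_eq_sub] at h
    filter_upwards [e1, e2, e3, eventually_sinh_ne_zero one_ne_zero 0 p.η] with η h1 h2 h3 h4
    rw [one_mul, add_zero] at h4
    exact ⟨fun a b hab => ⟨(hp.1 a b hab).1, h1 a b⟩,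
      fun a => ⟨h2 a, (hp.2.1 a).2.1, h3 a⟩, h4⟩
  filter_upwards [hreg, eventually_sinh_ne_zero one_ne_zero (I * Real.pi / 2) p.η] with η h1 h2
  rw [one_mul, sinh_add_half_pi] at h2
  exact (p.withEta η).transfer_interpolation_of_cosh_ne_zero h1 (right_ne_zero_of_mul h2) hζm hζp l

end Chain

end TransferInterpolation

end OpenXXZ

namespace OpenXXZ

/-! ### Separate action and Baxter equations -/

section SeparationOfVariables

variable {N : ℕ}

theorem IsStateBasis.eq_zero {E : Conf N → Vect N} (hE : IsStateBasis E) {u : Vect N}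
    (hu : ∀ h, E h ⬝ᵥ u = 0) : u = 0 := by
  have key : ∀ w : Vect N, w ⬝ᵥ u = 0 := fun w => by
    have hw : w ∈ Submodule.span ℂ (Set.range E) := hE.2 ▸ Submodule.mem_top
    induction hw using Submodule.span_induction with
    | mem x hx => obtain ⟨h, rfl⟩ := hx; exact hu h
    | zero => exact zero_dotProduct _
    | add x y _ _ hx hy => rw [add_dotProduct, hx, hy, add_zero]
    | smul a x _ hx => rw [smul_dotProduct, hx, smul_zero]
  funext s
  simpa using key (Pi.single s 1)

theorem sepShift_dotProduct (up down : Fin N → ℂ) (n : Fin N) (E : Conf N → Vect N) (v : Vect N)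
    (h : Conf N) : sepShift up down n E h ⬝ᵥ v = sepShift up down n (fun k => E k ⬝ᵥ v) h := by
  unfold sepShift
  split_ifs <;> rw [smul_dotProduct]

/-- A basis of covectors on which `T` acts at the points `z n (h n)` by separate shifts is a left
SOV representation if `T` and the functions in `F` are interpolated at these points. -/
theorem isLeftSOV_of_action {T : ℂ → Op N} {F : Set (ℂ → ℂ)} {z : Fin N → Fin 2 → ℂ}
    {up down : Fin N → ℂ} {E : Conf N → Vect N} {c : Fin N → ℂ → ℂ} {k : ℂ → ℂ}
    (hT : ∀ l, T l = ∑ a, c a l • T (z a 0) + k l • 1)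
    (hc : ∀ (h : Conf N) (d : Fin N → ℂ), (∀ n, ∑ a, c a (z n (h n)) * d a = 0) →
      ∀ l, ∑ a, c a l * d a = 0)
    (hF : ∀ t, t ∈ F ↔ ∀ l, t l = ∑ a, c a l * t (z a 0) + k l) (hE : IsStateBasis E)
    (hact : ∀ n h, E h ᵥ* T (z n (h n)) = sepShift up down n E h ∧
      E h ᵥ* T (-z n (h n)) = sepShift up down n E h) :
    IsLeftSOV T F z up down E := by
  refine ⟨hE, hact, fun t v hv => ⟨fun ht => ⟨(hF t).2 fun l => ?_, fun n h => ?_⟩,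
    fun ⟨htF, hB⟩ l => ?_⟩⟩
  · have h1 := ht l
    simp only [hT l, add_mulVec, sum_mulVec, smul_mulVec, ht, one_mulVec, smul_smul] at h1
    rw [← Finset.sum_smul, ← add_smul] at h1
    exact (smul_left_injective ℂ hv h1).symm
  · rw [← sepShift_dotProduct, ← (hact n h).1, ← dotProduct_mulVec, ht, dotProduct_smul,
      smul_eq_mul]
  · rw [hF] at htF
    refine sub_eq_zero.1 (hE.eq_zero fun h => ?_)
    -- The scalar part k cancels between T and t, leaving only interpolation coefficients.
    have key : ∀ l, E h ⬝ᵥ (T l *ᵥ v - t l • v) =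
        ∑ a, c a l * (E h ⬝ᵥ (T (z a 0) *ᵥ v - t (z a 0) • v)) := fun l => by
      simp only [hT l, htF l, add_mulVec, sum_mulVec, smul_mulVec, one_mulVec, dotProduct_sub,
        dotProduct_add, dotProduct_sum, dotProduct_smul, smul_eq_mul, mul_sub,
        Finset.sum_sub_distrib, add_mul, Finset.sum_mul, mul_assoc]
      ring
    rw [key]
    -- It suffices to test at the mixed nodes z n (h n) of this h, where the action on E h and the
    -- Baxter equation agree.
    refine hc h _ (fun n => ?_) l
    rw [← key, dotProduct_sub, dotProduct_mulVec, (hact n h).1, sepShift_dotProduct, ← hB n h,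
      dotProduct_smul, smul_eq_mul, sub_self]

theorem IsLeftSOV.transpose {T : ℂ → Op N} {F : Set (ℂ → ℂ)} {z : Fin N → Fin 2 → ℂ}
    {up down : Fin N → ℂ} {E : Conf N → Vect N}
    (h : IsLeftSOV (fun l => (T l)ᵀ) F z up down E) : IsRightSOV T F z up down E := by
  simpa only [IsLeftSOV, IsRightSOV, vecMul_transpose, mulVec_transpose, dotProduct_comm] using h

theorem IsLeftPseudoDiagonal.transpose {O : ℂ → Op N} {E E' : Conf N → Vect N}
    {v : Conf N → ℂ → ℂ} (h : IsLeftPseudoDiagonal (fun l => (O l)ᵀ) E E' v) :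
    IsRightPseudoDiagonal O E E' v := by
  simpa only [IsLeftPseudoDiagonal, IsRightPseudoDiagonal, vecMul_transpose] using h

namespace Chain

variable {p : Chain N} {αm βm : ℂ}

theorem Generic.interpRegular (hN : 0 < N) (hG : p.Generic αm βm) : p.InterpRegular :=
  ⟨fun _ _ hab => ⟨hG.shift hab 0 (by simp) (Or.inl (by simp)),
    hG.shift hab (-1) (by simp) (Or.inr (by push_cast; ring))⟩,
    fun a => ⟨hG.double a (-1) (by simp) (by push_cast; ring),
      hG.double a 0 (by simp) (by push_cast; ring),
      hG.double a (-2) (by simp) (by push_cast; ring)⟩, hG.sinh_eta ⟨0, hN⟩⟩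

-- In c = cosh 2l the sum is c² - cosh²η times a polynomial of degree below N. At the mixed nodes
-- the prefactor is nonzero and the N values of c are distinct, so the polynomial is zero.
open Polynomial in
theorem interpCoeff_eq_zero (hG : p.Generic αm βm) (h : Conf N) (d : Fin N → ℂ)
    (hd : ∀ n, ∑ a, p.interpCoeff a (p.sep n (h n)) * d a = 0) (l : ℂ) :
    ∑ a, p.interpCoeff a l * d a = 0 := by
  set D : Fin N → ℂ := fun a => d a / (cosh (2 * p.sep a 0) ^ 2 - cosh p.η ^ 2) with hD
  set Q : ℂ[X] := ∑ a, C (D a) *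
    Lagrange.basis Finset.univ (fun b => cosh (2 * p.sep b 0)) a with hQ
  have key : ∀ l, ∑ a, p.interpCoeff a l * d a =
      (cosh (2 * l) ^ 2 - cosh p.η ^ 2) * Q.eval (cosh (2 * l)) := fun l => by
    rw [hQ, eval_finsetSum, Finset.mul_sum]
    refine Finset.sum_congr rfl fun a _ => ?_
    simp only [interpCoeff, hD, eval_mul, eval_C, Lagrange.basis, eval_prod,
      Lagrange.basisDivisor, eval_sub, eval_X, div_eq_mul_inv]
    rw [Finset.prod_congr rfl fun b _ => mul_comm (cosh (2 * l) - cosh (2 * p.sep b 0)) _]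
    ring
  rcases Nat.eq_zero_or_pos N with rfl | hN
  · simp
  have hQ0 : Q = 0 := by
    refine Polynomial.eq_zero_of_natDegree_lt_card_of_eval_eq_zero Q
      (f := fun n => cosh (2 * p.sep n (h n))) (fun a b hab => ?_) (fun n => ?_) ?_
    · by_contra hne
      have h1 := cosh_two_mul_sub_cosh_two_mul (p.sep a (h a)) (p.sep b (h b))
      rw [sub_eq_zero.2 hab] at h1
      exact mul_ne_zero two_ne_zero (mul_ne_zero (sinh_sep_add_ne_zero hG hne _ _)
        (sinh_sep_sub_ne_zero hG hne _ _)) h1.symm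
    · have h1 := hd n
      rw [key] at h1
      refine (mul_eq_zero.1 h1).resolve_left ?_
      rw [cosh_sq_sub_cosh_sq]
      generalize h n = x
      fin_cases x
      · exact mul_ne_zero (hG.double n 0 (by simp) (by simp [sep]; ring))
          (hG.double n (-2) (by simp) (by simp [sep]; ring))
      · exact mul_ne_zero (hG.double n 2 (by simp) (by simp [sep]; ring))
          (hG.double n 0 (by simp) (by simp [sep]; ring))
    · rw [Fintype.card_fin]
      refine lt_of_le_of_lt (natDegree_sum_le_of_forall_le (n := N - 1) _ _ fun a _ => ?_) (by omega)
      refine (natDegree_C_mul_le _ _).trans ?_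
      refine (natDegree_prod_le _ _).trans ?_
      refine (Finset.sum_le_card_nsmul _ _ 1 fun b _ => ?_).trans ?_
      · exact (natDegree_C_mul_le _ _).trans (natDegree_X_sub_C_le _)
      · simp [Finset.card_erase_of_mem]
  rw [key, hQ0, eval_zero, mul_zero]

theorem isLeftSOV_transfer (hN : 0 < N) (hG : p.Generic αm βm) (hζm : sinh p.ζm ≠ 0)
    (hζp : sinh p.ζp ≠ 0) {up down : Fin N → ℂ} {E : Conf N → Vect N} (hE : IsStateBasis E)
    (hact : ∀ n h, E h ᵥ* p.transfer (p.sep n (h n)) = sepShift up down n E h ∧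
      E h ᵥ* p.transfer (-p.sep n (h n)) = sepShift up down n E h) :
    IsLeftSOV p.transfer p.spectralClass p.sep up down E :=
  isLeftSOV_of_action (p.transfer_interpolation (hG.interpRegular hN) hζm hζp)
    (interpCoeff_eq_zero hG) (fun _ => p.mem_spectralClass) hE hact

theorem isRightSOV_transfer (hN : 0 < N) (hG : p.Generic αm βm) (hζm : sinh p.ζm ≠ 0)
    (hζp : sinh p.ζp ≠ 0) {up down : Fin N → ℂ} {E : Conf N → Vect N} (hE : IsStateBasis E)
    (hact : ∀ n h, E h ᵥ* (p.transfer (p.sep n (h n)))ᵀ = sepShift up down n E h ∧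
      E h ᵥ* (p.transfer (-p.sep n (h n)))ᵀ = sepShift up down n E h) :
    IsRightSOV p.transfer p.spectralClass p.sep up down E := by
  refine (isLeftSOV_of_action (T := fun l => (p.transfer l)ᵀ) (fun l => ?_)
    (interpCoeff_eq_zero hG) (fun _ => p.mem_spectralClass) hE hact).transpose
  have h := congrArg Matrix.transpose
    (p.transfer_interpolation (hG.interpRegular hN) hζm hζp l)
  simpa only [transpose_add, transpose_sum, transpose_smul, transpose_one] using h

section Action

variable (hG : p.Generic αm βm) (hζ : sinh p.ζm ≠ 0) (hκ : p.κm ≠ 0)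
  (h₁ : sinh αm * cosh βm = sinh p.ζm / (2 * p.κm))
  (h₂ : cosh αm * sinh βm = cosh p.ζm / (2 * p.κm)) (hζp : sinh p.ζp ≠ 0)
include hG hζ hκ h₁ h₂ hζp

/-- The action of the transfer matrix on the separate covectors. -/
theorem sepConf_vecMul_transfer {z : ℂ}
    (hz : p.κp * ((exp p.η * z) ^ 2 * exp (-p.τp) - exp p.τp) = exp p.η * z * exp (-p.ζp))
    (n : Fin N) (h : Conf N) {l : ℂ} (hl : l = p.sep n (h n) ∨ l = -p.sep n (h n)) :
    p.sepConf αm βm z h ᵥ* p.transfer l =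
      sepShift (fun n => p.transferCoeff z (-p.sep n 0) * p.AMinus αm βm (-p.sep n 0))
        (fun n => p.transferCoeff z (p.sep n 1) * p.AMinus αm βm (p.sep n 1)) n
        (p.sepConf αm βm z) h := by
  have hs0 : sinh (2 * p.sep n (h n)) ≠ 0 := by
    generalize h n = x
    fin_cases x
    · exact hG.double n (-1) (by simp) (by simp [sep]; ring)
    · exact hG.double n 1 (by simp) (by simp [sep]; ring)
  have hsl : sinh (2 * l) ≠ 0 := by
    rcases hl with rfl | rfl
    · exact hs0
    · rwa [mul_neg, Complex.sinh_neg, neg_ne_zero]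
  have hB : p.sepConf αm βm z h ᵥ* p.Bz z l = 0 := by
    rw [sepConf_vecMul_Bz, p.sepVal_eq_zero z n hl, zero_smul]
  have key : p.sepConf αm βm z h ᵥ* p.transfer l =
      p.transferCoeff z (p.sep n (h n)) • (p.sepConf αm βm z h ᵥ* p.Az z (p.sep n (h n))) +
      p.transferCoeff z (-p.sep n (h n)) • (p.sepConf αm βm z h ᵥ* p.Az z (-p.sep n (h n))) := by
    rw [p.transfer_eq hζp hsl hz, vecMul_add, vecMul_add, vecMul_smul, vecMul_smul, vecMul_smul,
      hB, smul_zero, add_zero]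
    rcases hl with rfl | rfl
    · rfl
    · rw [neg_neg, add_comm]
  rw [key, sepShift]
  -- For h n = 0, `Az` annihilates at ζ_n and raises at -ζ_n; for h n = 1 it lowers at ζ_n and
  -- annihilates at -ζ_n.
  have hn : h n = 0 ∨ h n = 1 := by omega
  rcases hn with hn | hn
  · rw [if_pos hn, hn, sep_zero, sepConf_vecMul_Az_zero hG z hn, neg_sub,
      sepConf_vecMul_Az_raise hG z hn, smul_zero, zero_add, smul_smul]
  · rw [if_neg (by rw [hn]; exact one_ne_zero), hn, sep_one,
      sepConf_vecMul_Az_lower hG hζ hκ h₁ h₂ z hn, neg_add', sepConf_vecMul_Az_vanish hG z hn,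
      smul_zero, add_zero, smul_smul]

end Action

end Chain

end SeparationOfVariables

end OpenXXZ

namespace OpenXXZ

/-! ### From the gauge transformation to `Az` and `Bz` -/

section GaugeTransformation

variable {N : ℕ}

namespace Chain

variable (p : Chain N)

/-- The parameter of the triangular gauge of `ℬ₋(l|b)`. -/
noncomputable def gaugeParam (α b : ℂ) : ℂ := exp (-(α * p.η) + (b - 1) * p.η)

theorem gaugeParam_ne_zero (α b : ℂ) : p.gaugeParam α b ≠ 0 := Complex.exp_ne_zero _

theorem gaugeParam_neg_sub (α b : ℂ) : p.gaugeParam α (-b) - p.gaugeParam α b =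
    -(2 * exp (-((α + 1) * p.η)) * sinh (b * p.η)) := by
  rw [gaugeParam, gaugeParam, Complex.sinh,
    show -(α * p.η) + (-b - 1) * p.η = -((α + 1) * p.η) + -(b * p.η) by ring,
    show -(α * p.η) + (b - 1) * p.η = -((α + 1) * p.η) + b * p.η by ring, Complex.exp_add,
    Complex.exp_add]
  ring

theorem gaugeParam_neg_sub_ne_zero {α b : ℂ} (hb : sinh (b * p.η) ≠ 0) :
    p.gaugeParam α (-b) - p.gaugeParam α b ≠ 0 := by
  rw [gaugeParam_neg_sub]
  exact neg_ne_zero.2 (mul_ne_zero (mul_ne_zero two_ne_zero (Complex.exp_ne_zero _)) hb)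

theorem gaugeParam_sub_two (α b : ℂ) :
    p.gaugeParam α (b - 2) = p.gaugeParam α b * exp (-(2 * p.η)) := by
  rw [gaugeParam, gaugeParam, ← Complex.exp_add]
  ring_nf

theorem Gtil_eq (α b l : ℂ) : p.Gtil α b l =
    !![p.gaugeParam α (-b) * exp (-l), p.gaugeParam α b * exp (-l); 1, 1] := by
  ext i j
  fin_cases i <;> fin_cases j <;> simp [Gtil, X, Y, gaugeParam, ← Complex.exp_add] <;> ring_nf

/-- The entries of `𝒰₋(l|b)` in terms of contractions of `𝒰₋(l)`. -/
theorem Ugauge_eq {α b : ℂ} (hb : sinh (b * p.η) ≠ 0) (l : ℂ) :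
    p.Ugauge α b l = (p.gaugeParam α (-b) - p.gaugeParam α b)⁻¹ •
      !![contract (p.gaugeParam α b * exp (-(l - p.η / 2)))
          (p.gaugeParam α (-b) * exp (l - p.η / 2)) (p.Uminus l),
        contract (p.gaugeParam α b * exp (-(l - p.η / 2)))
          (p.gaugeParam α b * exp (l - p.η / 2)) (p.Uminus l);
        -contract (p.gaugeParam α (-b) * exp (-(l - p.η / 2)))
          (p.gaugeParam α (-b) * exp (l - p.η / 2)) (p.Uminus l),
        -contract (p.gaugeParam α (-b) * exp (-(l - p.η / 2)))
          (p.gaugeParam α b * exp (l - p.η / 2)) (p.Uminus l)] := by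
  have hd := p.gaugeParam_neg_sub_ne_zero (α := α) hb
  have hinv : (p.Gtil α b (l - p.η / 2))⁻¹ =
      (exp (l - p.η / 2) * (p.gaugeParam α (-b) - p.gaugeParam α b)⁻¹) •
        !![1, -(p.gaugeParam α b * exp (-(l - p.η / 2)));
          -1, p.gaugeParam α (-b) * exp (-(l - p.η / 2))] := by
    refine Matrix.inv_eq_left_inv ?_
    rw [Gtil_eq, Complex.exp_neg]
    have he := Complex.exp_ne_zero (l - p.η / 2)
    generalize exp (l - p.η / 2) = y at *
    ext i j
    fin_cases i <;> fin_cases j <;> simp <;> field_simp <;> ring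
  rw [Ugauge, hinv, Gtil_eq, lift_smul, smul_mul_assoc, smul_mul_assoc, smul_smul,
    show exp (-l + p.η / 2) * (exp (l - p.η / 2) * (p.gaugeParam α (-b) - p.gaugeParam α b)⁻¹) =
      (p.gaugeParam α (-b) - p.gaugeParam α b)⁻¹ by
        rw [← mul_assoc, ← Complex.exp_add]; simp]
  congr 1
  rw [neg_sub]
  ext1 i j
  fin_cases i <;> fin_cases j <;>
  · simp only [Matrix.mul_apply, Fin.sum_univ_two, lift_apply, contract]
    simp
    module

theorem opB_eq {α b : ℂ} (hb : sinh (b * p.η) ≠ 0) (l : ℂ) :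
    p.opB α b l = (p.gaugeParam α (-b) - p.gaugeParam α b)⁻¹ • p.Bz (p.gaugeParam α b) l := by
  rw [opB, Ugauge_eq p hb, Bz_eq_contract]
  simp

/-- The two columns of the gauge matrix differ by a multiple of (1, 0), so 𝒜₋ is `Az` plus the
contraction that defines `Bz`, suitably normalized. -/
theorem opA_eq {α b : ℂ} (hb : sinh ((b - 2) * p.η) ≠ 0) (l : ℂ) :
    p.opA α b l = p.Az (p.gaugeParam α (b - 2)) l +
      (p.gaugeParam α (-(b - 2)) - p.gaugeParam α (b - 2))⁻¹ •
        p.Bz (p.gaugeParam α (b - 2)) l := by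
  have hd := p.gaugeParam_neg_sub_ne_zero (α := α) hb
  rw [opA, Ugauge_eq p hb, Bz, Az, contract]
  generalize p.gaugeParam α (b - 2) = z at *
  generalize p.gaugeParam α (-(b - 2)) = w at *
  simp only [Matrix.smul_apply, of_apply, cons_val_zero, cons_val', cons_val_fin_one,
    Complex.exp_neg]
  have he := Complex.exp_ne_zero (l - p.η / 2)
  generalize exp (l - p.η / 2) = y at *
  match_scalars <;> field_simp <;> ring

/-- Changing the sign of the parameter of `Gtil` exchanges its two columns, hence the two indices of
the gauged matrix. -/
theorem opC_eq_opB {α b : ℂ} (hb : sinh ((b - 2) * p.η) ≠ 0) (l : ℂ) :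
    p.opC α b l = p.opB α (2 - b) l := by
  have hb' : sinh ((2 - b) * p.η) ≠ 0 := by
    rw [← neg_sub, neg_mul, Complex.sinh_neg]; exact neg_ne_zero.2 hb
  rw [opC, opB, Ugauge_eq p hb, Ugauge_eq p hb', neg_sub, neg_sub,
    ← neg_sub (p.gaugeParam α (b - 2)), ← neg_inv]
  simp

theorem opD_eq_opA {α b : ℂ} (hb : sinh (b * p.η) ≠ 0) (l : ℂ) :
    p.opD α b l = p.opA α (2 - b) l := by
  have hb' : sinh (-b * p.η) ≠ 0 := by
    rw [neg_mul, Complex.sinh_neg]; exact neg_ne_zero.2 hb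
  rw [opD, opA, show 2 - b - 2 = -b by ring, Ugauge_eq p hb, Ugauge_eq p hb', neg_neg,
    ← neg_sub (p.gaugeParam α b), ← neg_inv]
  simp

theorem leftRef_eq_refCov (α b : ℂ) : p.leftRef α b = p.refCov (p.gaugeParam α b) := by
  funext s
  simp only [leftRef, refCov, siteCov]
  refine Finset.prod_congr rfl fun n _ => ?_
  congr 2
  rw [gaugeParam, ← Complex.exp_nat_mul, ← Complex.exp_add, ← Complex.exp_add,
    Nat.cast_sub n.2.le]
  ring_nf

variable {p} {αm βm : ℂ} {z : ℂ}

theorem sepCov_vecMul_list_prod {O : Fin N → Op N} {r : Fin N → ℂ}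
    (hO : ∀ ns : List (Fin N), ns.Nodup → ∀ n ∉ ns,
      p.sepCov αm βm z ns ᵥ* O n = r n • p.sepCov αm βm z (n :: ns)) (h : Conf N) :
    ∀ ms ns : List (Fin N), ms.Nodup → ns.Nodup → List.Disjoint ms ns →
      p.sepCov αm βm z ns ᵥ* (ms.map fun n => O n ^ (h n : ℕ)).prod =
        (ms.map fun n => r n ^ (h n : ℕ)).prod •
          p.sepCov αm βm z ((ms.filter fun n => h n = 1).reverse ++ ns)
  | [], ns, _, _, _ => by simp
  | m :: ms, ns, hms, hns, hd => by
    rw [List.nodup_cons] at hms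
    rw [List.disjoint_cons_left] at hd
    have hm : h m = 0 ∨ h m = 1 := by omega
    rcases hm with hm | hm
    · simpa [hm] using sepCov_vecMul_list_prod hO h ms ns hms.2 hns hd.2
    · have ih := sepCov_vecMul_list_prod hO h ms (m :: ns) hms.2
        (List.nodup_cons.2 ⟨hd.1, hns⟩) (by
          rw [List.disjoint_cons_right]; exact ⟨hms.1, hd.2⟩)
      simp [hm, ← vecMul_vecMul, hO ns hns m hd.1, smul_vecMul, ih, smul_smul]

/-- Any ordering of the sites is allowed because transposition, used for right states, reverses the
ordered product. -/
theorem refCov_vecMul_list_prod (hG : p.Generic αm βm) {O : Fin N → Op N} {r : Fin N → ℂ}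
    (hO : ∀ ns : List (Fin N), ns.Nodup → ∀ n ∉ ns,
      p.sepCov αm βm z ns ᵥ* O n = r n • p.sepCov αm βm z (n :: ns)) (h : Conf N)
    {ms : List (Fin N)} (hms : ms.Perm (List.finRange N)) :
    p.refCov z ᵥ* (ms.map fun n => O n ^ (h n : ℕ)).prod =
      (∏ n, r n ^ (h n : ℕ)) • p.sepConf αm βm z h := by
  have hnd : ms.Nodup := hms.nodup_iff.2 (List.nodup_finRange N)
  have key := sepCov_vecMul_list_prod hO h ms [] hnd List.nodup_nil (by simp)
  rw [sepCov, List.append_nil] at key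
  rw [key, (hms.map _).prod_eq, ← List.ofFn_eq_map, List.prod_ofFn, sepCov_eq_sepConf hG z]
  · exact List.nodup_reverse.2 (hnd.filter _)
  · intro n
    rw [List.mem_reverse, List.mem_filter]
    simp [hms.mem_iff]

/-- The `Bz` part of 𝒜₋ contributes nothing when a site not yet excited is raised, so 𝒜₋ may be
replaced by `Az`. -/
theorem leftB_eq_sepConf (hG : p.Generic αm βm) {α b : ℂ} (hb : sinh (b * p.η) ≠ 0) (h : Conf N) :
    p.leftB αm βm α b h = p.sepConf αm βm (p.gaugeParam α b) h := by
  have key := refCov_vecMul_list_prod (z := p.gaugeParam α b) hG (r := fun _ => 1)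
    (O := fun n => (p.AMinus αm βm (p.η / 2 - p.ξ n))⁻¹ • p.opA α (b + 2) (p.η / 2 - p.ξ n))
    (fun ns hns n hn => by
      have hb' : sinh ((b + 2 - 2) * p.η) ≠ 0 := by rwa [add_sub_cancel_right]
      rw [opA_eq p hb', add_sub_cancel_right, vecMul_smul, vecMul_add, vecMul_smul,
        sepCov_vecMul_Bz_eq_zero _ hns hn (Or.inr rfl), smul_zero, add_zero, sepCov, one_smul])
    h (List.Perm.refl _)
  rw [leftB, leftRef_eq_refCov, key]
  simp

theorem isLeftPseudoDiagonal_of_sepVal (hN : 0 < N) (hG : p.Generic αm βm) (hz : p.refFactor z ≠ 0)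
    {O : ℂ → Op N} {E E' : Conf N → Vect N} {v : Conf N → ℂ → ℂ} (hE : IsStateBasis E)
    (hO : ∀ h l, E h ᵥ* O l = v h l • E' h) {σ : Conf N → Conf N} (hσ : Function.Injective σ)
    {c : Conf N → ℂ} (hc : ∀ h, c h ≠ 0) (hv : ∀ h l, v h l = c h * p.sepVal z (σ h) l) :
    IsLeftPseudoDiagonal O E E' v := by
  refine ⟨hE, hO, fun h h0 => ?_, fun h k hk => ?_⟩
  · have h1 := hv h (p.sep ⟨0, hN⟩ (σ h ⟨0, hN⟩ + 1))
    rw [h0, Pi.zero_apply] at h1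
    exact mul_ne_zero (hc h) (sepVal_ne_zero hG hz _ _ (by omega)) h1.symm
  · by_contra hne
    obtain ⟨l, h1, h2⟩ := sepVal_separates hG hz fun he => hne (hσ he)
    have h3 := congrFun hk l
    rw [hv, hv, h1, mul_zero] at h3
    exact mul_ne_zero (hc k) h2 h3.symm

/-- The factor of the reference eigenvalue, in terms of the exponent of the gauge parameter. -/
theorem refFactor_eq {W : ℂ} (hz : z * exp p.η ^ N = exp W) :
    p.refFactor z = -(exp W * (2 * p.κm * sinh (W - p.τm) - exp p.ζm) / sinh p.ζm) := by
  have h1 : 2 * sinh (W - p.τm) = exp W * exp (-p.τm) - exp p.τm * (exp W)⁻¹ := by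
    simp only [Complex.sinh, neg_sub, Complex.exp_sub, Complex.exp_neg]
    ring
  have h2 := Complex.exp_ne_zero W
  rw [refFactor, hz, ← neg_div]
  congr 1
  field_simp at h1
  linear_combination p.κm * h1

theorem leftVal_eq {α b : ℂ} (h : Conf N) (l : ℂ) :
    p.leftVal α b h l = (p.gaugeParam α (-b) - p.gaugeParam α b)⁻¹ *
      p.sepVal (p.gaugeParam α b) h l := by
  have hW : p.gaugeParam α b * exp p.η ^ N = exp ((N + b - α - 1) * p.η) := by
    rw [gaugeParam, ← Complex.exp_nat_mul, ← Complex.exp_add]; ring_nf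
  have h1 : p.aConf h l * ((-1) ^ N * p.aConf h (-l)) =
      ∏ n, sinh (l - p.sep n (h n)) * sinh (l + p.sep n (h n)) := by
    rw [Finset.prod_mul_distrib, aConf, aConf, show (-1 : ℂ) ^ N = ∏ _n : Fin N, (-1 : ℂ) by simp,
      ← Finset.prod_mul_distrib]
    congr 1
    refine Finset.prod_congr rfl fun n _ => ?_
    rw [neg_one_mul, ← Complex.sinh_neg]; ring_nf
  have h2 : exp ((b + N) * p.η) * exp (-((α + 1) * p.η)) = exp ((N + b - α - 1) * p.η) := by
    rw [← Complex.exp_add]; ring_nf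
  rw [sepVal, refFactor_eq hW, ← h1, gaugeParam_neg_sub, leftVal, ← h2]
  have h3 := Complex.exp_ne_zero (-((α + 1) * p.η))
  generalize exp (-((α + 1) * p.η)) = x at *
  generalize (2 * p.κm * sinh ((N + b - α - 1) * p.η - p.τm) - exp p.ζm) = y
  -- Division by zero is zero, so both sides vanish in this case and in the next.
  by_cases h4 : sinh (b * p.η) = 0
  · simp [h4]
  by_cases h5 : sinh p.ζm = 0
  · simp [h5]
  field_simp

/-- For exp (-G) = e^η z this converts the hypothesis of `transfer_eq` into the form given by the
boundary parameters. -/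
theorem gauge_condition_iff (κ τ ζ G : ℂ) : κ * (exp (-G) ^ 2 * exp (-τ) - exp τ) =
    exp (-G) * exp (-ζ) ↔ 2 * κ * sinh (G + τ) = -exp (-ζ) := by
  rw [Complex.sinh, neg_add, Complex.exp_add, Complex.exp_add, Complex.exp_neg G]
  have h1 := Complex.exp_ne_zero G
  generalize exp G = x at *
  constructor <;> intro h
  · field_simp at h ⊢
    linear_combination -h
  · field_simp at h ⊢
    linear_combination -h

/-- The gauge condition fixes sinh at (α - b + 1)η + τ₊. The addition formula with increment (b +
1)η then expresses both coefficients through one exponential at that point. -/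
theorem aPlus_eq_transferCoeff {α b : ℂ} (hb : sinh ((b + 1) * p.η) ≠ 0)
    (hA : 2 * p.κp * sinh ((α - b + 1) * p.η + p.τp) = -exp (-p.ζp)) (l : ℂ) :
    p.aPlus α b l = p.transferCoeff (p.gaugeParam α (b - 1)) l := by
  have h1 : p.κp * sinh (p.τp + (α + 2) * p.η) =
      -exp (-p.ζp) * exp ((b + 1) * p.η) / 2 +
        sinh ((b + 1) * p.η) * (p.κp * exp (-((α - b + 1) * p.η + p.τp))) := by
    rw [← hA, show p.τp + (α + 2) * p.η = ((α - b + 1) * p.η + p.τp) + (b + 1) * p.η by ring,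
      Complex.sinh_add, ← Complex.cosh_sub_sinh, ← Complex.cosh_add_sinh]
    ring
  have h2 : p.gaugeParam α (b - 1) * (p.κp * exp (-p.τp)) =
      exp (-p.η) * (p.κp * exp (-((α - b + 1) * p.η + p.τp))) := by
    have : p.gaugeParam α (b - 1) * exp (-p.τp) =
        exp (-p.η) * exp (-((α - b + 1) * p.η + p.τp)) := by
      rw [gaugeParam, ← Complex.exp_add, ← Complex.exp_add]
      ring_nf
    linear_combination p.κp * this
  rw [aPlus, transferCoeff, h2,
    show p.κp * sinh (2 * l - p.η) * sinh (p.τp + (α + 2) * p.η) =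
      sinh (2 * l - p.η) * (p.κp * sinh (p.τp + (α + 2) * p.η)) by ring, h1]
  clear h1 h2 hA
  generalize p.κp * exp (-((α - b + 1) * p.η + p.τp)) = c
  rw [show l + p.η / 2 + b * p.η = l - p.η / 2 + (b + 1) * p.η by ring]
  generalize (b + 1) * p.η = B at *
  by_cases h3 : sinh p.ζp = 0
  · simp [h3]
  by_cases h4 : sinh (2 * l) = 0
  · simp [h4]
  have e0 : p.η = p.η / 2 + p.η / 2 := (add_halves _).symm
  generalize p.η / 2 = k at *
  rw [e0]
  generalize hS : sinh (2 * l) = S at *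
  generalize hT : sinh (2 * l + (k + k)) = T at *
  have hexp : ∀ x : ℂ, exp (2 * x) = exp x ^ 2 := fun x => by
    rw [← Complex.exp_nat_mul]; push_cast; rfl
  field_simp
  rw [mul_comm l, show k * (1 + 1) = 2 * k by ring]
  simp only [Complex.sinh, Complex.cosh, sub_eq_add_neg, neg_add, neg_neg, Complex.exp_add,
    Complex.exp_neg, hexp]
  field_simp
  ring

/-- With x = l + η/2, and apart from 1/sinh ζ₊, the contraction reduces to sinh 2x times the gauge
condition. -/
theorem gauge_row_col {G : ℂ} (hG : 2 * p.κp * sinh (G + p.τp) = -exp (-p.ζp)) (l : ℂ)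
    {r c : Fin 2 → ℂ} (hr : r = ![-1, exp (-(p.η / 2 - l + (G - p.η)))])
    (hc : c = ![exp (-(l - p.η / 2 + (G + p.η))), 1]) :
    r ⬝ᵥ (p.Kplus l *ᵥ c) = 0 := by
  rw [← gauge_condition_iff] at hG
  obtain ⟨x, hx⟩ : ∃ x, x = l + p.η / 2 := ⟨_, rfl⟩
  have h1 : p.Kplus l = (1 / sinh p.ζp) • !![sinh (x + p.ζp), p.κp * exp p.τp * sinh (2 * x);
      p.κp * exp (-p.τp) * sinh (2 * x), sinh (p.ζp - x)] := by
    rw [Kplus, KMatrix, hx]; ring_nf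
  rw [h1, hr, hc, smul_mulVec, dotProduct_smul,
    show p.η / 2 - l + (G - p.η) = G - x by rw [hx]; ring,
    show l - p.η / 2 + (G + p.η) = x + G by rw [hx]; ring]
  clear h1 hx hr hc
  refine smul_eq_zero_of_right _ ?_
  simp [Matrix.mulVec, dotProduct, Fin.sum_univ_two]
  have e1 : exp (x - G) = exp x * exp (-G) := by rw [← Complex.exp_add]; ring_nf
  have e2 : exp (-G + -x) = exp (-x) * exp (-G) := by rw [← Complex.exp_add]; ring_nf
  rw [e1, e2]
  have e3 : exp x * exp (-x) = 1 := by rw [← Complex.exp_add]; simp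
  have e4 : exp x * sinh (p.ζp - x) - exp (-x) * sinh (x + p.ζp) =
      -exp (-p.ζp) * sinh (2 * x) := by
    simp only [Complex.sinh, sub_eq_add_neg, neg_add, neg_neg, Complex.exp_add, two_mul,
      Complex.exp_neg]
    field_simp
    ring
  linear_combination sinh (2 * x) * hG + exp (-G) * e4 +
    (exp (-G) ^ 2 * p.κp * exp (-p.τp) * sinh (2 * x)) * e3

end Chain

end GaugeTransformation

end OpenXXZ

namespace OpenXXZ

/-! ### Transposition and the dual chain -/

section Transposition

variable {N : ℕ}

/-- The transposition in the auxiliary and the quantum space. -/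
def fullTranspose (A : AuxOp N) : AuxOp N := Matrix.of fun i j => (A j i)ᵀ

theorem fullTranspose_mul (A B : AuxOp N) :
    fullTranspose (A * B) = fullTranspose B * fullTranspose A := by
  ext1 i j
  simp only [fullTranspose, of_apply, Matrix.mul_apply, transpose_sum, transpose_mul]

theorem fullTranspose_lift (A : Matrix (Fin 2) (Fin 2) ℂ) :
    fullTranspose (lift A : AuxOp N) = lift Aᵀ := by
  ext1 i j
  simp [fullTranspose, lift_apply]

/-- The configuration with all spins reversed. -/
def flipConf (h : Conf N) : Conf N := fun n => 1 - h n

theorem flipConf_injective : Function.Injective (flipConf (N := N)) := fun h k hk => by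
  funext n
  exact sub_right_injective (congrFun hk n)

theorem flipConf_update (h : Conf N) (n : Fin N) (a : Fin 2) :
    flipConf (Function.update h n a) = Function.update (flipConf h) n (1 - a) := by
  funext k
  by_cases hk : k = n
  · subst hk; simp [flipConf]
  · simp [flipConf, hk]

theorem val_one_sub (a : Fin 2) : ((1 - a : Fin 2) : ℕ) = 1 - (a : ℕ) := by
  fin_cases a <;> rfl

theorem IsStateBasis.smul_flip {E : Conf N → Vect N} (hE : IsStateBasis E) {c : Conf N → ℂ}
    (hc : ∀ h, c h ≠ 0) : IsStateBasis fun h => c h • E (flipConf h) :=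
  isStateBasis_of_linearIndependent
    ((hE.1.comp _ flipConf_injective).units_smul fun h => Units.mk0 (c h) (hc h))

namespace Chain

variable (p : Chain N)

/-- The chain whose monodromy matrix is the transposed monodromy matrix. -/
def dual : Chain N := { p with ξ := fun n => -p.ξ n, τm := -p.τm, τp := -p.τp }

theorem fullTranspose_R0 (n : Fin N) (l : ℂ) : fullTranspose (p.R0 n l) = p.dual.R0 n l := by
  ext1 i j
  simp only [fullTranspose, R0, of_apply, siteOp_transpose]
  congr 1
  ext a b
  fin_cases i <;> fin_cases j <;> fin_cases a <;> fin_cases b <;> simp [RMatrix, dual]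

theorem fullTranspose_Ulist (l : ℂ) :
    ∀ ns : List (Fin N), fullTranspose (p.Ulist ns l) = p.dual.Ulist ns l
  | [] => by
    rw [Ulist_nil, Ulist_nil, fullTranspose_lift]
    congr 1
    ext i j
    fin_cases i <;> fin_cases j <;> simp [Kminus, KMatrix, dual]
  | n :: ns => by
    rw [Ulist_cons, Ulist_cons, fullTranspose_mul, fullTranspose_mul, fullTranspose_Ulist l ns,
      fullTranspose_R0, fullTranspose_R0, mul_assoc]
    simp [dual, ← sub_eq_add_neg]

theorem Uminus_transpose (l : ℂ) (i j : Fin 2) : (p.Uminus l i j)ᵀ = p.dual.Uminus l j i := by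
  rw [Uminus_eq_Ulist, Uminus_eq_Ulist, ← fullTranspose_Ulist]
  rfl

theorem transfer_transpose (l : ℂ) : (p.transfer l)ᵀ = p.dual.transfer l := by
  simp [transfer, Matrix.trace, Fin.sum_univ_two, Matrix.mul_apply, lift_apply, Uminus_transpose,
    Kplus, KMatrix, dual]
  abel

/-- With y = e^{l-η/2}, transposition exchanges the row (1, -z/y) and the column (zy, 1). Rescaled
to the same normal form they belong to -1/z, and the two scale factors multiply to -z². -/
theorem Bz_transpose {z : ℂ} (hz : z ≠ 0) (l : ℂ) :
    (p.Bz z l)ᵀ = (-z ^ 2) • p.dual.Bz (-z⁻¹) l := by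
  simp only [Bz, transpose_sub, transpose_add, transpose_smul, Uminus_transpose]
  simp only [dual]
  match_scalars <;> field_simp

theorem opD_transpose {α b : ℂ} (hb : sinh (b * p.η) ≠ 0) (l : ℂ) :
    (p.opD α b l)ᵀ = p.dual.Az (-(p.gaugeParam α b)⁻¹) l +
      (p.gaugeParam α b * p.gaugeParam α (-b) / (p.gaugeParam α (-b) - p.gaugeParam α b)) •
        p.dual.Bz (-(p.gaugeParam α b)⁻¹) l := by
  have hb' : sinh ((2 - b - 2) * p.η) ≠ 0 := by
    rw [sub_sub_cancel_left, neg_mul, Complex.sinh_neg]; exact neg_ne_zero.2 hb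
  have hd := p.gaugeParam_neg_sub_ne_zero (α := α) hb
  have hd' : p.gaugeParam α b - p.gaugeParam α (-b) ≠ 0 := by
    rw [← neg_sub]; exact neg_ne_zero.2 hd
  have hz := p.gaugeParam_ne_zero α b
  rw [opD_eq_opA p hb, opA_eq p hb', sub_sub_cancel_left, neg_neg]
  simp only [Az, Bz, transpose_sub, transpose_add, transpose_smul, Uminus_transpose]
  generalize p.gaugeParam α b = z at *
  generalize p.gaugeParam α (-b) = w at *
  simp only [dual]
  match_scalars <;> field_simp <;> ring

theorem dual_AMinus (αm βm l : ℂ) : p.dual.AMinus αm βm l = p.AMinus αm βm l := by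
  rw [AMinus, AMinus, mul_assoc, mul_assoc]
  congr 1
  simp only [aFun, dFun, ← Finset.prod_mul_distrib]
  refine Finset.prod_congr rfl fun n _ => ?_
  simp only [dual]
  rw [show l - -p.ξ n + p.η / 2 = -(-l - p.η - p.ξ n + p.η / 2) by ring,
    show -l - p.η - -p.ξ n + p.η / 2 = -(l - p.ξ n + p.η / 2) by ring, Complex.sinh_neg,
    Complex.sinh_neg]
  ring

/-- Negating ξ_n exchanges ζ_n^{(0)} and ζ_n^{(1)} up to sign; this is why configurations are
flipped. -/
theorem dual_sep (n : Fin N) (a : Fin 2) : p.dual.sep n (1 - a) = -p.sep n a := by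
  fin_cases a <;> simp [sep, dual] <;> ring

theorem Generic.dual {p : Chain N} {αm βm : ℂ} (hG : p.Generic αm βm) :
    p.dual.Generic αm βm := by
  refine ⟨fun a b hab r hr => ⟨?_, ?_⟩, fun a r hr => ?_, fun a => ⟨?_, ?_⟩⟩
  · have := (hG.1 b a hab.symm r hr).1
    simpa only [Chain.dual, neg_sub_neg] using this
  · have := neg_ne_zero.2 (hG.1 a b hab (-r) (by rwa [abs_neg])).2
    rw [← Complex.sinh_neg] at this
    convert this using 2
    simp [Chain.dual]
    ring
  · have := neg_ne_zero.2 (hG.2.1 a (-r) (by rwa [abs_neg]))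
    rw [← Complex.sinh_neg] at this
    convert this using 2
    simp [Chain.dual]
    ring
  · rw [dual_AMinus]
    simpa [Chain.dual] using (hG.2.2 a).2
  · rw [dual_AMinus]
    simpa [Chain.dual, sub_eq_add_neg] using (hG.2.2 a).1

/-- The ratio of the right reference state `|2 - b⟩` and the reference covector of the dual
chain. -/
noncomputable def rightScale (α b : ℂ) : ℂ :=
  ∏ n : Fin N, -exp (-(α * p.η) - ((N : ℂ) - (n : ℕ) + 1 - b) * p.η - p.ξ n)

theorem rightScale_ne_zero (α b : ℂ) : p.rightScale α b ≠ 0 :=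
  Finset.prod_ne_zero_iff.2 fun _ _ => neg_ne_zero.2 (Complex.exp_ne_zero _)

theorem rightScale_add_two (α b : ℂ) :
    p.rightScale α (b + 2) = exp (2 * N * p.η) * p.rightScale α b := by
  have : exp (2 * N * p.η) = ∏ _n : Fin N, exp (2 * p.η) := by
    rw [Finset.prod_const, Finset.card_univ, Fintype.card_fin, ← Complex.exp_nat_mul]
    ring_nf
  rw [rightScale, rightScale, this, ← Finset.prod_mul_distrib]
  refine Finset.prod_congr rfl fun n _ => ?_
  rw [mul_neg, ← Complex.exp_add]
  ring_nf

theorem rightRef_eq_refCov (α b : ℂ) : p.rightRef α (-b + 2) =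
    p.rightScale α b • p.dual.refCov (-(p.gaugeParam α b)⁻¹) := by
  funext s
  simp only [rightRef, rightScale, refCov, siteCov, Pi.smul_apply, smul_eq_mul,
    ← Finset.prod_mul_distrib]
  refine Finset.prod_congr rfl fun n _ => ?_
  have h1 : exp (-(α * p.η) - ((N : ℂ) - (n : ℕ) + 1 - b) * p.η - p.ξ n) *
      ((p.gaugeParam α b)⁻¹ * exp p.η ^ (N - (n : ℕ)) * exp (p.ξ n)) = 1 := by
    rw [gaugeParam, ← Complex.exp_neg, ← Complex.exp_nat_mul, ← Complex.exp_add, ← Complex.exp_add,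
      ← Complex.exp_add, Nat.cast_sub n.2.le, Complex.exp_eq_one_iff]
    exact ⟨0, by push_cast; ring⟩
  have h2 : s n = 0 ∨ s n = 1 := by omega
  rcases h2 with h2 | h2 <;> rw [h2] <;> simp only [dual]
  · simp
    ring_nf
  · simpa using h1.symm

/-- The ratio of two norms of separate covectors at the site `n`. -/
noncomputable def rightRatio (αm βm b : ℂ) (n : Fin N) : ℂ :=
  p.AMinus αm βm (p.η / 2 + p.ξ n) / (p.fNorm b n * p.AMinus αm βm (p.η / 2 - p.ξ n))

/-- The ratio of a right separate state and the separate covector of the dual chain. -/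
noncomputable def rightCoeff (αm βm α b : ℂ) (h : Conf N) : ℂ :=
  p.rightScale α b * ∏ n, p.rightRatio αm βm b n ^ (1 - (h n : ℕ))

variable {p} {αm βm : ℂ}

/-- After transposition 𝒟₋(ξ_n + η/2|b) is the raising operator `Az` of the dual chain plus a
multiple of `Bz`, which vanishes on covectors where site n is not excited. -/
theorem rightB_eq_sepConf (hG : p.Generic αm βm) {α b : ℂ} (hb : sinh (b * p.η) ≠ 0)
    (h : Conf N) : p.rightB αm βm α b h = p.rightCoeff αm βm α b h •
      p.dual.sepConf αm βm (-(p.gaugeParam α b)⁻¹) (flipConf h) := by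
  set z' := -(p.gaugeParam α b)⁻¹ with hz'
  have hO : ∀ ns : List (Fin N), ns.Nodup → ∀ n ∉ ns,
      p.dual.sepCov αm βm z' ns ᵥ* ((p.fNorm b n * p.AMinus αm βm (p.η / 2 - p.ξ n))⁻¹ •
        (p.opD α b (p.ξ n + p.η / 2))ᵀ) =
        p.rightRatio αm βm b n • p.dual.sepCov αm βm z' (n :: ns) := fun ns hns n hn => by
    have e1 : p.dual.η / 2 - p.dual.ξ n = p.η / 2 + p.ξ n := by simp [dual]
    have h1 : p.AMinus αm βm (p.η / 2 + p.ξ n) ≠ 0 := (hG.2.2 n).2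
    have h2 := sepCov_vecMul_Bz_eq_zero (αm := αm) (βm := βm) z' hns hn
      (Or.inr e1.symm : p.η / 2 + p.ξ n = p.dual.ξ n - p.dual.η / 2 ∨ _)
    rw [opD_transpose p hb, ← hz', add_comm (p.ξ n), vecMul_smul, vecMul_add, vecMul_smul, h2,
      smul_zero, add_zero, sepCov, e1, dual_AMinus, smul_smul, rightRatio,
      div_mul_eq_mul_div, mul_inv_cancel₀ h1, one_div]
  have key := refCov_vecMul_list_prod hG.dual hO (flipConf h)
    (ms := (List.finRange N).reverse) (List.reverse_perm _)
  rw [rightB, ← vecMul_transpose, rightRef_eq_refCov, smul_vecMul, rightCoeff, mul_smul,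
    transpose_list_prod]
  congr 1
  simp only [flipConf, val_one_sub] at key
  rw [← key]
  congr 2
  simp [List.map_reverse, Function.comp_def]

end Chain

end Transposition

end OpenXXZ

namespace OpenXXZ

/-! ### Normalization and coefficients of the right states -/

section RightStates

variable {N : ℕ}

namespace Chain

variable {p : Chain N} {αm βm : ℂ}

theorem fNorm_ne_zero (hG : p.Generic αm βm) {b : ℂ} (hb : sinh (b * p.η) ≠ 0) {n : Fin N}
    (hn : sinh (2 * p.ξ n + b * p.η) ≠ 0) : p.fNorm b n ≠ 0 :=
  div_ne_zero (mul_ne_zero (hG.double n 1 (by simp) (by simp)) hb)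
    (mul_ne_zero (hG.double n (-1) (by simp) (by simp [sub_eq_add_neg])) hn)

theorem rightRatio_ne_zero (hG : p.Generic αm βm) {b : ℂ} (hb : sinh (b * p.η) ≠ 0) {n : Fin N}
    (hn : sinh (2 * p.ξ n + b * p.η) ≠ 0) : p.rightRatio αm βm b n ≠ 0 :=
  div_ne_zero (hG.2.2 n).2 (mul_ne_zero (fNorm_ne_zero hG hb hn) (hG.2.2 n).1)

theorem rightCoeff_ne_zero (hG : p.Generic αm βm) {α b : ℂ} (hb : sinh (b * p.η) ≠ 0)
    (hn : ∀ n, sinh (2 * p.ξ n + b * p.η) ≠ 0) (h : Conf N) :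
    p.rightCoeff αm βm α b h ≠ 0 :=
  mul_ne_zero (p.rightScale_ne_zero α b)
    (Finset.prod_ne_zero_iff.2 fun n _ => pow_ne_zero _ (rightRatio_ne_zero hG hb (hn n)))

theorem rightCoeff_update (α b : ℂ) {h : Conf N} {n : Fin N} (hn : h n = 0) :
    p.rightCoeff αm βm α b h =
      p.rightRatio αm βm b n * p.rightCoeff αm βm α b (Function.update h n 1) := by
  rw [rightCoeff, rightCoeff, ← Finset.mul_prod_erase _ _ (Finset.mem_univ n),
    ← Finset.mul_prod_erase Finset.univ (fun k => _ ^ (1 - (Function.update h n 1 k : ℕ)))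
      (Finset.mem_univ n), hn, Function.update_self]
  have : ∀ k ∈ Finset.univ.erase n, p.rightRatio αm βm b k ^ (1 - (Function.update h n 1 k : ℕ)) =
      p.rightRatio αm βm b k ^ (1 - (h k : ℕ)) := fun k hk => by
    rw [Function.update_of_ne (Finset.ne_of_mem_erase hk)]
  rw [Finset.prod_congr rfl this]
  simp
  ring

theorem dual_refFactor {z W : ℂ} (hz : z * exp p.η ^ N = -exp (-W)) :
    p.dual.refFactor z =
      exp (-W) * (2 * p.κm * sinh (W - p.τm) - exp p.ζm) / sinh p.ζm := by
  have h1 : 2 * sinh (W - p.τm) = exp W * exp (-p.τm) - exp p.τm * (exp W)⁻¹ := by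
    simp only [Complex.sinh, neg_sub, Complex.exp_sub, Complex.exp_neg]
    ring
  have h2 := Complex.exp_ne_zero W
  have h3 : p.dual.refFactor z = (z * exp p.η ^ N * exp p.ζm +
    p.κm * (exp (-p.τm) - (z * exp p.η ^ N) ^ 2 * exp p.τm)) / sinh p.ζm := by
    simp [refFactor, dual]
  rw [h3, hz]
  congr 1
  rw [Complex.exp_neg W]
  field_simp at h1 ⊢
  linear_combination -p.κm * h1

theorem dual_sepVal (z : ℂ) (h : Conf N) (l : ℂ) : p.dual.sepVal z (flipConf h) l =
    (∏ n, sinh (l - p.sep n (h n)) * sinh (l + p.sep n (h n))) *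
      (sinh (2 * l - p.η) * p.dual.refFactor z) := by
  rw [sepVal]
  congr 1
  refine Finset.prod_congr rfl fun n _ => ?_
  rw [flipConf, dual_sep, sub_neg_eq_add, ← sub_eq_add_neg, mul_comm]

/-- Source and target states carry `rightCoeff` at b and at b + 2. Comparing the two gives the
ratios f_n(b+2)/f_n(b) and, through `rightScale`, a factor e^{2Nη}. -/
theorem rightVal_eq (hG : p.Generic αm βm) {α b : ℂ} (hb : sinh (b * p.η) ≠ 0)
    (hb' : sinh ((b + 2) * p.η) ≠ 0) (hn : ∀ n, sinh (2 * p.ξ n + b * p.η) ≠ 0)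
    (hn' : ∀ n, sinh (2 * p.ξ n + (b + 2) * p.η) ≠ 0) (h : Conf N) (l : ℂ) :
    p.rightCoeff αm βm α (b + 2) h * p.rightVal α b h l =
      p.rightCoeff αm βm α b h * ((p.gaugeParam α (-b) - p.gaugeParam α b)⁻¹ *
        (-p.gaugeParam α b ^ 2)) *
          p.dual.sepVal (-(p.gaugeParam α b)⁻¹) (flipConf h) l := by
  have hW : -(p.gaugeParam α b)⁻¹ * exp p.η ^ N = -exp (-((b - (1 + N + α)) * p.η)) := by
    rw [gaugeParam, ← Complex.exp_nat_mul, ← Complex.exp_neg, neg_mul, ← Complex.exp_add]; ring_nf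
  have h1 : p.aConf h l * ((-1) ^ N * p.aConf h (-l)) =
      ∏ n, sinh (l - p.sep n (h n)) * sinh (l + p.sep n (h n)) := by
    rw [Finset.prod_mul_distrib, aConf, aConf, show (-1 : ℂ) ^ N = ∏ _n : Fin N, (-1 : ℂ) by simp,
      ← Finset.prod_mul_distrib]
    congr 1
    refine Finset.prod_congr rfl fun n _ => ?_
    rw [neg_one_mul, ← Complex.sinh_neg]; ring_nf
  have h2 : exp ((b - N) * p.η) * (exp (2 * N * p.η) * exp (-((α + 1) * p.η))) =
      p.gaugeParam α b ^ 2 * exp (-((b - (1 + N + α)) * p.η)) := by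
    rw [gaugeParam, ← Complex.exp_nat_mul, ← Complex.exp_add, ← Complex.exp_add, ← Complex.exp_add]
    push_cast
    ring_nf
  have h3 : (∏ n, p.rightRatio αm βm (b + 2) n ^ (1 - (h n : ℕ))) *
      ∏ n, (p.fNorm (b + 2) n / p.fNorm b n) ^ (1 - (h n : ℕ)) =
        ∏ n, p.rightRatio αm βm b n ^ (1 - (h n : ℕ)) := by
    rw [← Finset.prod_mul_distrib]
    refine Finset.prod_congr rfl fun n _ => ?_
    rw [← mul_pow, rightRatio, rightRatio]
    have := fNorm_ne_zero hG hb (hn n)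
    have := fNorm_ne_zero hG hb' (hn' n)
    have := (hG.2.2 n).1
    congr 1
    field_simp
  rw [dual_sepVal, dual_refFactor hW, ← h1, gaugeParam_neg_sub, rightVal, rightCoeff, rightCoeff,
    rightScale_add_two, ← h3]
  generalize (∏ n, p.rightRatio αm βm (b + 2) n ^ (1 - (h n : ℕ))) = P
  generalize ∏ n, (p.fNorm (b + 2) n / p.fNorm b n) ^ (1 - (h n : ℕ)) = Q
  have h4 := Complex.exp_ne_zero (-((α + 1) * p.η))
  generalize exp (-((b - (1 + N + α)) * p.η)) = w at *
  generalize p.gaugeParam α b = z at *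
  generalize exp ((b - N) * p.η) = u at *
  generalize exp (2 * N * p.η) = v at *
  generalize exp (-((α + 1) * p.η)) = x at *
  generalize (2 * p.κm * sinh ((b - (1 + N + α)) * p.η - p.τm) - exp p.ζm) = y
  by_cases h5 : sinh p.ζm = 0
  · simp [h5]
  clear h1 hW
  generalize sinh (b * p.η) = s at *
  generalize sinh (2 * l - p.η) = t at *
  field_simp
  linear_combination p.rightScale α b * P * Q * p.aConf h l * p.aConf h (-l) * y * t * h2

theorem dPlus_eq_transferCoeff {α b : ℂ} (hb : sinh ((b - 1) * p.η) ≠ 0)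
    (hA : 2 * p.κp * sinh ((α - b + 1) * p.η + p.τp) = -exp (-p.ζp)) (l : ℂ) :
    p.dPlus α b l = p.dual.transferCoeff (-(p.gaugeParam α (b + 1))⁻¹) l := by
  have h1 : p.κp * sinh (p.τp + α * p.η) =
      -exp (-p.ζp) * exp (-((b - 1) * p.η)) / 2 +
        sinh ((b - 1) * p.η) * (p.κp * exp ((α - b + 1) * p.η + p.τp)) := by
    rw [← hA, show p.τp + α * p.η = ((α - b + 1) * p.η + p.τp) + (b - 1) * p.η by ring,
      Complex.sinh_add, ← Complex.cosh_sub_sinh, ← Complex.cosh_add_sinh]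
    ring
  have h2 : (p.gaugeParam α (b + 1))⁻¹ * (p.κp * exp p.τp) =
      exp (-p.η) * (p.κp * exp ((α - b + 1) * p.η + p.τp)) := by
    have : (p.gaugeParam α (b + 1))⁻¹ * exp p.τp =
        exp (-p.η) * exp ((α - b + 1) * p.η + p.τp) := by
      rw [gaugeParam, ← Complex.exp_neg, ← Complex.exp_add, ← Complex.exp_add]
      ring_nf
    linear_combination p.κp * this
  have h0 : p.dual.transferCoeff (-(p.gaugeParam α (b + 1))⁻¹) l =
      exp p.η * sinh (2 * l + p.η) / (sinh (2 * l) * sinh p.ζp) *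
    (exp (-l - p.η / 2) * sinh (p.ζp + l - p.η / 2)
      + (p.gaugeParam α (b + 1))⁻¹ * (p.κp * exp p.τp) * sinh (2 * l - p.η)) := by
    simp [transferCoeff, dual]
  rw [dPlus, h0, h2,
    show p.κp * sinh (2 * l - p.η) * sinh (p.τp + α * p.η) =
      sinh (2 * l - p.η) * (p.κp * sinh (p.τp + α * p.η)) by ring, h1]
  clear h0 h1 h2 hA
  generalize p.κp * exp ((α - b + 1) * p.η + p.τp) = c
  rw [show -l - p.η / 2 + b * p.η = -(l - p.η / 2) + (b - 1) * p.η by ring]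
  generalize (b - 1) * p.η = B at *
  by_cases h3 : sinh p.ζp = 0
  · simp [h3]
  by_cases h4 : sinh (2 * l) = 0
  · simp [h4]
  have e0 : p.η = p.η / 2 + p.η / 2 := (add_halves _).symm
  generalize p.η / 2 = k at *
  rw [e0]
  generalize hS : sinh (2 * l) = S at *
  generalize hT : sinh (2 * l + (k + k)) = T at *
  have hexp : ∀ x : ℂ, exp (2 * x) = exp x ^ 2 := fun x => by
    rw [← Complex.exp_nat_mul]; push_cast; rfl
  field_simp
  rw [mul_comm l, show k * (1 + 1) = 2 * k by ring]
  simp only [Complex.sinh, Complex.cosh, sub_eq_add_neg, neg_add, neg_neg, Complex.exp_add,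
    Complex.exp_neg, hexp]
  field_simp
  ring

end Chain

end RightStates

end OpenXXZ

/-! ### The conditions on the boundary parameters -/

namespace OpenXXZ

theorem sinh_eq_sinh_iff (x y : ℂ) :
    sinh x = sinh y ↔ ∃ k : ℤ, x = (-1) ^ k * y + I * Real.pi * k := by
  have h1 : sinh x = sinh y ↔ sin (y * I) = sin (x * I) := by
    rw [Complex.sin_mul_I, Complex.sin_mul_I, mul_left_inj' I_ne_zero, eq_comm]
  have hx : x = -(x * I * I) := by rw [mul_assoc, I_mul_I]; ring
  have hy : y * I * I = -y := by rw [mul_assoc, I_mul_I]; ring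
  rw [h1, Complex.sin_eq_sin_iff]
  constructor
  · rintro ⟨k, h | h⟩
    · refine ⟨-(2 * k), ?_⟩
      rw [Even.neg_one_zpow (by simp), hx, h, add_mul, hy]
      push_cast
      ring
    · refine ⟨-(2 * k + 1), ?_⟩
      rw [Odd.neg_one_zpow (odd_two_mul_add_one k).neg, hx, h, sub_mul, hy]
      push_cast
      ring
  · rintro ⟨k, h⟩
    obtain ⟨m, rfl | rfl⟩ := k.even_or_odd'
    · refine ⟨-m, Or.inl ?_⟩
      rw [h, Even.neg_one_zpow (by simp)]
      push_cast
      linear_combination 2 * Real.pi * m * I_mul_I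
    · refine ⟨-m - 1, Or.inr ?_⟩
      rw [h, Odd.neg_one_zpow (by simp)]
      push_cast
      linear_combination (2 * m + 1) * Real.pi * I_mul_I

section Boundary

variable {a b ζ κ : ℂ} (hκ : κ ≠ 0) (h₁ : sinh a * cosh b = sinh ζ / (2 * κ))
  (h₂ : cosh a * sinh b = cosh ζ / (2 * κ))
include hκ h₁ h₂

/-- The sum of the two defining equations is the sinh of α + β and their difference that of α - β;
hence the combinations α₋ + β₋ and α₊ - β₊ in the conditions on the gauge. -/
theorem sinh_add_boundary : 2 * κ * sinh (a + b) = exp ζ := by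
  rw [Complex.sinh_add, h₁, h₂, ← Complex.cosh_add_sinh]
  field_simp
  ring

theorem sinh_sub_boundary : 2 * κ * sinh (a - b) = -exp (-ζ) := by
  rw [Complex.sinh_sub, h₁, h₂, ← Complex.cosh_sub_sinh]
  field_simp
  ring

end Boundary

/-! ### The four SOV representations -/

section Representations

variable {N : ℕ}

namespace Chain

variable {p : Chain N} {αm βm α β : ℂ}

/-- The condition under which the off-diagonal entry of the gauge transformed `K₊` vanishes. -/
def UpperGauge (p : Chain N) (α β : ℂ) : Prop :=
  2 * p.κp * sinh ((α - β + 2) * p.η + p.τp) = -exp (-p.ζp)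

/-- The condition under which the pseudo-spectrum of `ℬ₋` does not vanish. -/
def LowerGauge (p : Chain N) (α β : ℂ) : Prop :=
  ∀ j < N, 2 * p.κm * sinh ((β - α + N - 3 - 2 * (j : ℂ)) * p.η - p.τm) - exp p.ζm ≠ 0

theorem upperGauge_of_exists {αp βp : ℂ} (hκ : p.κp ≠ 0)
    (h₁ : sinh αp * cosh βp = sinh p.ζp / (2 * p.κp))
    (h₂ : cosh αp * sinh βp = cosh p.ζp / (2 * p.κp))
    (h : ∃ k : ℤ, (α - β + 2) * p.η = -p.τp + (-1) ^ k * (αp - βp) + I * Real.pi * k) :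
    p.UpperGauge α β := by
  obtain ⟨k, hk⟩ := h
  rw [UpperGauge, ← sinh_sub_boundary hκ h₁ h₂, (sinh_eq_sinh_iff _ (αp - βp)).2 ⟨k, ?_⟩]
  rw [hk]
  ring

theorem lowerGauge_of_forall (hκ : p.κm ≠ 0) (h₁ : sinh αm * cosh βm = sinh p.ζm / (2 * p.κm))
    (h₂ : cosh αm * sinh βm = cosh p.ζm / (2 * p.κm))
    (h : ∀ (j : Fin N) (k : ℤ), (α - β) * p.η ≠ ((N : ℂ) - 3 - 2 * ((j : ℕ) : ℂ)) * p.η - p.τm -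
      (-1) ^ k * (αm + βm) + I * Real.pi * k) : p.LowerGauge α β := fun j hj h0 => by
  rw [← sinh_add_boundary hκ h₁ h₂, sub_eq_zero] at h0
  obtain ⟨k, hk⟩ := (sinh_eq_sinh_iff _ _).1 (mul_left_cancel₀ (mul_ne_zero two_ne_zero hκ) h0)
  -- Solving for (α - β)η reverses the sign of iπk.
  refine h ⟨j, hj⟩ (-k) ?_
  rw [_root_.zpow_neg, ← _root_.inv_zpow, inv_neg_one]
  push_cast
  linear_combination -hk

theorem KL_KR_apply_zero_one (h : p.UpperGauge α β) (l : ℂ) :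
    p.KL α (β - 1) l 0 1 = 0 ∧ p.KR α (β - 1) l 0 1 = 0 := by
  have h0 := p.gauge_row_col h l rfl rfl
  rw [show (α - β + 2) * p.η - p.η = (α - (β - 1)) * p.η by ring,
    show (α - β + 2) * p.η + p.η = (α - (β - 1 - 2)) * p.η by ring] at h0
  constructor
  · simp only [KL, Ytil, Ybar, Yhat, Y, mulVec_smul, smul_dotProduct, dotProduct_smul, of_apply,
      cons_val', cons_val_zero, cons_val_one, cons_val_fin_one, h0, smul_zero]
  · simp only [KR, Ybar, Y, smul_dotProduct, of_apply,
      cons_val', cons_val_zero, cons_val_one, cons_val_fin_one, h0, smul_zero]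

theorem KL_KR_apply_one_zero (h : p.UpperGauge α (2 - β)) (l : ℂ) :
    p.KL α (β - 1) l 1 0 = 0 ∧ p.KR α (β - 1) l 1 0 = 0 := by
  have h0 := p.gauge_row_col h l rfl rfl
  rw [show (α - (2 - β) + 2) * p.η - p.η = (α + (β - 1)) * p.η by ring,
    show (α - (2 - β) + 2) * p.η + p.η = (α + (β - 1 + 2)) * p.η by ring] at h0
  have e : ∀ x : ℂ, (![1, -x] : Fin 2 → ℂ) = -![-1, x] := fun x => by simp
  constructor
  · simp only [KL, Xtil, Xbar, Xhat, X, mulVec_smul, smul_dotProduct, dotProduct_smul, of_apply,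
      cons_val', cons_val_zero, cons_val_one, cons_val_fin_one, e, neg_dotProduct, h0, neg_zero,
      smul_zero]
  · simp only [KR, Xbar, X, smul_dotProduct, of_apply,
      cons_val', cons_val_zero, cons_val_one, cons_val_fin_one, e, neg_dotProduct, h0, neg_zero,
      smul_zero]

theorem refFactor_left_ne_zero (hζ : sinh p.ζm ≠ 0) (h : p.LowerGauge α β) {j : ℕ} (hj : j < N) :
    p.refFactor (p.gaugeParam α (β - 2) * exp (-(2 * p.η)) ^ j) ≠ 0 := by
  rw [p.refFactor_eq (W := (β - α + N - 3 - 2 * (j : ℂ)) * p.η)]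
  · exact neg_ne_zero.2 (div_ne_zero (mul_ne_zero (Complex.exp_ne_zero _) (h j hj)) hζ)
  · rw [gaugeParam, ← Complex.exp_nat_mul, ← Complex.exp_nat_mul, ← Complex.exp_add,
      ← Complex.exp_add]
    ring_nf

/-- The gauge steps of the dual chain run through the same N boundary factors in the opposite order,
j ↔ N - 1 - j, so the left and right cases share one hypothesis. -/
theorem refFactor_right_ne_zero (hζ : sinh p.ζm ≠ 0) (h : p.LowerGauge α β) {j : ℕ} (hj : j < N) :
    p.dual.refFactor (-(p.gaugeParam α β)⁻¹ * exp (-(2 * p.η)) ^ j) ≠ 0 := by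
  rw [dual_refFactor (W := (β - α + N - 3 - 2 * ((N - 1 - j : ℕ) : ℂ)) * p.η)]
  · exact div_ne_zero (mul_ne_zero (Complex.exp_ne_zero _) (h _ (by omega))) hζ
  · rw [gaugeParam, ← Complex.exp_nat_mul, ← Complex.exp_nat_mul, ← Complex.exp_neg, neg_mul,
      neg_mul, ← Complex.exp_add, ← Complex.exp_add, Nat.cast_sub (by omega),
      Nat.cast_sub (by omega)]
    push_cast
    ring_nf

section Left

variable (hN : 0 < N) (hG : p.Generic αm βm) (hζ : sinh p.ζm ≠ 0) (hκ : p.κm ≠ 0)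
  (h₁ : sinh αm * cosh βm = sinh p.ζm / (2 * p.κm))
  (h₂ : cosh αm * sinh βm = cosh p.ζm / (2 * p.κm)) (hβ : ∀ m : ℤ, sinh ((β + m) * p.η) ≠ 0)
  (hL : p.LowerGauge α β)
include hN hG hζ hκ h₁ h₂ hβ hL

theorem isLeftPseudoDiagonal_leftB : IsLeftPseudoDiagonal (p.opB α (β - 2))
    (p.leftB αm βm α (β - 2)) (p.leftB αm βm α (β - 4)) (p.leftVal α (β - 2)) := by
  have hb2 : sinh ((β - 2) * p.η) ≠ 0 := by simpa [sub_eq_add_neg] using hβ (-2)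
  have hb4 : sinh ((β - 4) * p.η) ≠ 0 := by simpa [sub_eq_add_neg] using hβ (-4)
  rw [funext (leftB_eq_sepConf hG hb2), funext (leftB_eq_sepConf hG hb4)]
  refine isLeftPseudoDiagonal_of_sepVal hN hG (z := p.gaugeParam α (β - 2))
    (by simpa using refFactor_left_ne_zero hζ hL hN)
    (isStateBasis_sepConf hG hζ hκ h₁ h₂ fun j hj => refFactor_left_ne_zero hζ hL hj)
    (fun h l => ?_) Function.injective_id
    (fun _ => inv_ne_zero (p.gaugeParam_neg_sub_ne_zero (α := α) hb2)) fun h l => p.leftVal_eq h l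
  rw [opB_eq p hb2, vecMul_smul, sepConf_vecMul_Bz, smul_smul, leftVal_eq, ← gaugeParam_sub_two,
    sub_sub]
  norm_num

theorem isLeftSOV_leftB (hζp : sinh p.ζp ≠ 0) (hU : p.UpperGauge α β) :
    IsLeftSOV p.transfer p.spectralClass p.sep
      (fun n => p.aPlus α (β - 1) (-p.sep n 0) * p.AMinus αm βm (-p.sep n 0))
      (fun n => p.aPlus α (β - 1) (p.sep n 1) * p.AMinus αm βm (p.sep n 1))
      (p.leftB αm βm α (β - 2)) := by
  have hb2 : sinh ((β - 2) * p.η) ≠ 0 := by simpa [sub_eq_add_neg] using hβ (-2)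
  have hb : sinh ((β - 1 + 1) * p.η) ≠ 0 := by simpa using hβ 0
  rw [UpperGauge] at hU
  have hz := (gauge_condition_iff _ _ _ _).2 hU
  rw [show exp (-((α - β + 2) * p.η)) = exp p.η * p.gaugeParam α (β - 2) by
    rw [gaugeParam, ← Complex.exp_add]; ring_nf] at hz
  have ha : p.aPlus α (β - 1) = p.transferCoeff (p.gaugeParam α (β - 2)) := funext fun l => by
    rw [p.aPlus_eq_transferCoeff hb (by rw [← hU]; ring_nf), sub_sub]
    norm_num
  rw [funext (leftB_eq_sepConf hG hb2), ha]
  exact isLeftSOV_transfer hN hG hζ hζp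
    (isStateBasis_sepConf hG hζ hκ h₁ h₂ fun j hj => refFactor_left_ne_zero hζ hL hj) fun n h =>
      ⟨sepConf_vecMul_transfer hG hζ hκ h₁ h₂ hζp hz n h (Or.inl rfl),
        sepConf_vecMul_transfer hG hζ hκ h₁ h₂ hζp hz n h (Or.inr rfl)⟩

variable (hn : ∀ n, sinh (2 * p.ξ n + β * p.η) ≠ 0)
include hn

omit hN in
theorem isStateBasis_rightB : IsStateBasis (p.rightB αm βm α β) := by
  have hb : sinh (β * p.η) ≠ 0 := by simpa using hβ 0
  rw [funext (rightB_eq_sepConf hG hb)]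
  exact (isStateBasis_sepConf hG.dual hζ hκ h₁ h₂
    fun j hj => refFactor_right_ne_zero hζ hL hj).smul_flip (rightCoeff_ne_zero hG hb hn)

theorem isRightPseudoDiagonal_rightB (hn' : ∀ n, sinh (2 * p.ξ n + (β + 2) * p.η) ≠ 0) :
    IsRightPseudoDiagonal (p.opB α β) (p.rightB αm βm α β) (p.rightB αm βm α (β + 2))
      (p.rightVal α β) := by
  have hb : sinh (β * p.η) ≠ 0 := by simpa using hβ 0
  have hb2 : sinh ((β + 2) * p.η) ≠ 0 := by simpa using hβ 2
  have hval := rightVal_eq hG hb hb2 hn hn' (α := α)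
  have hc := rightCoeff_ne_zero (α := α) hG hb hn
  have hc' := rightCoeff_ne_zero (α := α) hG hb2 hn'
  have hk : (p.gaugeParam α (-β) - p.gaugeParam α β)⁻¹ * (-p.gaugeParam α β ^ 2) ≠ 0 :=
    mul_ne_zero (inv_ne_zero (p.gaugeParam_neg_sub_ne_zero hb))
      (neg_ne_zero.2 (pow_ne_zero 2 (p.gaugeParam_ne_zero α β)))
  refine IsLeftPseudoDiagonal.transpose (isLeftPseudoDiagonal_of_sepVal hN hG.dual
    (z := -(p.gaugeParam α β)⁻¹) (by simpa using refFactor_right_ne_zero hζ hL hN)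
    (isStateBasis_rightB hG hζ hκ h₁ h₂ hβ hL hn) (fun h l => ?_) flipConf_injective
    (c := fun h => p.rightCoeff αm βm α β h * ((p.gaugeParam α (-β) - p.gaugeParam α β)⁻¹ *
      (-p.gaugeParam α β ^ 2)) / p.rightCoeff αm βm α (β + 2) h)
    (fun h => div_ne_zero (mul_ne_zero (hc h) hk) (hc' h)) fun h l => ?_)
  · have hz : -(p.gaugeParam α β)⁻¹ * exp (-(2 * p.dual.η)) = -(p.gaugeParam α (β + 2))⁻¹ := by
      rw [gaugeParam, gaugeParam, ← Complex.exp_neg, ← Complex.exp_neg, neg_mul,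
        ← Complex.exp_add]
      simp only [dual]
      ring_nf
    rw [rightB_eq_sepConf hG hb, rightB_eq_sepConf hG hb2, opB_eq p hb, transpose_smul,
      Bz_transpose p (p.gaugeParam_ne_zero α β), smul_smul, vecMul_smul, smul_vecMul,
      sepConf_vecMul_Bz, hz, smul_smul, smul_smul, smul_smul, mul_comm (p.rightVal α β h l), hval]
    congr 1
    ring
  · rw [div_mul_eq_mul_div, eq_div_iff (hc' h), mul_comm, hval]

theorem isRightSOV_rightB (hζp : sinh p.ζp ≠ 0) (hU : p.UpperGauge α β) :
    IsRightSOV p.transfer p.spectralClass p.sep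
      (fun n => p.dPlus α (β - 1) (-p.sep n 0) * (p.AMinus αm βm (p.sep n 1) / p.fNorm β n))
      (fun n => p.dPlus α (β - 1) (p.sep n 1) * (p.fNorm β n * p.AMinus αm βm (-p.sep n 0)))
      (p.rightB αm βm α β) := by
  have hb : sinh (β * p.η) ≠ 0 := by simpa using hβ 0
  have hb2 : sinh ((β - 1 - 1) * p.η) ≠ 0 := by
    rw [sub_sub]; norm_num; simpa [sub_eq_add_neg] using hβ (-2)
  rw [UpperGauge] at hU
  have hd : p.dPlus α (β - 1) = p.dual.transferCoeff (-(p.gaugeParam α β)⁻¹) := funext fun l => by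
    rw [dPlus_eq_transferCoeff hb2 (by rw [← hU]; ring_nf), sub_add_cancel]
  -- The condition of the dual chain at -1/z is the original gauge condition multiplied by an
  -- exponential.
  have hz : p.dual.κp * ((exp p.dual.η * -(p.gaugeParam α β)⁻¹) ^ 2 * exp (-p.dual.τp) -
      exp p.dual.τp) = exp p.dual.η * -(p.gaugeParam α β)⁻¹ * exp (-p.dual.ζp) := by
    have e : exp p.dual.η * -(p.gaugeParam α β)⁻¹ = -exp ((α - β + 2) * p.η) := by
      rw [gaugeParam, ← Complex.exp_neg, mul_neg, ← Complex.exp_add]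
      simp only [dual]
      ring_nf
    rw [e]
    simp only [dual, neg_neg]
    have e1 : 2 * sinh ((α - β + 2) * p.η + p.τp) * exp ((α - β + 2) * p.η) =
        exp ((α - β + 2) * p.η) ^ 2 * exp p.τp - exp (-p.τp) := by
      rw [Complex.sinh, neg_add, Complex.exp_add, Complex.exp_add, Complex.exp_neg,
        Complex.exp_neg]
      field_simp
    linear_combination exp ((α - β + 2) * p.η) * hU - p.κp * e1
  refine isRightSOV_transfer hN hG hζ hζp (isStateBasis_rightB hG hζ hκ h₁ h₂ hβ hL hn)
    fun n h => ?_
  have key : ∀ l, l = p.sep n (h n) ∨ l = -p.sep n (h n) →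
      p.rightB αm βm α β h ᵥ* (p.transfer l)ᵀ =
      sepShift (fun n => p.dPlus α (β - 1) (-p.sep n 0) *
          (p.AMinus αm βm (p.sep n 1) / p.fNorm β n))
        (fun n => p.dPlus α (β - 1) (p.sep n 1) *
          (p.fNorm β n * p.AMinus αm βm (-p.sep n 0))) n (p.rightB αm βm α β) h := by
    intro l hl
    have e0 : p.dual.sep n 0 = -p.sep n 1 := p.dual_sep n 1
    have e1 : p.dual.sep n 1 = -p.sep n 0 := p.dual_sep n 0
    have hr := rightRatio_ne_zero hG hb (hn n)
    have hA := (hG.2.2 n).1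
    have hA' := (hG.2.2 n).2
    have hf := fNorm_ne_zero hG hb (hn n)
    have hrr : p.rightRatio αm βm β n =
        p.AMinus αm βm (p.sep n 1) / (p.fNorm β n * p.AMinus αm βm (-p.sep n 0)) := by
      rw [rightRatio, sep_one, sep_zero, neg_sub, add_comm]
    rw [← neg_sub, ← sep_zero] at hA
    rw [add_comm, ← sep_one] at hA'
    have h3 := sepConf_vecMul_transfer hG.dual (p := p.dual) hζ hκ h₁ h₂ hζp hz n (flipConf h)
      (l := l) (by rw [flipConf, dual_sep, neg_neg]; exact hl.symm)
    rw [transfer_transpose, funext (rightB_eq_sepConf hG hb), smul_vecMul, h3, hd, sepShift,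
      sepShift, dual_AMinus, dual_AMinus, e0, e1, neg_neg]
    have h4 : h n = 0 ∨ h n = 1 := by omega
    -- The flip exchanges raising and lowering; changing one spin changes `rightCoeff` by
    -- `rightRatio`, which produces the factors f_n and exchanges the two values of 𝖠₋.
    rcases h4 with h4 | h4
    · rw [if_neg (by simp [flipConf, h4]), if_pos h4, flipConf_update, rightCoeff_update α β h4,
        smul_smul, smul_smul, hrr]
      congr 1
      field_simp
    · have h5 := rightCoeff_update (p := p) (αm := αm) (βm := βm) α β
        (h := Function.update h n 0) (n := n) (by simp)
      rw [Function.update_idem, ← h4, Function.update_eq_self] at h5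
      rw [if_pos (by simp [flipConf, h4]), if_neg (by simp [h4]), flipConf_update, h5,
        smul_smul, smul_smul, hrr]
      congr 1
      field_simp
  exact ⟨key _ (Or.inl rfl), key _ (Or.inr rfl)⟩

end Left

theorem leftC_eq_leftB (hb : sinh (β * p.η) ≠ 0) :
    p.leftC αm βm α (β + 2) = p.leftB αm βm α (-β) := by
  funext h
  simp only [leftC, leftB, add_sub_cancel_right, opD_eq_opA p hb]
  rw [show 2 - (β + 2) = -β by ring, show -β + 2 = 2 - β by ring]

theorem rightC_eq_rightB (hb : sinh ((2 - β) * p.η) ≠ 0) :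
    p.rightC αm βm α β = p.rightB αm βm α (2 - β) := by
  funext h
  simp only [rightC, rightB, opD_eq_opA p hb]
  rw [show 2 - (2 - β) = β by ring, show -(2 - β) + 2 = β by ring]

end Chain

end Representations

end OpenXXZ

theorem mainTheorem9 (N : ℕ) (hN : 0 < N) (p : OpenXXZ.Chain N) (αm βm αp βp α β : ℂ)
    (hζm : Complex.sinh p.ζm ≠ 0) (hζp : Complex.sinh p.ζp ≠ 0)
    (hκm : p.κm ≠ 0) (hκp : p.κp ≠ 0)
    (hm₁ : Complex.sinh αm * Complex.cosh βm = Complex.sinh p.ζm / (2 * p.κm))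
    (hm₂ : Complex.cosh αm * Complex.sinh βm = Complex.cosh p.ζm / (2 * p.κm))
    (hp₁ : Complex.sinh αp * Complex.cosh βp = Complex.sinh p.ζp / (2 * p.κp))
    (hp₂ : Complex.cosh αp * Complex.sinh βp = Complex.cosh p.ζp / (2 * p.κp))
    (hβ : ∀ m : ℤ, Complex.sinh ((β + m) * p.η) ≠ 0) :
    -- the `ℬ₋` representations
    ((∃ k : ℤ, (α - β + 2) * p.η =
        -p.τp + (-1) ^ k * (αp - βp) + Complex.I * Real.pi * k) →
      (∀ l, p.KL α (β - 1) l 0 1 = 0 ∧ p.KR α (β - 1) l 0 1 = 0) ∧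
      (p.Generic αm βm →
        (∀ (j : Fin N) (k : ℤ), (α - β) * p.η ≠
          ((N : ℂ) - 3 - 2 * ((j : ℕ) : ℂ)) * p.η - p.τm - (-1) ^ k * (αm + βm)
            + Complex.I * Real.pi * k) →
        (OpenXXZ.IsLeftPseudoDiagonal (p.opB α (β - 2)) (p.leftB αm βm α (β - 2))
            (p.leftB αm βm α (β - 4)) (p.leftVal α (β - 2)) ∧
          OpenXXZ.IsLeftSOV p.transfer p.spectralClass p.sep
            (fun n => p.aPlus α (β - 1) (-p.sep n 0) * p.AMinus αm βm (-p.sep n 0))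
            (fun n => p.aPlus α (β - 1) (p.sep n 1) * p.AMinus αm βm (p.sep n 1))
            (p.leftB αm βm α (β - 2))) ∧
        ((∀ n, Complex.sinh (2 * p.ξ n + β * p.η) ≠ 0 ∧
            Complex.sinh (2 * p.ξ n + (β + 2) * p.η) ≠ 0) →
          OpenXXZ.IsRightPseudoDiagonal (p.opB α β) (p.rightB αm βm α β)
            (p.rightB αm βm α (β + 2)) (p.rightVal α β) ∧
          OpenXXZ.IsRightSOV p.transfer p.spectralClass p.sep
            (fun n => p.dPlus α (β - 1) (-p.sep n 0) *
              (p.AMinus αm βm (p.sep n 1) / p.fNorm β n))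
            (fun n => p.dPlus α (β - 1) (p.sep n 1) *
              (p.fNorm β n * p.AMinus αm βm (-p.sep n 0)))
            (p.rightB αm βm α β)))) ∧
    -- the `𝒞₋` representations
    ((∃ k : ℤ, (α + β) * p.η =
        -p.τp + (-1) ^ k * (αp - βp) + Complex.I * Real.pi * k) →
      (∀ l, p.KL α (β - 1) l 1 0 = 0 ∧ p.KR α (β - 1) l 1 0 = 0) ∧
      (p.Generic αm βm →
        (∀ (j : Fin N) (k : ℤ), (α + β) * p.η ≠
          ((N : ℂ) - 1 - 2 * ((j : ℕ) : ℂ)) * p.η - p.τm - (-1) ^ k * (αm + βm)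
            + Complex.I * Real.pi * k) →
        (OpenXXZ.IsLeftPseudoDiagonal (p.opC α (β + 2)) (p.leftC αm βm α (β + 2))
            (p.leftC αm βm α (β + 4)) (p.leftVal α (-β)) ∧
          OpenXXZ.IsLeftSOV p.transfer p.spectralClass p.sep
            (fun n => p.aPlus α (1 - β) (-p.sep n 0) * p.AMinus αm βm (-p.sep n 0))
            (fun n => p.aPlus α (1 - β) (p.sep n 1) * p.AMinus αm βm (p.sep n 1))
            (p.leftC αm βm α (β + 2))) ∧
        ((∀ n, Complex.sinh (2 * p.ξ n + (2 - β) * p.η) ≠ 0 ∧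
            Complex.sinh (2 * p.ξ n + (4 - β) * p.η) ≠ 0) →
          OpenXXZ.IsRightPseudoDiagonal (p.opC α β) (p.rightC αm βm α β)
            (p.rightC αm βm α (β - 2)) (p.rightVal α (2 - β)) ∧
          OpenXXZ.IsRightSOV p.transfer p.spectralClass p.sep
            (fun n => p.dPlus α (1 - β) (-p.sep n 0) *
              (p.AMinus αm βm (p.sep n 1) / p.fNorm (2 - β) n))
            (fun n => p.dPlus α (1 - β) (p.sep n 1) *
              (p.fNorm (2 - β) n * p.AMinus αm βm (-p.sep n 0)))
            (p.rightC αm βm α β)))) := by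
  have hβ₀ : Complex.sinh (β * p.η) ≠ 0 := by simpa using hβ 0
  have hβ' : ∀ m : ℤ, Complex.sinh ((2 - β + m) * p.η) ≠ 0 := fun m => by
    have := neg_ne_zero.2 (hβ (-2 - m))
    rw [← Complex.sinh_neg] at this
    convert this using 2
    push_cast
    ring
  have hβ₂ : Complex.sinh ((2 - β) * p.η) ≠ 0 := by simpa using hβ' 0
  have hβ₃ : Complex.sinh ((β - 2) * p.η) ≠ 0 := by simpa [sub_eq_add_neg] using hβ (-2)
  have hβ₄ : Complex.sinh ((β + 2 - 2) * p.η) ≠ 0 := by rwa [add_sub_cancel_right]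
  refine ⟨fun hk => ?_, fun hk => ?_⟩
  · have hU := OpenXXZ.Chain.upperGauge_of_exists hκp hp₁ hp₂ hk
    refine ⟨OpenXXZ.Chain.KL_KR_apply_zero_one hU, fun hG hne => ?_⟩
    have hL := OpenXXZ.Chain.lowerGauge_of_forall hκm hm₁ hm₂ hne
    exact ⟨⟨OpenXXZ.Chain.isLeftPseudoDiagonal_leftB hN hG hζm hκm hm₁ hm₂ hβ hL,
        OpenXXZ.Chain.isLeftSOV_leftB hN hG hζm hκm hm₁ hm₂ hβ hL hζp hU⟩,
      fun hn => ⟨OpenXXZ.Chain.isRightPseudoDiagonal_rightB hN hG hζm hκm hm₁ hm₂ hβ hL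
          (fun n => (hn n).1) fun n => (hn n).2,
        OpenXXZ.Chain.isRightSOV_rightB hN hG hζm hκm hm₁ hm₂ hβ hL (fun n => (hn n).1) hζp hU⟩⟩
  -- Everything for 𝒞₋ is the ℬ₋ case at 2 - β, and the two conditions on the gauge translate
  -- accordingly.
  · have hU : p.UpperGauge α (2 - β) := OpenXXZ.Chain.upperGauge_of_exists hκp hp₁ hp₂ <| by
      simpa only [show α - (2 - β) + 2 = α + β by ring] using hk
    refine ⟨OpenXXZ.Chain.KL_KR_apply_one_zero hU, fun hG hne => ?_⟩
    have hL : p.LowerGauge α (2 - β) :=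
      OpenXXZ.Chain.lowerGauge_of_forall hκm hm₁ hm₂ fun j k h => hne j k (by
        linear_combination h)
    have hL₁ := OpenXXZ.Chain.isLeftPseudoDiagonal_leftB hN hG hζm hκm hm₁ hm₂ hβ' hL
    have hL₂ := OpenXXZ.Chain.isLeftSOV_leftB hN hG hζm hκm hm₁ hm₂ hβ' hL hζp hU
    have e₁ : p.leftC αm βm α (β + 4) = p.leftB αm βm α (-(β + 2)) := by
      rw [← OpenXXZ.Chain.leftC_eq_leftB (by simpa using hβ 2), add_assoc]
      norm_num
    have e₂ : p.opC α (β + 2) = p.opB α (-β) := funext fun l => by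
      rw [p.opC_eq_opB hβ₄, sub_add_cancel_right]
    have e₃ : p.opC α β = p.opB α (2 - β) := funext fun l => p.opC_eq_opB hβ₃ l
    have e₄ : p.rightC αm βm α (β - 2) = p.rightB αm βm α (2 - β + 2) := by
      rw [OpenXXZ.Chain.rightC_eq_rightB, sub_sub_eq_add_sub, sub_add_eq_add_sub]
      simpa [sub_sub_eq_add_sub, sub_add_eq_add_sub] using hβ' 2
    rw [show 2 - β - 2 = -β by ring, show 2 - β - 4 = -(β + 2) by ring] at hL₁
    rw [show 2 - β - 2 = -β by ring, show 2 - β - 1 = 1 - β by ring] at hL₂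
    refine ⟨?_, fun hn => ?_⟩
    · rw [e₁, e₂, OpenXXZ.Chain.leftC_eq_leftB hβ₀]
      exact ⟨hL₁, hL₂⟩
    · have hR₁ := OpenXXZ.Chain.isRightPseudoDiagonal_rightB hN hG hζm hκm hm₁ hm₂ hβ' hL
        (fun n => (hn n).1) fun n => by
          rw [show 2 - β + 2 = 4 - β by ring]; exact (hn n).2
      have hR₂ := OpenXXZ.Chain.isRightSOV_rightB hN hG hζm hκm hm₁ hm₂ hβ' hL
        (fun n => (hn n).1) hζp hU
      rw [show 2 - β - 1 = 1 - β by ring] at hR₂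
      rw [e₃, e₄, OpenXXZ.Chain.rightC_eq_rightB hβ₂]
      exact ⟨hR₁, hR₂⟩
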